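/- Let $F$ be a distribution function on $\mathbb R$, $F^\leftarrow(u)=\inf\{x:F(x)\ge u\}$, and $U(t)=F^\leftarrow(1-1/t)$, $t>1$, its tail quantile function. Let $\gamma>0$ and $\rho\le 0$; throughout $(x^\rho-1)/\rho$ is read as $\log x$ (and $(x^{\rho/\gamma}-1)/\rho$ as $\log(x)/\gamma$) when $\rho=0$. Assume the second-order condition \[ \lim_{t\to\infty}\frac{U(tx)/U(t)-x^\gamma}{A(t)}=x^\gamma\,\frac{x^\rho-1}{\rho},\qquad x>0, \] where $A$ is eventually positive or eventually negative, $A(t)\to0$ as $t\to\infty$, and $A(tx)/A(t)\to x^\rho$ for all $x>0$. Let $Z_1,Z_2,\dots$ be i.i.d. with the unit Pareto law $\mathbb P(Z_i>z)=1/z$, $z\ge1$, and let $X_i=U(Z_i)$, which are i.i.d. with distribution function $F$. Denote by $Z_{1,n}\le\dots\le Z_{n,n}$ and $X_{1,n}\le\dots\le X_{n,n}$ the order statistics of the first $n$ variables. For $1\le k<n$ put \[ \Pi_{n,k}=\frac1k\sum_{i=1}^k\varepsilon_{X_{n+1-i,n}/X_{n-k,n}},\qquad \hat\gamma_{n,k}=\frac1k\sum_{i=1}^k\log\frac{X_{n+1-i,n}}{X_{n-k,n}},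 \] \[ \Pi^*_{k,t}=\frac1k\sum_{i=1}^k\varepsilon_{X_i^*\left|1+A(t)\frac{(X_i^*)^{\rho/\gamma}-1}{\rho}\right|}, \] where $\varepsilon_x$ is the Dirac mass at $x$ and $X_1^*,\dots,X_k^*$ are i.i.d. with distribution function $1-x^{-1/\gamma}$, $x>1$. (If $\rho<0$, or if $A$ is eventually positive, the absolute value has no effect once $t$ is large.) For $p\in[1,\infty)$ and a distance $d$, let $W_p(P_1,P_2)=\inf\|d(Y_1,Y_2)\|_{L^p}$, the infimum being over all couplings $(Y_1,Y_2)$ of $P_1,P_2$. Let $W_p^{(2)}$ be the distance so obtained between laws of random probability measures on $(0,\infty)$, when the distance between two measures is their $W_p$ distance for $d(x,y)=|\log x-\log y|$. For laws on $\mathbb R$, $W_p$ refers to the usual distance. Let $p\in[1,\infty)$. 1. Let $t_0\ge1$ with $U(t_0)>0$. For all $1\le k<n$, a version of the regular conditional distribution of $\Pi_{n,k}$ given $Z_{n-k,n}$ satisfies, for every $t\ge t_0$, \[ W_p^{(2)}\bigl(P_{\Pi_{n,k}\mid Z_{n-k,n}=t},P_{\Pi^*_{k,t}}\bigr)\le\left(\int_1^\infty\left|\log\frac{U(zt)}{z^\gamma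 U(t)}-\log\left|1+A(t)\frac{z^\rho-1}{\rho}\right|\right|^p\frac{dz}{z^2}\right)^{1/p}, \] and any version satisfies it for almost every $t\ge t_0$ with respect to the law of $Z_{n-k,n}$. The right-hand side, which does not depend on $n$ and $k$, is $o(A(t))$ as $t\to\infty$. 2. Let $k=k(n)$ be an intermediate sequence, i.e. $k\to\infty$ and $k/n\to0$, and let $b(\rho)=\int_1^\infty\frac{z^\rho-1}{\rho}\frac{dz}{z^2}$. Then, as $n\to\infty$, for any versions of the conditional laws, \[ W_p\Bigl(P_{\sqrt k(\hat\gamma_{n,k}-\gamma)\mid Z_{n-k,n}},\ \mathcal N\bigl(\sqrt k\,A(n/k)\,b(\rho),\gamma^2\bigr)\Bigr)=O_P\bigl(1/\sqrt k\bigr)+o_P\bigl(\sqrt k\,A(n/k)\bigr). \] 3. If moreover $\sqrt k\,A(n/k)\to\lambda\in\mathbb R$, then $\sqrt k(\hat\gamma_{n,k}-\gamma)$ converges in distribution to $\mathcal N(\lambda b(\rho),\gamma^2)$, and it is asymptotically independent of the threshold $X_{n-k,n}$: for all $x\in\mathbb R$ and all Borel sets $B_n\subset\mathbb R$, \[ \mathbb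 P\bigl(\sqrt k(\hat\gamma_{n,k}-\gamma)\le x,\ X_{n-k,n}\in B_n\bigr)-\mathbb P\bigl(\sqrt k(\hat\gamma_{n,k}-\gamma)\le x\bigr)\,\mathbb P\bigl(X_{n-k,n}\in B_n\bigr)\to0 . \] -/

import Mathlib

open MeasureTheory ProbabilityTheory Filter Topology
open scoped ENNReal NNReal

namespace HillBias

noncomputable section

/-- The Wasserstein distance of order `p` between two measures on a measurable space `α`, for the
distance `c` on `α`: the infimum over all couplings `q` of the `L^p`-norm of the distance.
Taking `α` to be a space of measures and `c` a Wasserstein distance iterates the construction. -/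
def wasserstein {α : Type*} [MeasurableSpace α] (c : α → α → ℝ≥0∞) (p : ℝ) (μ ν : Measure α) :
    ℝ≥0∞ :=
  ⨅ (q : Measure (α × α)) (_ : q.map Prod.fst = μ ∧ q.map Prod.snd = ν),
    (∫⁻ z, c z.1 z.2 ^ p ∂q) ^ (1 / p)

/-- The logarithmic distance `|log x - log y|`; a distance on `(0, ∞)`, hence on `[1, ∞)`. It is
only used for measures that are concentrated on `(0, ∞)`, whose couplings are concentrated on
`(0, ∞) × (0, ∞)`. -/
def logDist (x y : ℝ) : ℝ≥0∞ := ENNReal.ofReal |Real.log x - Real.log y|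

/-- The distance `W_p^{(2)}` between the laws of two random probability measures, the underlying
distance being the logarithmic one. -/
def wasserstein₂ (p : ℝ) (Q₁ Q₂ : Measure (ProbabilityMeasure ℝ)) : ℝ≥0∞ :=
  wasserstein (fun π₁ π₂ : ProbabilityMeasure ℝ =>
    wasserstein logDist p (π₁ : Measure ℝ) (π₂ : Measure ℝ)) p Q₁ Q₂

/-- The empirical measure `(1/k) ∑ ε_{x_i}` of `k ≥ 1` real numbers. -/
def empirical (k : ℕ) (hk : 0 < k) (x : Fin k → ℝ) : ProbabilityMeasure ℝ :=
  ⟨(k : ℝ≥0∞)⁻¹ • ∑ i, Measure.dirac (x i), by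
    constructor
    simp [ENNReal.inv_mul_cancel (Nat.cast_ne_zero.mpr hk.ne') (ENNReal.natCast_ne_top k)]⟩

/-- The order statistic `x_{m,n}`, the `m`-th smallest of `x_1, …, x_n`, for `1 ≤ m ≤ n`. -/
def orderStat {n : ℕ} (x : Fin n → ℝ) (m : ℕ) : ℝ :=
  if h : 0 < m ∧ m ≤ n then x (Tuple.sort x ⟨m - 1, by omega⟩) else 0

/-- The relative exceedances `x_{n+1-i,n} / x_{n-k,n}`, `i = 1, …, k` (here `i` starts at `0`). -/
def relExceed {n : ℕ} (k : ℕ) (x : Fin n → ℝ) : Fin k → ℝ :=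
  fun i => orderStat x (n - i) / orderStat x (n - k)

/-- The Hill estimator `(1/k) ∑_{i=1}^k log (x_{n+1-i,n} / x_{n-k,n})`. -/
def hill {n : ℕ} (k : ℕ) (x : Fin n → ℝ) : ℝ :=
  (1 / (k : ℝ)) * ∑ i, Real.log (relExceed k x i)

/-- The tail quantile function `U(t) = F^←(1 - 1/t)`, `t > 1`, of a law on the line with
distribution function `F`, where `F^←(u) = inf {x | F(x) ≥ u}`. -/
def tailQuantile (μ : Measure ℝ) (t : ℝ) : ℝ := sInf {x : ℝ | 1 - 1 / t ≤ cdf μ x}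

/-- `(x^ρ - 1)/ρ`, with its limit `log x` when `ρ = 0`. -/
def boxCox (ρ x : ℝ) : ℝ := if ρ = 0 then Real.log x else (x ^ ρ - 1) / ρ

/-- The second order condition with auxiliary function `A`, for a heavy-tailed law with tail
quantile function `U`, index `γ > 0` and second order parameter `ρ ≤ 0`. -/
structure SecondOrder (U A : ℝ → ℝ) (γ ρ : ℝ) : Prop where
  sign : (∀ᶠ t in atTop, 0 < A t) ∨ (∀ᶠ t in atTop, A t < 0)
  tendsto_zero : Tendsto A atTop (𝓝 0)
  regVar : ∀ x : ℝ, 0 < x → Tendsto (fun t => A (t * x) / A t) atTop (𝓝 (x ^ ρ))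
  limit : ∀ x : ℝ, 0 < x →
    Tendsto (fun t => (U (t * x) / U t - x ^ γ) / A t) atTop (𝓝 (x ^ γ * boxCox ρ x))

/-- The bias-corrected Pareto point `x |1 + a (x^{ρ/γ} - 1)/ρ|`, since
`(x^{ρ/γ} - 1)/ρ = boxCox ρ (x^{1/γ})`. -/
def correctedPoint (γ ρ a x : ℝ) : ℝ := x * |1 + a * boxCox ρ (x ^ (1 / γ))|

/-- The law of the bias-corrected Pareto empirical measure, built on `k` i.i.d. variables with
distribution function `1 - x^{-1/γ}`, `x > 1`, where `a` is the value `A(t)`. -/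
def correctedLaw (γ ρ a : ℝ) (k : ℕ) (hk : 0 < k) : Measure (ProbabilityMeasure ℝ) :=
  (Measure.pi fun _ : Fin k => paretoMeasure 1 (1 / γ)).map
    fun x => empirical k hk fun i => correctedPoint γ ρ a (x i)

/-- `(∫_1^∞ |log (U(zt)/(z^γ U(t))) - log |1 + A(t) (z^ρ - 1)/ρ||^p dz/z²)^{1/p}`. -/
def bound (U A : ℝ → ℝ) (γ ρ p t : ℝ) : ℝ≥0∞ :=
  (∫⁻ z in Set.Ioi (1 : ℝ), ENNReal.ofReal
    (|Real.log (U (z * t) / (z ^ γ * U t)) - Real.log (|1 + A t * boxCox ρ z|)| ^ p / z ^ 2))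
      ^ (1 / p)

/-- `b(ρ) = ∫_1^∞ ((z^ρ - 1)/ρ) dz/z²`. -/
def bias (ρ : ℝ) : ℝ := ∫ z in Set.Ioi (1 : ℝ), boxCox ρ z / z ^ 2

/-- Intermediate sequence: `k(n) → ∞` and `k(n)/n → 0`. -/
def IsIntermediate (k : ℕ → ℕ) : Prop :=
  Tendsto k atTop atTop ∧ Tendsto (fun n => (k n : ℝ) / n) atTop (𝓝 0)

/-- `R_n = O_P(a_n)` as `n → ∞`. -/
def IsBigOP {Ω : Type*} [MeasurableSpace Ω] (P : Measure Ω) (R : ℕ → Ω → ℝ≥0∞) (a : ℕ → ℝ) :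
    Prop :=
  ∀ ε : ℝ≥0∞, 0 < ε → ∃ M : ℝ, ∀ᶠ n in atTop, P {ω | ENNReal.ofReal (M * |a n|) < R n ω} ≤ ε

/-- `R_n = o_P(a_n)` as `n → ∞`. -/
def IsLittleOP {Ω : Type*} [MeasurableSpace Ω] (P : Measure Ω) (R : ℕ → Ω → ℝ≥0∞) (a : ℕ → ℝ) :
    Prop :=
  ∀ c : ℝ, 0 < c → Tendsto (fun n => P {ω | ENNReal.ofReal (c * |a n|) < R n ω}) atTop (𝓝 0)

/-- The sample `X_i = U(Z_i)`, `i = 1, …, n`. -/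
def sample {Ω : Type*} (U : ℝ → ℝ) (Z : ℕ → Ω → ℝ) (n : ℕ) (ω : Ω) : Fin n → ℝ :=
  fun i => U (Z i ω)

/-- The threshold variable `Z_{n-k,n}`. -/
def threshold {Ω : Type*} (Z : ℕ → Ω → ℝ) (n k : ℕ) (ω : Ω) : ℝ :=
  orderStat (fun i : Fin n => Z i ω) (n - k)

/-- The normalized error `√k (γ̂_{n,k} - γ)` of the Hill estimator. -/
def hillError {Ω : Type*} (U : ℝ → ℝ) (Z : ℕ → Ω → ℝ) (γ : ℝ) (n k : ℕ) (ω : Ω) : ℝ :=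
  Real.sqrt k * (hill k (sample U Z n ω) - γ)

end

end HillBias

open HillBias

/-! Given $Z_{n-k,n}=t$, the larger values are, up to order, $t$ times an i.i.d. unit Pareto sample
$Y_1,\dots,Y_k$. The empirical measure and the Hill estimator ignore the order, so their conditional
laws are explicit: they are laws of functions of the $U(tY_i)/U(t)$ (`hasCondDistrib_scaledKernel`).
Everything is thereby reduced to one Pareto sample and a parameter $t$.

Since $Y_i^\gamma$ has the law of $X_i^*$, the same sample can drive both empirical measures.
Matching atoms of equal index bounds $W_p^{(2)}$ by the $L^p$ norm of a single logarithmic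
discrepancy, free of $n$ and $k$ (`wasserstein₂_scaledKernel_le`). With $\ell(t)=\log
U(t)-\gamma\log t$ and $h(z)=(z^\rho-1)/\rho$, both $(\ell(tz)-\ell(t))/A(t)$ and
$\log|1+A(t)h(z)|/A(t)$ tend to $h(z)$ in $L^p(dz/z^2)$, so the discrepancy is $o(A(t))$. Domination
of the former is a Potter bound, obtained from the measurability of $U$ by a Steinhaus type argument
(`eventually_forall_increment_le`, `potter`). The latter is delicate only if $\rho=0$ and $A<0$: the
logarithm is then singular at $z=e^{1/|A(t)|}$, where the Pareto law has exponentially small mass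
(`tendsto_eLpNorm_singular`).

The normalized Hill error is $\gamma\sqrt k(k^{-1}\sum\log Y_i-1)+\sqrt k\,A(t)\,k^{-1}\sum h(Y_i)$
plus a remainder. The sum of logarithms is a Gamma variable. Likelihood ratio comparisons show that
one transform of it is stochastically smaller, and another larger, than a standard normal variable;
the quantile coupling turns this into pointwise bounds, with an $L^p$ error of order $1/\sqrt k$
(`exists_eLpNorm_sub_coupledNormal_le`). A law of large numbers in $L^p$ replaces the average of $h$
by $b(\rho)$. Chebyshev's inequality for the number of exceedances puts the threshold within a
factor $e^{\pm\eta}$ of $n/k$, where $A(t)$ is close to $A(n/k)$.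

For such thresholds the conditional distribution function is uniformly close to a Gaussian one that
does not involve $t$. Integration over an arbitrary threshold event gives both the limit law and the
asymptotic independence (`SecondOrder.tendsto_joint`). -/

namespace HillBias

/-! ### Order statistics and vectors separated by their first coordinate. -/

section OrderStatistics

/-- Ties make the sorting permutation ambiguous, but not the sorted values, so any sorting
permutation may be used. -/
lemma orderStat_of_monotone {n : ℕ} {z : Fin n → ℝ} {σ : Equiv.Perm (Fin n)}
    (h : Monotone (z ∘ σ)) {m : ℕ} (hm : 0 < m) (hmn : m ≤ n) :
    orderStat z m = z (σ ⟨m - 1, by omega⟩) := by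
  rw [orderStat, dif_pos ⟨hm, hmn⟩]
  exact (congrFun (Tuple.comp_sort_eq_comp_iff_monotone.2 h) ⟨m - 1, by omega⟩).symm

lemma orderStat_comp_perm {n : ℕ} (z : Fin n → ℝ) (σ : Equiv.Perm (Fin n)) (m : ℕ) :
    orderStat (z ∘ σ) m = orderStat z m := by
  by_cases h : 0 < m ∧ m ≤ n
  · have hm : Monotone (z ∘ (σ * Tuple.sort (z ∘ σ) : Equiv.Perm (Fin n))) :=
      Tuple.monotone_sort (z ∘ σ)
    rw [orderStat_of_monotone hm h.1 h.2, orderStat, dif_pos h]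
    rfl
  · simp only [orderStat, dif_neg h]

lemma orderStat_comp_monotoneOn {n : ℕ} {U : ℝ → ℝ} {s : Set ℝ} (hU : MonotoneOn U s)
    {z : Fin n → ℝ} (hz : ∀ i, z i ∈ s) {m : ℕ} (hm : 0 < m) (hmn : m ≤ n) :
    orderStat (fun i => U (z i)) m = U (orderStat z m) := by
  have h1 : Monotone ((fun i => U (z i)) ∘ Tuple.sort z) := fun i j hij =>
    hU (hz _) (hz _) (Tuple.monotone_sort z hij)
  rw [orderStat_of_monotone h1 hm hmn, orderStat_of_monotone (Tuple.monotone_sort z) hm hmn]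

lemma orderStat_mem {n : ℕ} {s : Set ℝ} {z : Fin n → ℝ} (hz : ∀ i, z i ∈ s) {m : ℕ}
    (hm : 0 < m) (hmn : m ≤ n) : orderStat z m ∈ s := by
  rw [orderStat_of_monotone (Tuple.monotone_sort z) hm hmn]
  exact hz _

lemma orderStat_le_iff {n : ℕ} {z : Fin n → ℝ} {m : ℕ} (hm : 0 < m) (hmn : m ≤ n) (c : ℝ) :
    orderStat z m ≤ c ↔ m ≤ (Finset.univ.filter fun i => z i ≤ c).card := by
  have h := Tuple.lt_card_le_iff_apply_le_of_monotone (j := (⟨m - 1, by omega⟩ : Fin n))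
    (a := c) (Tuple.monotone_sort z)
  have e : (Finset.univ.filter fun i => (z ∘ Tuple.sort z) i ≤ c).card
      = (Finset.univ.filter fun i => z i ≤ c).card :=
    Finset.card_equiv (Tuple.sort z) (by simp)
  rw [orderStat_of_monotone (Tuple.monotone_sort z) hm hmn, ← e]
  refine h.symm.trans ?_
  change m - 1 < _ ↔ _
  omega

lemma orderStat_lt_iff {n : ℕ} {z : Fin n → ℝ} {m : ℕ} (hm : 0 < m) (hmn : m ≤ n) (c : ℝ) :
    orderStat z m < c ↔ m ≤ (Finset.univ.filter fun i => z i < c).card := by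
  have h := Tuple.lt_card_lt_iff_apply_lt_of_monotone (j := (⟨m - 1, by omega⟩ : Fin n))
    (a := c) (Tuple.monotone_sort z)
  have e : (Finset.univ.filter fun i => (z ∘ Tuple.sort z) i < c).card
      = (Finset.univ.filter fun i => z i < c).card :=
    Finset.card_equiv (Tuple.sort z) (by simp)
  rw [orderStat_of_monotone (Tuple.monotone_sort z) hm hmn, ← e]
  refine h.symm.trans ?_
  change m - 1 < _ ↔ _
  omega

@[fun_prop]
lemma measurable_orderStat {n : ℕ} (m : ℕ) : Measurable fun z : Fin n → ℝ => orderStat z m := by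
  by_cases h : 0 < m ∧ m ≤ n
  · refine measurable_of_Iic fun c => ?_
    have : (fun z : Fin n → ℝ => orderStat z m) ⁻¹' Set.Iic c
        = {z | m ≤ ∑ i, if z i ≤ c then 1 else 0} := by
      ext z
      simp only [Set.mem_preimage, Set.mem_Iic, Set.mem_ofPred_eq, orderStat_le_iff h.1 h.2,
        Finset.card_filter]
    rw [this]
    refine measurableSet_le measurable_const (Finset.measurable_sum _ fun i _ => ?_)
    exact Measurable.ite (measurableSet_le (measurable_pi_apply i) measurable_const)
      measurable_const measurable_const
  · simp only [orderStat, dif_neg h, measurable_const]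

/-- The first coordinate of `z` separates the next `k` coordinates, which are larger, from the
last `a` ones, which are smaller. -/
def Separated {α : Type*} [LT α] (k a : ℕ) (z : Fin (k + a + 1) → α) : Prop :=
  (∀ i : Fin k, z 0 < z (Fin.castAdd a i).succ) ∧ ∀ j : Fin a, z (Fin.natAdd k j).succ < z 0

/-- The vector made of the blocks `x`, `u` and `v`. -/
def blocks {α : Type*} {k a : ℕ} (x : α) (u : Fin k → α) (v : Fin a → α) : Fin (k + a + 1) → α :=
  Fin.cons x (Fin.append u v)

section blocks
variable {α : Type*} {k a : ℕ} (x : α) (u : Fin k → α) (v : Fin a → α)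

@[simp] lemma blocks_zero : blocks x u v 0 = x := rfl
@[simp] lemma blocks_castAdd (i : Fin k) : blocks x u v (Fin.castAdd a i).succ = u i := by
  simp [blocks]
@[simp] lemma blocks_natAdd (j : Fin a) : blocks x u v (Fin.natAdd k j).succ = v j := by
  simp [blocks]

end blocks

lemma orderStat_blocks {k a : ℕ} {x : ℝ} {u : Fin k → ℝ} {v : Fin a → ℝ}
    (h : Separated k a (blocks x u v)) : orderStat (blocks x u v) (a + 1) = x := by
  simp only [Separated, blocks_zero, blocks_castAdd, blocks_natAdd] at h
  refine le_antisymm ?_ (not_lt.1 fun hlt => ?_)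
  · rw [orderStat_le_iff (by omega) (by omega), Finset.card_filter, Fin.sum_univ_succ,
      Fin.sum_univ_add]
    simp [fun j => (h.2 j).le]
    omega
  · rw [orderStat_lt_iff (by omega) (by omega), Finset.card_filter, Fin.sum_univ_succ,
      Fin.sum_univ_add] at hlt
    simp [fun j => (h.2 j), fun i => (h.1 i).le.not_gt] at hlt

/-- Only $a+1$ coordinates are at most $x$, so the $k$ highest ranks are filled from the block `u`.
Distinct ranks come from distinct indices, and an injection of `Fin k` into itself is a permutation.
-/
lemma exists_perm_orderStat_blocks {k a : ℕ} {x : ℝ} {u : Fin k → ℝ} {v : Fin a → ℝ}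
    (h : Separated k a (blocks x u v)) :
    ∃ τ : Equiv.Perm (Fin k), ∀ i : Fin k,
      orderStat (blocks x u v) (k + a + 1 - i) = u (τ i) := by
  have h' := h
  simp only [Separated, blocks_zero, blocks_castAdd, blocks_natAdd] at h
  set w := blocks x u v with hw
  have key : ∀ i : Fin k, ∃ j : Fin k,
      Tuple.sort w ⟨k + a + 1 - i - 1, by omega⟩ = (Fin.castAdd a j).succ := by
    intro i
    have hlt : x < w (Tuple.sort w ⟨k + a + 1 - i - 1, by omega⟩) := by
      rw [← orderStat_of_monotone (Tuple.monotone_sort w) (by omega) (by omega), ← not_le,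
        orderStat_le_iff (by omega) (by omega), Finset.card_filter, Fin.sum_univ_succ,
        Fin.sum_univ_add]
      simp [hw, fun j => (h.2 j).le, fun i => (h.1 i).not_ge]
      omega
    generalize Tuple.sort w ⟨k + a + 1 - i - 1, by omega⟩ = q at hlt
    induction q using Fin.cases with
    | zero => exact absurd hlt (lt_irrefl _)
    | succ q =>
      induction q using Fin.addCases with
      | left j => exact ⟨j, rfl⟩
      | right j =>
        rw [hw, blocks_natAdd] at hlt
        exact absurd hlt (h.2 j).not_gt
  choose τ hτ using key
  have hinj : Function.Injective τ := by
    intro i j hij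
    have := (hτ i).trans ((congrArg (fun l => (Fin.castAdd a l).succ) hij).trans (hτ j).symm)
    have := Fin.mk.inj ((Tuple.sort w).injective this)
    ext
    omega
  refine ⟨Equiv.ofBijective τ (Finite.injective_iff_bijective.1 hinj), fun i => ?_⟩
  rw [orderStat_of_monotone (Tuple.monotone_sort w) (by omega) (by omega), hτ i, hw,
    blocks_castAdd]
  rfl

open Classical in
-- Separation of $z\circ\sigma$ depends only on the relative order of the coordinates, so sorting
-- $z$ reduces the count to that of separated permutations. One explicit separated vector shows that
-- the count is not zero; its value is never needed.
lemma exists_card_separated (k a : ℕ) : ∃ c : ℕ, c ≠ 0 ∧ ∀ z : Fin (k + a + 1) → ℝ,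
    Function.Injective z →
      (Finset.univ.filter fun σ : Equiv.Perm (Fin (k + a + 1)) => Separated k a (z ∘ σ)).card
        = c := by
  have key : ∀ z : Fin (k + a + 1) → ℝ, Function.Injective z →
      (Finset.univ.filter fun σ : Equiv.Perm (Fin (k + a + 1)) => Separated k a (z ∘ σ)).card
      = (Finset.univ.filter fun σ : Equiv.Perm (Fin (k + a + 1)) => Separated k a σ).card := by
    intro z hz
    have hs : StrictMono (z ∘ Tuple.sort z) :=
      (Tuple.monotone_sort z).strictMono_of_injective (hz.comp (Tuple.sort z).injective)
    refine Finset.card_equiv (Equiv.mulLeft (Tuple.sort z)⁻¹) fun σ => ?_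
    have : ∀ p q, z (σ p) < z (σ q) ↔ (Tuple.sort z)⁻¹ (σ p) < (Tuple.sort z)⁻¹ (σ q) := by
      intro p q
      rw [← hs.lt_iff_lt]
      simp
    simp only [Finset.mem_filter, Finset.mem_univ, true_and]
    simp [Separated, this]
  have h1 : ∃ z : Fin (k + a + 1) → ℝ, Function.Injective z ∧ Separated k a z := by
    refine ⟨blocks 0 (fun i => (i : ℝ) + 1) (fun j => -((j : ℝ) + 1)), ?_, ?_⟩
    · have hp : ∀ i : ℕ, (0 : ℝ) < i + 1 := fun i => by positivity
      intro p q
      induction p using Fin.cases with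
      | zero =>
        induction q using Fin.cases with
        | zero => simp
        | succ q =>
          induction q using Fin.addCases with
          | left j => intro h; simp at h; linarith [hp j]
          | right j => intro h; simp at h; linarith [hp j]
      | succ p =>
        induction p using Fin.addCases with
        | left i =>
          induction q using Fin.cases with
          | zero => intro h; simp at h; linarith [hp i]
          | succ q =>
            induction q using Fin.addCases with
            | left j => intro h; simp at h; rw [Fin.ext h]
            | right j => intro h; simp at h; linarith [hp i, hp j]
        | right i =>
          induction q using Fin.cases with
          | zero => intro h; simp at h; linarith [hp i]
          | succ q =>
            induction q using Fin.addCases with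
            | left j => intro h; simp at h; linarith [hp i, hp j]
            | right j => intro h; simp at h; rw [Fin.ext h]
    · constructor
      · intro i; simp; positivity
      · intro i; simp; linarith [show (0 : ℝ) ≤ (i : ℕ) from by positivity]
  obtain ⟨z, hz, hs⟩ := h1
  refine ⟨_, ?_, key⟩
  rw [← key z hz]
  exact Finset.card_ne_zero_of_mem (Finset.mem_filter.2 ⟨Finset.mem_univ 1, hs⟩)

end OrderStatistics

/-! ### Pareto laws: tails, powers and self-similarity. -/

section Pareto

instance isProbabilityMeasure_unitPareto : IsProbabilityMeasure (paretoMeasure 1 1) :=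
  isProbabilityMeasure_paretoMeasure one_pos one_pos

lemma lintegral_unitPareto (f : ℝ → ℝ≥0∞) :
    ∫⁻ z, f z ∂(paretoMeasure 1 1) = ∫⁻ z in Set.Ioi 1, ENNReal.ofReal (1 / z ^ 2) * f z := by
  rw [paretoMeasure, lintegral_withDensity_eq_lintegral_mul_non_measurable₀]
  · rw [← setLIntegral_congr (Ioi_ae_eq_Ici (a := (1 : ℝ))).symm,
      ← lintegral_indicator measurableSet_Ici]
    refine lintegral_congr fun z => ?_
    by_cases hz : 1 ≤ z
    · rw [Set.indicator_of_mem (show z ∈ Set.Ici 1 from hz), Pi.mul_apply, paretoPDF_of_le hz]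
      congr 2
      rw [Real.one_rpow, mul_one, one_mul, Real.rpow_neg (by linarith), one_div]
      norm_num
    · rw [Set.indicator_of_notMem (by simpa using hz), Pi.mul_apply,
        paretoPDF_of_lt (not_le.1 hz), zero_mul]
  · exact (measurable_paretoPDFReal 1 1).ennreal_ofReal.aemeasurable
  · exact ae_of_all _ fun x => ENNReal.ofReal_lt_top

lemma paretoMeasure_Ioi {r x : ℝ} (hr : 0 < r) (hx : 1 ≤ x) :
    paretoMeasure 1 r (Set.Ioi x) = ENNReal.ofReal (x ^ (-r)) := by
  have hx0 : 0 < x := by linarith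
  have h : Set.EqOn (paretoPDF 1 r) (fun y => ENNReal.ofReal (r * y ^ (-(r + 1)))) (Set.Ioi x) := by
    intro y hy
    rw [paretoPDF_of_le (hx.trans (Set.mem_Ioi.1 hy).le), Real.one_rpow, mul_one]
  rw [paretoMeasure, withDensity_apply _ measurableSet_Ioi, setLIntegral_congr_fun
    measurableSet_Ioi h, ← ofReal_integral_eq_lintegral_ofReal, integral_const_mul,
    integral_Ioi_rpow_of_lt (by linarith) hx0]
  · congr 1
    rw [show -(r + 1) + 1 = -r by ring]
    field_simp
  · exact (integrableOn_Ioi_rpow_of_lt (by linarith) hx0).const_mul r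
  · filter_upwards [ae_restrict_mem measurableSet_Ioi] with y hy
    have : 0 < y := hx0.trans hy
    positivity

lemma ae_one_lt_paretoMeasure {r : ℝ} (hr : 0 < r) : ∀ᵐ z ∂(paretoMeasure 1 r), 1 < z := by
  have := isProbabilityMeasure_paretoMeasure one_pos hr
  have h := paretoMeasure_Ioi hr le_rfl
  rw [Real.one_rpow, ENNReal.ofReal_one, ← prob_compl_eq_zero_iff measurableSet_Ioi] at h
  exact h

instance nullSingletonClass_paretoMeasure (t r : ℝ) : NullSingletonClass (paretoMeasure t r) :=
  ⟨fun x => withDensity_absolutelyContinuous _ _ (measure_singleton x)⟩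

lemma ext_of_Ioi {μ ν : Measure ℝ} [IsProbabilityMeasure μ] [IsProbabilityMeasure ν]
    (h : ∀ x, μ (Set.Ioi x) = ν (Set.Ioi x)) : μ = ν := by
  refine Measure.ext_of_Iic μ ν fun x => ?_
  rw [← Set.compl_Ioi, prob_compl_eq_one_sub measurableSet_Ioi,
    prob_compl_eq_one_sub measurableSet_Ioi, h]

lemma paretoMeasure_Ioi_of_lt {r x : ℝ} (hr : 0 < r) (hx : x < 1) :
    paretoMeasure 1 r (Set.Ioi x) = 1 := by
  have := isProbabilityMeasure_paretoMeasure one_pos hr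
  rw [prob_compl_eq_zero_iff measurableSet_Ioi |>.symm]
  exact (ae_one_lt_paretoMeasure hr).mono fun z hz => hx.trans hz

lemma map_rpow_unitPareto {γ : ℝ} (hγ : 0 < γ) :
    (paretoMeasure 1 1).map (fun z => z ^ γ) = paretoMeasure 1 (1 / γ) := by
  have := isProbabilityMeasure_paretoMeasure one_pos (one_div_pos.2 hγ)
  have hm : Measurable fun z : ℝ => z ^ γ := by fun_prop
  have := Measure.isProbabilityMeasure_map (μ := paretoMeasure 1 1) hm.aemeasurable
  refine ext_of_Ioi fun x => ?_
  rw [Measure.map_apply hm measurableSet_Ioi]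
  by_cases hx : 1 ≤ x
  · have hx0 : 0 < x := by linarith
    rw [paretoMeasure_Ioi (one_div_pos.2 hγ) hx, show -(1 / γ) = 1 / γ * -1 by ring,
      Real.rpow_mul hx0.le, ← paretoMeasure_Ioi one_pos (Real.one_le_rpow hx (by positivity))]
    refine measure_congr ?_
    filter_upwards [ae_one_lt_paretoMeasure one_pos] with z hz
    refine propext ?_
    change x < z ^ γ ↔ x ^ (1 / γ) < z
    rw [one_div, Real.rpow_inv_lt_iff_of_pos hx0.le (by linarith) hγ]
  · rw [paretoMeasure_Ioi_of_lt (one_div_pos.2 hγ) (not_le.1 hx),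
      ← paretoMeasure_Ioi_of_lt one_pos (not_le.1 hx)]
    refine measure_congr ?_
    filter_upwards [ae_one_lt_paretoMeasure one_pos] with z hz
    refine propext ?_
    change x < z ^ γ ↔ x < z
    have h1 : 1 < z ^ γ := Real.one_lt_rpow hz hγ
    exact ⟨fun _ => by linarith, fun _ => by linarith⟩

/-- Multiplicative lack of memory, read off from the tails $1/x$. It is the source of the
description of the exceedances given the threshold. -/
lemma restrict_Ioi_unitPareto {t : ℝ} (ht : 1 ≤ t) :
    (paretoMeasure 1 1).restrict (Set.Ioi t)
      = ENNReal.ofReal (1 / t) • (paretoMeasure 1 1).map (fun z => t * z) := by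
  have ht0 : 0 < t := by linarith
  have hm : Measurable fun z : ℝ => t * z := by fun_prop
  have := Measure.isProbabilityMeasure_map (μ := paretoMeasure 1 1) hm.aemeasurable
  have hf : IsFiniteMeasure (ENNReal.ofReal (1 / t) • (paretoMeasure 1 1).map (fun z => t * z)) :=
    Measure.smul_finite _ ENNReal.ofReal_ne_top
  have key : ∀ x, (paretoMeasure 1 1).restrict (Set.Ioi t) (Set.Ioi x)
      = (ENNReal.ofReal (1 / t) • (paretoMeasure 1 1).map (fun z => t * z)) (Set.Ioi x) := by
    intro x
    have hpre : (fun z => t * z) ⁻¹' Set.Ioi x = Set.Ioi (x / t) := by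
      ext z; simp [div_lt_iff₀' ht0]
    rw [Measure.restrict_apply measurableSet_Ioi, Set.Ioi_inter_Ioi, Measure.smul_apply,
      Measure.map_apply hm measurableSet_Ioi, hpre, smul_eq_mul]
    rw [paretoMeasure_Ioi one_pos (ht.trans le_sup_right)]
    by_cases hx : t ≤ x
    · rw [paretoMeasure_Ioi one_pos ((one_le_div ht0).2 hx), sup_eq_left.2 hx,
        ← ENNReal.ofReal_mul (by positivity), Real.rpow_neg_one, Real.rpow_neg_one]
      congr 1
      field_simp
    · rw [paretoMeasure_Ioi_of_lt one_pos ((div_lt_one ht0).2 (not_le.1 hx)),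
        sup_eq_right.2 (not_le.1 hx).le, mul_one, Real.rpow_neg_one, one_div]
  have huniv : (paretoMeasure 1 1).restrict (Set.Ioi t) Set.univ
      = (ENNReal.ofReal (1 / t) • (paretoMeasure 1 1).map (fun z => t * z)) Set.univ := by
    rw [Measure.restrict_apply_univ, Measure.smul_apply, measure_univ, smul_eq_mul, mul_one,
      paretoMeasure_Ioi one_pos ht, Real.rpow_neg_one, one_div]
  refine Measure.ext_of_Iic _ _ fun x => ?_
  rw [← Set.compl_Ioi, measure_compl measurableSet_Ioi (measure_ne_top _ _),
    measure_compl measurableSet_Ioi (measure_ne_top _ _), key, huniv]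

end Pareto

/-! ### Conditional law of the exceedances given the threshold. -/

section ConditionalLaw

lemma measurable_blocks {k a : ℕ} :
    Measurable fun p : (ℝ × (Fin k → ℝ)) × (Fin a → ℝ) => blocks p.1.1 p.1.2 p.2 := by
  refine measurable_pi_iff.2 fun i => ?_
  induction i using Fin.cases with
  | zero => exact measurable_fst.fst
  | succ i =>
    induction i using Fin.addCases with
    | left i => simp only [blocks_castAdd]; fun_prop
    | right i => simp only [blocks_natAdd]; fun_prop

lemma map_blocks (μ : Measure ℝ) [SigmaFinite μ] (k a : ℕ) :
    ((μ.prod (Measure.pi fun _ : Fin k => μ)).prod (Measure.pi fun _ : Fin a => μ)).map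
      (fun p => blocks p.1.1 p.1.2 p.2) = Measure.pi fun _ : Fin (k + a + 1) => μ := by
  refine (Measure.pi_eq fun s hs => ?_).symm
  rw [Measure.map_apply measurable_blocks (MeasurableSet.univ_pi hs)]
  have : (fun p : (ℝ × (Fin k → ℝ)) × (Fin a → ℝ) => blocks p.1.1 p.1.2 p.2) ⁻¹' Set.univ.pi s
      = (s 0 ×ˢ Set.univ.pi fun i => s (Fin.castAdd a i).succ) ×ˢ
        Set.univ.pi fun j => s (Fin.natAdd k j).succ := by
    ext p
    simp only [Set.mem_preimage, Set.mem_pi, Set.mem_univ, true_imp_iff, Set.mem_prod]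
    constructor
    · intro h
      exact ⟨⟨h 0, fun i => by simpa using h (Fin.castAdd a i).succ⟩,
        fun j => by simpa using h (Fin.natAdd k j).succ⟩
    · rintro ⟨⟨h0, h1⟩, h2⟩ i
      induction i using Fin.cases with
      | zero => exact h0
      | succ i =>
        induction i using Fin.addCases with
        | left i => simpa using h1 i
        | right i => simpa using h2 i
  rw [this, Measure.prod_prod, Measure.prod_prod, Measure.pi_pi, Measure.pi_pi,
    Fin.prod_univ_succ, Fin.prod_univ_add, mul_assoc]

lemma lintegral_pi_blocks (μ : Measure ℝ) [SigmaFinite μ] (k a : ℕ)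
    {G : (Fin (k + a + 1) → ℝ) → ℝ≥0∞} (hG : Measurable G) :
    ∫⁻ z, G z ∂(Measure.pi fun _ => μ) = ∫⁻ x, ∫⁻ u : Fin k → ℝ, ∫⁻ v : Fin a → ℝ,
      G (blocks x u v) ∂(Measure.pi fun _ => μ) ∂(Measure.pi fun _ => μ) ∂μ := by
  have h1 : Measurable fun p : (ℝ × (Fin k → ℝ)) × (Fin a → ℝ) => G (blocks p.1.1 p.1.2 p.2) :=
    hG.comp (measurable_blocks (k := k) (a := a))
  rw [← map_blocks, lintegral_map hG measurable_blocks, lintegral_prod _ h1.aemeasurable,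
    lintegral_prod _ h1.lintegral_prod_right'.aemeasurable]

/-- Two independent coordinates with an atomless law coincide with probability zero, since the
diagonal has null sections. -/
lemma ae_injective_pi (μ : Measure ℝ) [IsProbabilityMeasure μ] [NullSingletonClass μ] (n : ℕ) :
    ∀ᵐ z ∂(Measure.pi fun _ : Fin n => μ), Function.Injective z := by
  have h : ∀ i j : Fin n, i ≠ j → ∀ᵐ z ∂(Measure.pi fun _ : Fin n => μ), z i ≠ z j := by
    intro i j hij
    have hind : iIndepFun (fun (i : Fin n) (z : Fin n → ℝ) => z i)
        (Measure.pi fun _ : Fin n => μ) :=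
      iIndepFun_pi (X := fun _ x => x) fun _ => aemeasurable_id
    have h2 := (indepFun_iff_map_prod_eq_prod_map_map
      (measurable_pi_apply i).aemeasurable (measurable_pi_apply j).aemeasurable).1
      (hind.indepFun hij)
    have hev : ∀ i : Fin n, (Measure.pi fun _ : Fin n => μ).map (fun z => z i) = μ := fun i =>
      (measurePreserving_eval (fun _ : Fin n => μ) i).map_eq
    rw [hev, hev] at h2
    have h3 : (μ.prod μ) {p | p.1 = p.2} = 0 := by
      rw [Measure.prod_apply (measurableSet_eq_fun measurable_fst measurable_snd)]
      refine (lintegral_congr fun x => ?_).trans lintegral_zero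
      have : Prod.mk x ⁻¹' {p : ℝ × ℝ | p.1 = p.2} = {x} := by ext y; simp [eq_comm]
      rw [this, measure_singleton]
    rw [← h2, Measure.map_apply (by fun_prop)
      (measurableSet_eq_fun measurable_fst measurable_snd)] at h3
    exact measure_eq_zero_iff_ae_notMem.1 h3
  have h' : ∀ᵐ z ∂(Measure.pi fun _ : Fin n => μ), ∀ i j : Fin n, i ≠ j → z i ≠ z j :=
    ae_all_iff.2 fun i => ae_all_iff.2 fun j => ae_all_iff.2 fun hij => h i j hij
  filter_upwards [h'] with z hz i j hij
  by_contra hne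
  exact hz i j hne hij

lemma measurableSet_separated (k a : ℕ) :
    MeasurableSet {z : Fin (k + a + 1) → ℝ | Separated k a z} := by
  simp only [Separated, Set.ofPred_and, Set.ofPred_forall]
  exact (MeasurableSet.iInter fun i => measurableSet_lt (by fun_prop) (by fun_prop)).inter
    (MeasurableSet.iInter fun i => measurableSet_lt (by fun_prop) (by fun_prop))

lemma measurePreserving_comp_perm (μ : Measure ℝ) [SigmaFinite μ] {n : ℕ}
    (σ : Equiv.Perm (Fin n)) :
    MeasurePreserving (fun z : Fin n → ℝ => z ∘ σ) (Measure.pi fun _ => μ)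
      (Measure.pi fun _ => μ) := by
  have h := measurePreserving_piCongrLeft (fun _ : Fin n => μ) σ.symm
  convert h using 1
  funext z
  ext i
  simp [MeasurableEquiv.coe_piCongrLeft, Equiv.piCongrLeft_apply]

open Classical in
-- For an injective $z$, exactly the same number of permutations make $z\circ\sigma$ separated.
-- Summing the indicator over all permutations and using the invariance of the product measure under
-- each of them shows that a symmetric function is integrated over the separated vectors with a
-- fixed proportion.
lemma lintegral_symmetric (μ : Measure ℝ) [IsProbabilityMeasure μ] [NullSingletonClass μ]
    (k a : ℕ) : ∃ c : ℝ≥0∞, c ≠ 0 ∧ c ≠ ∞ ∧ ∀ G : (Fin (k + a + 1) → ℝ) → ℝ≥0∞, Measurable G →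
      (∀ z (σ : Equiv.Perm (Fin (k + a + 1))), G (z ∘ σ) = G z) →
      c * ∫⁻ z, G z ∂(Measure.pi fun _ => μ) = ∫⁻ z, {z | Separated k a z}.indicator G z
        ∂(Measure.pi fun _ => μ) := by
  obtain ⟨c, hc0, hc⟩ := exists_card_separated k a
  have hN : (Fintype.card (Equiv.Perm (Fin (k + a + 1))) : ℝ≥0∞) ≠ 0 := by simp
  refine ⟨c / (Fintype.card (Equiv.Perm (Fin (k + a + 1))) : ℝ≥0∞),
    (ENNReal.div_pos (by exact_mod_cast hc0) (by simp)).ne',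
    (ENNReal.div_lt_top (by simp) hN).ne, fun G hG hsymm => ?_⟩
  have hind := hG.indicator (measurableSet_separated k a)
  have h1 : (c : ℝ≥0∞) * ∫⁻ z, G z ∂(Measure.pi fun _ => μ)
      = ∫⁻ z, ∑ σ : Equiv.Perm (Fin (k + a + 1)),
        {z | Separated k a z}.indicator G (z ∘ σ) ∂(Measure.pi fun _ => μ) := by
    rw [← lintegral_const_mul _ hG]
    refine lintegral_congr_ae ?_
    filter_upwards [ae_injective_pi μ (k + a + 1)] with z hz
    simp only [Set.indicator_apply, hsymm, Set.mem_ofPred_eq]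
    rw [← Finset.sum_filter, Finset.sum_const, hc z hz, nsmul_eq_mul]
  have hm : ∀ σ : Equiv.Perm (Fin (k + a + 1)), Measurable fun z : Fin (k + a + 1) → ℝ =>
      {z | Separated k a z}.indicator G (z ∘ σ) := fun σ =>
    hind.comp (measurePreserving_comp_perm μ σ).measurable
  rw [lintegral_finsetSum _ fun σ _ => hm σ] at h1
  simp only [(measurePreserving_comp_perm μ _).lintegral_comp hind, Finset.sum_const,
    nsmul_eq_mul, Finset.card_univ] at h1
  rw [ENNReal.mul_comm_div, mul_div_assoc', h1, mul_comm, ENNReal.mul_div_cancel_right hN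
    (by simp)]

/-- By symmetry the vector may be taken separated: its first coordinate is then the threshold, the
next $k$ are the exceedances in some order and the last $a$ lie below. Integrating these last ones
out leaves the factor $\mu(-\infty,x)^a$. -/
lemma lintegral_orderStat (μ : Measure ℝ) [IsProbabilityMeasure μ] [NullSingletonClass μ]
    (k a : ℕ) : ∃ c : ℝ≥0∞, c ≠ 0 ∧ c ≠ ∞ ∧ ∀ Φ : ℝ × (Fin k → ℝ) → ℝ≥0∞, Measurable Φ →
      (∀ x u (τ : Equiv.Perm (Fin k)), Φ (x, u ∘ τ) = Φ (x, u)) →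
      c * ∫⁻ z, Φ (orderStat z (a + 1), fun i : Fin k => orderStat z (k + a + 1 - i))
          ∂(Measure.pi fun _ : Fin (k + a + 1) => μ)
        = ∫⁻ x, μ (Set.Iio x) ^ a *
          ∫⁻ u, Φ (x, u) ∂(Measure.pi fun _ : Fin k => μ.restrict (Set.Ioi x)) ∂μ := by
  obtain ⟨c, hc0, hct, hc⟩ := lintegral_symmetric μ k a
  refine ⟨c, hc0, hct, fun Φ hΦ hsymm => ?_⟩
  have hmeas : Measurable fun z : Fin (k + a + 1) → ℝ =>
      Φ (orderStat z (a + 1), fun i : Fin k => orderStat z (k + a + 1 - i)) :=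
    hΦ.comp ((measurable_orderStat _).prodMk (measurable_pi_iff.2 fun i => measurable_orderStat _))
  rw [hc _ hmeas fun z σ => by simp only [orderStat_comp_perm],
    lintegral_pi_blocks _ _ _ (hmeas.indicator (measurableSet_separated k a))]
  refine lintegral_congr fun x => ?_
  have hΦx : Measurable fun u => Φ (x, u) := hΦ.comp measurable_prodMk_left
  rw [← Measure.restrict_pi_pi, ← lintegral_indicator
    (MeasurableSet.univ_pi fun _ => measurableSet_Ioi), ← lintegral_const_mul _
    (hΦx.indicator (MeasurableSet.univ_pi fun _ => measurableSet_Ioi))]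
  refine lintegral_congr fun u => ?_
  have hpi : μ (Set.Iio x) ^ a
      = (Measure.pi fun _ : Fin a => μ) (Set.univ.pi fun _ => Set.Iio x) := by
    rw [Measure.pi_pi]; simp
  rw [hpi, mul_comm, ← lintegral_indicator_const (MeasurableSet.univ_pi fun _ => measurableSet_Iio)]
  refine lintegral_congr fun v => ?_
  by_cases h : Separated k a (blocks x u v)
  · obtain ⟨τ, hτ⟩ := exists_perm_orderStat_blocks h
    have hh := h
    simp only [Separated, blocks_zero, blocks_castAdd, blocks_natAdd] at hh
    rw [Set.indicator_of_mem (show blocks x u v ∈ {z | Separated k a z} from h),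
      orderStat_blocks h, funext hτ, Set.indicator_of_mem, Set.indicator_of_mem]
    · exact hsymm x u τ
    · exact fun i _ => hh.1 i
    · exact fun j _ => hh.2 j
  · rw [Set.indicator_of_notMem (show blocks x u v ∉ {z | Separated k a z} from h)]
    simp only [Separated, blocks_zero, blocks_castAdd, blocks_natAdd, not_and_or] at h
    rcases h with h | h
    · have hu : u ∉ Set.univ.pi fun _ => Set.Ioi x := fun hu => h fun i => hu i trivial
      by_cases hv : v ∈ Set.univ.pi fun _ => Set.Iio x
      · rw [Set.indicator_of_mem hv, Set.indicator_of_notMem hu]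
      · rw [Set.indicator_of_notMem hv]
    · have hv : v ∉ Set.univ.pi fun _ => Set.Iio x := fun hv => h fun j => hv j trivial
      rw [Set.indicator_of_notMem hv]

/-- Given the threshold `t`, the larger values are distributed as `t` times a sample of unit
Pareto variables, up to a permutation. -/
lemma lintegral_orderStat_unitPareto (k a : ℕ) {Φ : ℝ × (Fin k → ℝ) → ℝ≥0∞} (hΦ : Measurable Φ)
    (hsymm : ∀ x u (τ : Equiv.Perm (Fin k)), Φ (x, u ∘ τ) = Φ (x, u)) :
    ∫⁻ z, Φ (orderStat z (a + 1), fun i : Fin k => orderStat z (k + a + 1 - i))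
        ∂(Measure.pi fun _ : Fin (k + a + 1) => paretoMeasure 1 1)
      = ∫⁻ t, ∫⁻ y, Φ (t, fun i => t * y i) ∂(Measure.pi fun _ : Fin k => paretoMeasure 1 1)
        ∂((Measure.pi fun _ : Fin (k + a + 1) => paretoMeasure 1 1).map
          fun z => orderStat z (a + 1)) := by
  obtain ⟨c, hc0, hct, hc⟩ := lintegral_orderStat (paretoMeasure 1 1) k a
  have hmm : Measurable fun p : ℝ × (Fin k → ℝ) => Φ (p.1, fun i => p.1 * p.2 i) :=
    hΦ.comp (by fun_prop)
  set g : ℝ → ℝ≥0∞ := fun t => ∫⁻ y, Φ (t, fun i => t * y i)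
    ∂(Measure.pi fun _ : Fin k => paretoMeasure 1 1) with hg
  have hgm : Measurable g := hmm.lintegral_prod_right'
  have hscale : ∀ᵐ t ∂(paretoMeasure 1 1), ∀ Ψ : (Fin k → ℝ) → ℝ≥0∞, Measurable Ψ →
      ∫⁻ u, Ψ u ∂(Measure.pi fun _ : Fin k => (paretoMeasure 1 1).restrict (Set.Ioi t))
        = ENNReal.ofReal (1 / t) ^ k *
          ∫⁻ y, Ψ (fun i => t * y i) ∂(Measure.pi fun _ : Fin k => paretoMeasure 1 1) := by
    filter_upwards [ae_one_lt_paretoMeasure one_pos] with t ht Ψ hΨ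
    have hm : Measurable fun z : ℝ => t * z := by fun_prop
    have := Measure.isProbabilityMeasure_map (μ := paretoMeasure 1 1) hm.aemeasurable
    have h1 : (Measure.pi fun _ : Fin k => (paretoMeasure 1 1).restrict (Set.Ioi t))
        = ENNReal.ofReal (1 / t) ^ k •
          Measure.pi fun _ : Fin k => (paretoMeasure 1 1).map (fun z => t * z) := by
      rw [restrict_Ioi_unitPareto ht.le]
      have : SigmaFinite (ENNReal.ofReal (1 / t) • (paretoMeasure 1 1).map (fun z => t * z)) :=
        (Measure.smul_finite _ ENNReal.ofReal_ne_top).toSigmaFinite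
      refine Measure.pi_eq fun s hs => ?_
      simp [Measure.pi_pi, Finset.prod_mul_distrib]
    rw [h1, lintegral_smul_measure, ← Measure.pi_map_pi fun _ => hm.aemeasurable,
      lintegral_map hΨ (by fun_prop), smul_eq_mul]
  have e1 := hc Φ hΦ hsymm
  -- The same formula applied to a function of the threshold alone. Both sides now carry the same
  -- constant and the same weights, so neither has to be computed.
  have e2 := hc (fun p => g p.1) (hgm.comp measurable_fst) fun _ _ _ => rfl
  rw [lintegral_map hgm (measurable_orderStat _)]
  rw [← ENNReal.mul_right_inj hc0 hct, e1, e2]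
  refine lintegral_congr_ae ?_
  filter_upwards [hscale] with t ht
  have hΦt : Measurable fun u => Φ (t, u) := hΦ.comp measurable_prodMk_left
  rw [ht _ hΦt, ht _ measurable_const]
  simp [hg]

/-- The law of `H (t, t y)` when `y` is a sample of `k` unit Pareto variables. -/
noncomputable def scaledKernel {β : Type*} [MeasurableSpace β] (k : ℕ)
    (H : ℝ × (Fin k → ℝ) → β) : Kernel ℝ β :=
  (Kernel.id ×ₖ Kernel.const ℝ (Measure.pi fun _ : Fin k => paretoMeasure 1 1)).map
    fun p => H (p.1, fun i => p.1 * p.2 i)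

section scaledKernel
variable {β : Type*} [MeasurableSpace β] {k : ℕ} {H : ℝ × (Fin k → ℝ) → β}

lemma scaledKernel_apply (hH : Measurable H) (t : ℝ) :
    scaledKernel k H t = (Measure.pi fun _ : Fin k => paretoMeasure 1 1).map
      fun y => H (t, fun i => t * y i) := by
  have h : Measurable fun p : ℝ × (Fin k → ℝ) => H (p.1, fun i => p.1 * p.2 i) :=
    hH.comp (by fun_prop)
  rw [scaledKernel, Kernel.map_apply _ h, Kernel.prod_apply, Kernel.id_apply, Kernel.const_apply,
    Measure.dirac_prod, Measure.map_map h measurable_prodMk_left]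
  rfl

lemma isMarkovKernel_scaledKernel (hH : Measurable H) : IsMarkovKernel (scaledKernel k H) :=
  Kernel.IsMarkovKernel.map _ (hH.comp (by fun_prop))

lemma map_orderStat_eq_compProd (a : ℕ) (hH : Measurable H)
    (hsymm : ∀ x u (τ : Equiv.Perm (Fin k)), H (x, u ∘ τ) = H (x, u)) :
    (Measure.pi fun _ : Fin (k + a + 1) => paretoMeasure 1 1).map
        (fun z => (orderStat z (a + 1),
          H (orderStat z (a + 1), fun i : Fin k => orderStat z (k + a + 1 - i))))
      = ((Measure.pi fun _ : Fin (k + a + 1) => paretoMeasure 1 1).map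
          fun z => orderStat z (a + 1)) ⊗ₘ scaledKernel k H := by
  have := isMarkovKernel_scaledKernel hH
  have hmz : Measurable fun z : Fin (k + a + 1) → ℝ =>
      (orderStat z (a + 1), fun i : Fin k => orderStat z (k + a + 1 - i)) :=
    (measurable_orderStat _).prodMk (measurable_pi_iff.2 fun i => measurable_orderStat _)
  have hm2 : Measurable fun p : ℝ × (Fin k → ℝ) => (p.1, H p) := measurable_fst.prodMk hH
  have hfull : Measurable fun z : Fin (k + a + 1) → ℝ => (orderStat z (a + 1),
      H (orderStat z (a + 1), fun i : Fin k => orderStat z (k + a + 1 - i))) := hm2.comp hmz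
  ext s hs
  have hΦ : Measurable fun p : ℝ × (Fin k → ℝ) => s.indicator (1 : ℝ × β → ℝ≥0∞) (p.1, H p) :=
    (measurable_one.indicator hs).comp hm2
  rw [Measure.compProd_apply hs, ← lintegral_indicator_one hs,
    lintegral_map (measurable_one.indicator hs) hfull]
  refine (lintegral_orderStat_unitPareto k a hΦ fun x u τ => by simp only [hsymm]).trans ?_
  refine lintegral_congr fun t => ?_
  have h2 : Measurable fun y : Fin k → ℝ => H (t, fun i => t * y i) := hH.comp (by fun_prop)
  rw [scaledKernel_apply hH, ← lintegral_indicator_one (measurable_prodMk_left hs),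
    lintegral_map (measurable_one.indicator (measurable_prodMk_left hs)) h2]
  rfl

lemma map_sample_eq_pi {Ω : Type*} [MeasurableSpace Ω] {P : Measure Ω} [IsProbabilityMeasure P]
    {Z : ℕ → Ω → ℝ} (hZ : ∀ i, HasLaw (Z i) (paretoMeasure 1 1) P) (hind : iIndepFun Z P) (n : ℕ) :
    P.map (fun ω (i : Fin n) => Z i ω) = Measure.pi fun _ : Fin n => paretoMeasure 1 1 := by
  have h := (iIndepFun_iff_map_fun_eq_pi_map (fun i : Fin n => (hZ i).aemeasurable)).1
    (hind.precomp Fin.val_injective)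
  rw [h]
  simp only [(hZ _).map_eq]

/-- The order statistics come sorted whereas the Pareto sample does not; the invariance of `H` under
permutations makes the difference invisible. -/
lemma hasCondDistrib_scaledKernel {Ω : Type*} [MeasurableSpace Ω] {P : Measure Ω}
    [IsProbabilityMeasure P] {Z : ℕ → Ω → ℝ} (hZ : ∀ i, HasLaw (Z i) (paretoMeasure 1 1) P)
    (hind : iIndepFun Z P) {n : ℕ} (hkn : k < n) (hH : Measurable H)
    (hsymm : ∀ x u (τ : Equiv.Perm (Fin k)), H (x, u ∘ τ) = H (x, u)) :
    HasCondDistrib (fun ω => H (threshold Z n k ω,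
        fun i : Fin k => orderStat (fun i : Fin n => Z i ω) (n - i)))
      (threshold Z n k) (scaledKernel k H) P := by
  obtain ⟨a, rfl⟩ : ∃ a, n = k + a + 1 := ⟨n - k - 1, by omega⟩
  have hae : AEMeasurable (fun ω (i : Fin (k + a + 1)) => Z i ω) P :=
    aemeasurable_pi_iff.2 fun i => (hZ i).aemeasurable
  have hmz : Measurable fun z : Fin (k + a + 1) → ℝ =>
      (orderStat z (a + 1), fun i : Fin k => orderStat z (k + a + 1 - i)) :=
    (measurable_orderStat _).prodMk (measurable_pi_iff.2 fun i => measurable_orderStat _)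
  have hm2 : Measurable fun p : ℝ × (Fin k → ℝ) => (p.1, H p) := measurable_fst.prodMk hH
  have hfull : Measurable fun z : Fin (k + a + 1) → ℝ => (orderStat z (a + 1),
      H (orderStat z (a + 1), fun i : Fin k => orderStat z (k + a + 1 - i))) := hm2.comp hmz
  have hk : k + a + 1 - k = a + 1 := by omega
  have hT : threshold Z (k + a + 1) k
      = (fun z => orderStat z (a + 1)) ∘ fun ω (i : Fin (k + a + 1)) => Z i ω := by
    funext ω
    rw [threshold, hk]
    rfl
  refine ⟨?_, ?_⟩
  · rw [hT]
    exact hfull.comp_aemeasurable hae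
  · have h1 := map_orderStat_eq_compProd a hH hsymm
    rw [← map_sample_eq_pi hZ hind, AEMeasurable.map_map_of_aemeasurable
      hfull.aemeasurable hae, AEMeasurable.map_map_of_aemeasurable
      (measurable_orderStat _).aemeasurable hae] at h1
    rw [hT]
    exact h1

end scaledKernel

end ConditionalLaw

/-! ### Quantile functions and the tail quantile function. -/

section Quantile

/-- The generalized inverse of the distribution function of a law on the line. -/
noncomputable def quantile (μ : Measure ℝ) (u : ℝ) : ℝ := sInf {x : ℝ | u ≤ cdf μ x}

lemma tailQuantile_eq_quantile (μ : Measure ℝ) (t : ℝ) :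
    tailQuantile μ t = quantile μ (1 - 1 / t) := rfl

/-- Right continuity of the distribution function makes the infimum attained. Levels 0 and 1 are
excluded because the set may there be unbounded below or empty, and `sInf` then takes a default
value. -/
lemma quantile_le_iff (μ : Measure ℝ) {u : ℝ} (hu : u ∈ Set.Ioo (0 : ℝ) 1) (x : ℝ) :
    quantile μ u ≤ x ↔ u ≤ cdf μ x := by
  have hbdd : BddBelow {x : ℝ | u ≤ cdf μ x} := by
    obtain ⟨b, hb⟩ := ((tendsto_cdf_atBot μ).eventually (gt_mem_nhds hu.1)).exists
    exact ⟨b, fun y hy => not_lt.1 fun hyb =>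
      (hb.trans_le hy).not_ge (monotone_cdf μ hyb.le)⟩
  have hne : {x : ℝ | u ≤ cdf μ x}.Nonempty :=
    ((tendsto_cdf_atTop μ).eventually (lt_mem_nhds hu.2)).exists.imp fun _ h => h.le
  refine ⟨fun h => ?_, fun h => csInf_le hbdd h⟩
  have hright : Tendsto (cdf μ) (𝓝[>] x) (𝓝 (cdf μ x)) :=
    ((cdf μ).right_continuous x).mono Set.Ioi_subset_Ici_self
  refine ge_of_tendsto hright ?_
  filter_upwards [self_mem_nhdsWithin] with y hy
  obtain ⟨b, hb, hby⟩ := exists_lt_of_csInf_lt hne (lt_of_le_of_lt h hy)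
  exact le_trans hb (monotone_cdf μ hby.le)

lemma monotoneOn_quantile (μ : Measure ℝ) : MonotoneOn (quantile μ) (Set.Ioo 0 1) :=
  fun _ hu _ hv huv => (quantile_le_iff μ hu _).2 (huv.trans ((quantile_le_iff μ hv _).1 le_rfl))

lemma quantile_of_nonpos (μ : Measure ℝ) {u : ℝ} (hu : u ≤ 0) : quantile μ u = 0 := by
  have : {x : ℝ | u ≤ cdf μ x} = Set.univ := Set.eq_univ_of_forall fun x =>
    hu.trans (cdf_nonneg μ x)
  rw [quantile, this, Real.sInf_univ]

lemma quantile_of_one_lt (μ : Measure ℝ) {u : ℝ} (hu : 1 < u) : quantile μ u = 0 := by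
  have : {x : ℝ | u ≤ cdf μ x} = ∅ := Set.eq_empty_of_forall_notMem fun x hx =>
    ((hx : u ≤ cdf μ x).trans (cdf_le_one μ x)).not_gt hu
  rw [quantile, this, Real.sInf_empty]

-- Monotonicity holds only on $(0,1)$. Outside $[0,1]$ the default value is 0, and the level 1 is a
-- single point, so the preimage of a half-line is treated in three pieces.
@[fun_prop]
lemma measurable_quantile (μ : Measure ℝ) : Measurable (quantile μ) := by
  refine measurable_of_Iic fun x => ?_
  have : quantile μ ⁻¹' Set.Iic x = (Set.Ioo 0 1 ∩ Set.Iic (cdf μ x)) ∪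
      (({1} ∩ quantile μ ⁻¹' Set.Iic x) ∪ ((Set.Iic 0 ∪ Set.Ioi 1) ∩ {_u | 0 ≤ x})) := by
    ext u
    simp only [Set.mem_preimage, Set.mem_Iic, Set.mem_union, Set.mem_inter_iff, Set.mem_Ioi,
      Set.mem_singleton_iff, Set.mem_ofPred_eq]
    rcases le_or_gt u 0 with h0 | h0
    · simp [quantile_of_nonpos μ h0, h0, (h0.trans_lt one_pos).ne, h0.not_gt]
    rcases lt_trichotomy u 1 with h1 | h1 | h1
    · simp [quantile_le_iff μ ⟨h0, h1⟩, h0, h1, h1.ne, h0.not_ge, h1.not_gt]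
    · simp [h1]
    · simp [quantile_of_one_lt μ h1, h1, h1.ne', h1.not_gt]
  rw [this]
  refine (measurableSet_Ioo.inter measurableSet_Iic).union (MeasurableSet.union ?_
    ((measurableSet_Iic.union measurableSet_Ioi).inter (MeasurableSet.const _)))
  exact (Set.subsingleton_singleton.anti Set.inter_subset_left).measurableSet

@[fun_prop]
lemma measurable_tailQuantile (μ : Measure ℝ) : Measurable (tailQuantile μ) :=
  (measurable_quantile μ).comp (by fun_prop)

lemma one_sub_one_div_mem_Ioo {t : ℝ} (ht : 1 < t) : 1 - 1 / t ∈ Set.Ioo (0 : ℝ) 1 := by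
  have h0 : 0 < 1 / t := by positivity
  have h1 : 1 / t < 1 := (div_lt_one (by linarith)).2 ht
  exact ⟨by linarith, by linarith⟩

lemma monotoneOn_tailQuantile (μ : Measure ℝ) : MonotoneOn (tailQuantile μ) (Set.Ioi 1) :=
  fun _ hs t ht hst => monotoneOn_quantile μ (one_sub_one_div_mem_Ioo hs)
    (one_sub_one_div_mem_Ioo ht)
    (sub_le_sub_left (one_div_le_one_div_of_le (by linarith [Set.mem_Ioi.1 hs]) hst) _)

/-- At $t=1$ the defining set is the whole line, whose `sInf` is 0 by convention; positivity
therefore excludes that endpoint. -/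
lemma one_lt_of_tailQuantile_pos {μ : Measure ℝ} {t : ℝ} (ht : 1 ≤ t)
    (h : 0 < tailQuantile μ t) : 1 < t := by
  refine lt_of_le_of_ne ht fun h1 => ?_
  rw [← h1, tailQuantile_eq_quantile, quantile_of_nonpos μ (by norm_num)] at h
  exact lt_irrefl _ h

end Quantile

/-! ### Couplings, empirical measures and the space of probability measures. -/

section Wasserstein

lemma wasserstein_map_le {α β : Type*} [MeasurableSpace α] [MeasurableSpace β] (ν : Measure β)
    (c : α → α → ℝ≥0∞) {p : ℝ} (hp : 0 < p) {f g : β → α} (hf : Measurable f)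
    (hg : Measurable g) :
    wasserstein c p (ν.map f) (ν.map g) ≤ (∫⁻ y, c (f y) (g y) ^ p ∂ν) ^ (1 / p) := by
  have h : (ν.map fun y => (f y, g y)).map Prod.fst = ν.map f ∧
      (ν.map fun y => (f y, g y)).map Prod.snd = ν.map g := by
    rw [Measure.map_map measurable_fst (hf.prodMk hg), Measure.map_map measurable_snd
      (hf.prodMk hg)]
    exact ⟨rfl, rfl⟩
  exact (iInf₂_le (ν.map fun y => (f y, g y)) h).trans
    -- This inequality for the integral against an image measure needs no measurability of the cost,
    -- which matters when the cost is itself a Wasserstein distance.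
    (ENNReal.rpow_le_rpow (lintegral_map_le _ _) (by positivity))

/-- The coupling is the empirical measure of the pairs: atoms of equal index are matched. -/
lemma wasserstein_empirical_le (c : ℝ → ℝ → ℝ≥0∞) (p : ℝ) {k : ℕ} (hk : 0 < k)
    (x y : Fin k → ℝ) :
    wasserstein c p (empirical k hk x : Measure ℝ) (empirical k hk y : Measure ℝ)
      ≤ ((k : ℝ≥0∞)⁻¹ * ∑ i, c (x i) (y i) ^ p) ^ (1 / p) := by
  have h : ((k : ℝ≥0∞)⁻¹ • ∑ i, Measure.dirac (x i, y i)).map Prod.fst = empirical k hk x ∧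
      ((k : ℝ≥0∞)⁻¹ • ∑ i, Measure.dirac (x i, y i)).map Prod.snd = empirical k hk y := by
    constructor
    · ext s hs
      rw [Measure.map_apply measurable_fst hs]
      simp [empirical, Measure.finsetSum_apply, Measure.dirac_apply' _ hs,
        Measure.dirac_apply' _ (measurable_fst hs)]
      rfl
    · ext s hs
      rw [Measure.map_apply measurable_snd hs]
      simp [empirical, Measure.finsetSum_apply, Measure.dirac_apply' _ hs,
        Measure.dirac_apply' _ (measurable_snd hs)]
      rfl
  refine (iInf₂_le ((k : ℝ≥0∞)⁻¹ • ∑ i, Measure.dirac (x i, y i)) h).trans (le_of_eq ?_)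
  rw [lintegral_smul_measure, lintegral_finsetSum_measure]
  simp [lintegral_dirac]

lemma measurable_empirical {k : ℕ} (hk : 0 < k) : Measurable (empirical k hk) := by
  refine Measurable.subtype_mk (Measure.measurable_of_measurable_coe _ fun s hs => ?_)
  simp only [Measure.smul_apply, Measure.finsetSum_apply, Measure.dirac_apply' _ hs]
  have h : Measurable (s.indicator (1 : ℝ → ℝ≥0∞)) := measurable_one.indicator hs
  exact (Finset.measurable_sum _ fun i _ => h.comp (measurable_pi_apply i)).const_mul _

lemma empirical_comp_perm {k : ℕ} (hk : 0 < k) (x : Fin k → ℝ) (τ : Equiv.Perm (Fin k)) :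
    empirical k hk (x ∘ τ) = empirical k hk x := by
  refine Subtype.ext ?_
  simp only [empirical, Function.comp_apply]
  rw [Equiv.sum_comp τ fun i => Measure.dirac (x i)]

lemma measurable_of_measurable_Iic_rat {α : Type*} [MeasurableSpace α]
    {f : α → ProbabilityMeasure ℝ}
    (h : ∀ q : ℚ, Measurable fun a => (f a : Measure ℝ) (Set.Iic (q : ℝ))) : Measurable f := by
  refine Measurable.subtype_mk (f := fun a => (f a : Measure ℝ))
    (Measurable.measure_of_isPiSystem_of_isProbabilityMeasure
      ((BorelSpace.measurable_eq (α := ℝ)).trans Real.borel_eq_generateFrom_Iic_rat)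
      Real.isPiSystem_Iic_rat ?_)
  intro s hs
  obtain ⟨q, rfl⟩ := Set.mem_iUnion.1 hs
  exact h q

/-- The masses of the rational half-lines generate the σ-algebra. Countable generation is what makes
conditional laws of random measures unique almost everywhere. -/
instance countablyGenerated_probabilityMeasure :
    MeasurableSpace.CountablyGenerated (ProbabilityMeasure ℝ) := by
  let e : ProbabilityMeasure ℝ → ℚ → ℝ≥0∞ := fun π q => (π : Measure ℝ) (Set.Iic (q : ℝ))
  have he : (inferInstance : MeasurableSpace (ProbabilityMeasure ℝ))
      = MeasurableSpace.comap e inferInstance := by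
    refine le_antisymm ?_ ?_
    · have h1 : @Measurable _ _ (MeasurableSpace.comap e inferInstance) _ e := comap_measurable e
      have h3 := @measurable_of_measurable_Iic_rat _ (MeasurableSpace.comap e inferInstance)
        id fun q => (measurable_pi_apply q).comp h1
      intro s hs
      exact h3 hs
    · exact measurable_iff_comap_le.1 (measurable_pi_iff.2 fun q =>
        (Measure.measurable_coe measurableSet_Iic).comp measurable_subtype_coe)
  have h := MeasurableSpace.CountablyGenerated.comap e
  rwa [← he] at h

end Wasserstein

/-! ### The coupling bound for the empirical measures. -/

section FirstPart

lemma threshold_one_lt {Ω : Type*} {Z : ℕ → Ω → ℝ} {n k : ℕ} (hkn : k < n) {ω : Ω}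
    (h : ∀ i, 1 < Z i ω) : 1 < threshold Z n k ω :=
  orderStat_mem (s := Set.Ioi 1) (fun i => h i) (by omega) (by omega)

lemma orderStat_sample {Ω : Type*} {Z : ℕ → Ω → ℝ} (F : Measure ℝ) {n m : ℕ}
    (hm : 0 < m) (hmn : m ≤ n) {ω : Ω} (h : ∀ i, 1 < Z i ω) :
    orderStat (sample (tailQuantile F) Z n ω) m
      = tailQuantile F (orderStat (fun i : Fin n => Z i ω) m) :=
  orderStat_comp_monotoneOn (monotoneOn_tailQuantile F) (fun i => h i) hm hmn

lemma relExceed_sample {Ω : Type*} {Z : ℕ → Ω → ℝ} (F : Measure ℝ) {n k : ℕ} (hkn : k < n) {ω : Ω}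
    (h : ∀ i, 1 < Z i ω) : relExceed k (sample (tailQuantile F) Z n ω)
      = fun i : Fin k => tailQuantile F (orderStat (fun i : Fin n => Z i ω) (n - i))
        / tailQuantile F (threshold Z n k ω) := by
  funext i
  rw [relExceed, orderStat_sample F (by omega) (by omega) h,
    orderStat_sample F (by omega) (by omega) h]
  rfl

variable {Ω : Type*} [MeasurableSpace Ω] {P : Measure Ω} [IsProbabilityMeasure P] {Z : ℕ → Ω → ℝ}

lemma ae_one_lt {Ω : Type*} [MeasurableSpace Ω] {P : Measure Ω} {Z : ℕ → Ω → ℝ}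
    (hZ : ∀ i, HasLaw (Z i) (paretoMeasure 1 1) P) : ∀ᵐ ω ∂P, ∀ i, 1 < Z i ω :=
  ae_all_iff.2 fun i => ((hZ i).ae_iff (measurableSet_setOfPred.1 measurableSet_Ioi)).2
    (ae_one_lt_paretoMeasure one_pos)

lemma hasCondDistrib_congr_left {Ω α β : Type*} [MeasurableSpace α] [MeasurableSpace β]
    [MeasurableSpace Ω] {P : Measure Ω} {X : Ω → α} {Y Y' : Ω → β} {κ : Kernel α β}
    (h : HasCondDistrib Y X κ P) (hY : Y =ᵐ[P] Y') :
    HasCondDistrib Y' X κ P :=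
  HasLaw.congr (X := fun ω => (X ω, Y ω)) h (by
    filter_upwards [hY] with ω hω
    simp only [hω])

/-- Transfers what is known of the explicit conditional law to an arbitrary version. -/
lemma ae_eq_of_hasCondDistrib {α β : Type*} [MeasurableSpace α] [MeasurableSpace β]
    [MeasurableSpace.CountablyGenerated β]
    {X : Ω → α} {Y : Ω → β} {κ η : Kernel α β} [IsMarkovKernel κ] [IsMarkovKernel η]
    (h : HasCondDistrib Y X κ P) (h' : HasCondDistrib Y X η P) : κ =ᵐ[P.map X] η :=
  have := Measure.isProbabilityMeasure_map (μ := P) h.aemeasurable_fst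
  Kernel.ae_eq_of_compProd_eq (h.map_eq.symm.trans h'.map_eq)

/-- The empirical measure of `U (u_i) / U (x)`. -/
noncomputable def ratioEmpirical (U : ℝ → ℝ) {k : ℕ} (hk : 0 < k) (q : ℝ × (Fin k → ℝ)) :
    ProbabilityMeasure ℝ :=
  empirical k hk fun i => U (q.2 i) / U q.1

lemma measurable_ratioEmpirical {U : ℝ → ℝ} (hU : Measurable U) {k : ℕ} (hk : 0 < k) :
    Measurable (ratioEmpirical U hk) :=
  (measurable_empirical hk).comp (measurable_pi_iff.2 fun i => by fun_prop)

lemma hasCondDistrib_empirical (hZ : ∀ i, HasLaw (Z i) (paretoMeasure 1 1) P)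
    (hind : iIndepFun Z P) (F : Measure ℝ) {n k : ℕ} (hk : 0 < k) (hkn : k < n) :
    HasCondDistrib (fun ω => empirical k hk (relExceed k (sample (tailQuantile F) Z n ω)))
      (threshold Z n k) (scaledKernel k (ratioEmpirical (tailQuantile F) hk)) P := by
  refine hasCondDistrib_congr_left (hasCondDistrib_scaledKernel hZ hind hkn
    (measurable_ratioEmpirical (measurable_tailQuantile F) hk) fun x u τ => ?_) ?_
  · exact empirical_comp_perm hk (fun i => tailQuantile F (u i) / tailQuantile F x) τ
  · filter_upwards [ae_one_lt hZ] with ω hω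
    rw [relExceed_sample F hkn hω]
    rfl

lemma measurable_boxCox (ρ : ℝ) : Measurable (boxCox ρ) := by
  unfold boxCox
  split_ifs <;> fun_prop

lemma measurable_correctedPoint (γ ρ a : ℝ) : Measurable (correctedPoint γ ρ a) := by
  have h := measurable_boxCox ρ
  unfold correctedPoint
  fun_prop

/-- A power of a unit Pareto variable is Pareto of index $1/\gamma$; this puts both empirical
measures on the same sample. -/
lemma correctedLaw_eq {γ : ℝ} (hγ : 0 < γ) (ρ a : ℝ) {k : ℕ} (hk : 0 < k) :
    correctedLaw γ ρ a k hk = (Measure.pi fun _ : Fin k => paretoMeasure 1 1).map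
      fun y => empirical k hk fun i => correctedPoint γ ρ a (y i ^ γ) := by
  have hm : Measurable fun z : ℝ => z ^ γ := by fun_prop
  have := isProbabilityMeasure_paretoMeasure one_pos (one_div_pos.2 hγ)
  have := Measure.isProbabilityMeasure_map (μ := paretoMeasure 1 1) hm.aemeasurable
  have hc := measurable_correctedPoint γ ρ a
  have hc' : Measurable fun (y : Fin k → ℝ) (i : Fin k) => correctedPoint γ ρ a (y i) := by
    fun_prop
  have hce : Measurable fun y : Fin k → ℝ =>
      empirical k hk fun i => correctedPoint γ ρ a (y i) := (measurable_empirical hk).comp hc'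
  rw [correctedLaw, ← map_rpow_unitPareto hγ, ← Measure.pi_map_pi fun _ => hm.aemeasurable,
    Measure.map_map hce (by fun_prop)]
  rfl

lemma boxCox_strictMonoOn (ρ : ℝ) : StrictMonoOn (boxCox ρ) (Set.Ioi 0) := by
  intro x hx y hy hxy
  unfold boxCox
  have hx : 0 < x := hx
  rcases lt_trichotomy ρ 0 with h | h | h
  · rw [if_neg h.ne, if_neg h.ne]
    exact div_lt_div_of_neg_of_lt h (by linarith [Real.rpow_lt_rpow_of_neg hx hxy h])
  · rw [if_pos h, if_pos h]
    exact Real.log_lt_log hx hxy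
  · rw [if_neg h.ne', if_neg h.ne']
    exact div_lt_div_of_pos_right (by linarith [Real.rpow_lt_rpow hx.le hxy h]) h

/-- By strict monotonicity the factor vanishes at one point at most, a null set. This point must be
avoided in splitting the logarithm of a product, since `Real.log 0 = 0`. -/
lemma ae_one_add_mul_boxCox_ne_zero (a ρ : ℝ) :
    ∀ᵐ z ∂(paretoMeasure 1 1), 1 + a * boxCox ρ z ≠ 0 := by
  have h : ({z | 1 + a * boxCox ρ z = 0} ∩ Set.Ioi 1).Subsingleton := by
    rintro x ⟨hx, hx1⟩ y ⟨hy, hy1⟩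
    have ha : a ≠ 0 := by rintro rfl; simp at hx
    refine (boxCox_strictMonoOn ρ).injOn (one_pos.trans (Set.mem_Ioi.1 hx1))
      (one_pos.trans (Set.mem_Ioi.1 hy1))
      (mul_left_cancel₀ ha ?_)
    have hx : 1 + a * boxCox ρ x = 0 := hx
    have hy : 1 + a * boxCox ρ y = 0 := hy
    linarith
  filter_upwards [ae_one_lt_paretoMeasure one_pos,
    measure_eq_zero_iff_ae_notMem.1 (h.measure_zero (paretoMeasure 1 1))] with z h1 h2 h3
  exact h2 ⟨h3, h1⟩

lemma bound_eq (U A : ℝ → ℝ) (γ ρ p t : ℝ) : bound U A γ ρ p t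
    = (∫⁻ z, ENNReal.ofReal (|Real.log (U (z * t) / (z ^ γ * U t))
      - Real.log (|1 + A t * boxCox ρ z|)| ^ p) ∂(paretoMeasure 1 1)) ^ (1 / p) := by
  rw [bound, lintegral_unitPareto]
  congr 1
  refine lintegral_congr fun z => ?_
  rw [← ENNReal.ofReal_mul (by positivity)]
  congr 1
  ring

lemma lintegral_pi_average {k : ℕ} (hk : 0 < k) (μ : Measure ℝ) [IsProbabilityMeasure μ]
    {φ : ℝ → ℝ≥0∞} (hφ : Measurable φ) :
    ∫⁻ y, (k : ℝ≥0∞)⁻¹ * ∑ i, φ (y i) ∂(Measure.pi fun _ : Fin k => μ) = ∫⁻ z, φ z ∂μ := by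
  have hm : ∀ i : Fin k, Measurable fun y : Fin k → ℝ => φ (y i) := fun i =>
    hφ.comp (measurable_pi_apply i)
  have he : ∀ i : Fin k, ∫⁻ y, φ (y i) ∂(Measure.pi fun _ : Fin k => μ) = ∫⁻ z, φ z ∂μ := fun i =>
    (measurePreserving_eval (fun _ : Fin k => μ) i).lintegral_comp hφ
  rw [lintegral_const_mul _ (Finset.measurable_sum _ fun i _ => hm i),
    lintegral_finsetSum _ fun i _ => hm i]
  simp only [he, Finset.sum_const, Finset.card_univ, Fintype.card_fin, nsmul_eq_mul]
  rw [← mul_assoc, ENNReal.inv_mul_cancel (by exact_mod_cast hk.ne') (by simp), one_mul]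

/-- The empirical measures built on the same unit Pareto sample form a coupling whose cost is at
most the bound. -/
lemma wasserstein₂_scaledKernel_le (F : Measure ℝ) (A : ℝ → ℝ) {γ ρ p t₀ t : ℝ} (hγ : 0 < γ)
    (hp : 1 ≤ p) (ht₀ : 1 ≤ t₀) (hU : 0 < tailQuantile F t₀) {k : ℕ} (hk : 0 < k) (ht : t₀ ≤ t) :
    wasserstein₂ p (scaledKernel k (ratioEmpirical (tailQuantile F) hk) t)
        (correctedLaw γ ρ (A t) k hk) ≤ bound (tailQuantile F) A γ ρ p t := by
  set U := tailQuantile F with hUdef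
  have hUm : Measurable U := measurable_tailQuantile F
  have hp0 : 0 < p := by linarith
  have ht1 : 1 < t := (one_lt_of_tailQuantile_pos ht₀ hU).trans_le ht
  have hUt : ∀ s, t₀ ≤ s → 0 < U s := fun s hs => hU.trans_le <|
    monotoneOn_tailQuantile F (one_lt_of_tailQuantile_pos ht₀ hU)
      ((one_lt_of_tailQuantile_pos ht₀ hU).trans_le hs) hs
  have hc := measurable_correctedPoint γ ρ (A t)
  have hm1 : Measurable fun y : Fin k → ℝ => ratioEmpirical U hk (t, fun i => t * y i) :=
    (measurable_ratioEmpirical hUm hk).comp (by fun_prop)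
  have hm2 : Measurable fun y : Fin k → ℝ =>
      empirical k hk fun i => correctedPoint γ ρ (A t) (y i ^ γ) :=
    (measurable_empirical hk).comp (measurable_pi_iff.2 fun i => by fun_prop)
  rw [scaledKernel_apply (measurable_ratioEmpirical hUm hk), correctedLaw_eq hγ, bound_eq]
  refine (wasserstein_map_le _ _ hp0 hm1 hm2).trans
    (ENNReal.rpow_le_rpow ?_ (by positivity))
  set φ : ℝ → ℝ≥0∞ := fun z => logDist (U (t * z) / U t) (correctedPoint γ ρ (A t) (z ^ γ)) ^ p
    with hφ
  have hφm : Measurable φ := by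
    simp only [hφ, logDist]
    fun_prop
  calc _ ≤ ∫⁻ y, (k : ℝ≥0∞)⁻¹ * ∑ i, φ (y i) ∂(Measure.pi fun _ : Fin k => paretoMeasure 1 1) := by
        refine lintegral_mono fun y => ?_
        refine (ENNReal.rpow_le_rpow (wasserstein_empirical_le logDist p hk _ _) hp0.le).trans ?_
        rw [← ENNReal.rpow_mul, one_div, inv_mul_cancel₀ hp0.ne', ENNReal.rpow_one]
    _ = ∫⁻ z, φ z ∂(paretoMeasure 1 1) := lintegral_pi_average hk _ hφm
    _ ≤ _ := by
        refine lintegral_mono_ae ?_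
        filter_upwards [ae_one_lt_paretoMeasure one_pos,
          ae_one_add_mul_boxCox_ne_zero (A t) ρ] with z hz hz0
        have hz' : 0 < z := by linarith
        have hzt : 0 < U (t * z) := hUt _ (ht.trans (by nlinarith))
        have hzg : 0 < z ^ γ := by positivity
        simp only [hφ, logDist]
        rw [ENNReal.ofReal_rpow_of_nonneg (abs_nonneg _) hp0.le]
        have e : Real.log (U (t * z) / U t) - Real.log (correctedPoint γ ρ (A t) (z ^ γ))
            = Real.log (U (z * t) / (z ^ γ * U t)) - Real.log |1 + A t * boxCox ρ z| := by
          unfold correctedPoint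
          rw [← Real.rpow_mul hz'.le, mul_one_div_cancel hγ.ne', Real.rpow_one,
            Real.log_mul hzg.ne' (abs_ne_zero.2 hz0), mul_comm z t,
            Real.log_div hzt.ne' (mul_pos hzg (hUt t ht)).ne',
            Real.log_div hzt.ne' (hUt t ht).ne', Real.log_mul hzg.ne' (hUt t ht).ne']
          ring
        rw [e]

end FirstPart

/-! ### From pointwise to locally uniform control of increments. -/

section UniformConvergence

/-- The sets of points that are good from rank `N` on increase to $[0,2]$, so their outer measure
tends to 2; no measurability in `y` is required. The value $3/2$ is chosen so that two such sets
cannot be disjoint inside $[0,3]$. -/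
lemma eventually_lt_volume {Q : ℕ → ℝ → Prop} (hQ : ∀ y ∈ Set.Icc (0 : ℝ) 2, ∀ᶠ n in atTop, Q n y) :
    ∀ᶠ N in atTop, ENNReal.ofReal (3 / 2) < volume {y | y ∈ Set.Icc (0 : ℝ) 2 ∧ Q N y} := by
  set E : ℕ → Set ℝ := fun N => {y | y ∈ Set.Icc (0 : ℝ) 2 ∧ ∀ n, N ≤ n → Q n y} with hE
  have hmono : Monotone E := fun N M hNM y hy => ⟨hy.1, fun n hn => hy.2 n (hNM.trans hn)⟩
  have hU : ⋃ N, E N = Set.Icc 0 2 := by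
    ext y
    simp only [hE, Set.mem_iUnion, Set.mem_ofPred_eq]
    refine ⟨fun ⟨N, h, _⟩ => h, fun hy => ?_⟩
    obtain ⟨N, hN⟩ := eventually_atTop.1 (hQ y hy)
    exact ⟨N, hy, hN⟩
  have ht := tendsto_measure_iUnion_atTop (μ := volume) hmono
  rw [hU, Real.volume_Icc] at ht
  have h32 : ENNReal.ofReal (3 / 2) < ENNReal.ofReal (2 - 0) :=
    (ENNReal.ofReal_lt_ofReal_iff (by norm_num)).2 (by norm_num)
  filter_upwards [ht.eventually (lt_mem_nhds h32)] with N hN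
  exact hN.trans_le (measure_mono fun y hy => ⟨hy.1, hy.2 N le_rfl⟩)

/-- Pointwise bounds for the increments of a measurable function are locally uniform. -/
lemma eventually_forall_increment_le {h a : ℝ → ℝ} (hh : Measurable h) {C C' : ℝ} (hC : 0 ≤ C)
    (hlim : ∀ y ∈ Set.Icc (0 : ℝ) 2, ∀ᶠ x in atTop, |h (x + y) - h x| ≤ C * |a x|)
    (ha : ∀ᶠ x in atTop, ∀ u ∈ Set.Icc (0 : ℝ) 1, |a (x + u)| ≤ C' * |a x|) :
    ∀ᶠ x in atTop, ∀ u ∈ Set.Icc (0 : ℝ) 1, |h (x + u) - h x| ≤ C * (1 + C') * |a x| := by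
  -- Suppose bad pairs $s_n\to\infty$, $u_n\in[0,1]$ exist. The good end points seen from $s_n$ and
  -- those seen from $s_n+u_n$ both lie in $[0,3]$ and will be shown to meet; passing through a
  -- common end point bounds the bad increment.
  by_contra hcon
  obtain ⟨s, hs, hs'⟩ := exists_seq_forall_of_frequently
    ((not_eventually.1 hcon).and_eventually ha)
  have hs1 := fun n => (hs' n).1
  push Not at hs1
  choose u hu hbad using hs1
  have hsu : Tendsto (fun n => s n + u n) atTop atTop :=
    tendsto_atTop_mono (fun n => le_add_of_nonneg_right (hu n).1) hs
  obtain ⟨N, hV, hW⟩ := ((eventually_lt_volume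
    (Q := fun n y => |h (s n + y) - h (s n)| ≤ C * |a (s n)|)
    fun y hy => hs.eventually (hlim y hy)).and (eventually_lt_volume
    (Q := fun n y => |h (s n + u n + y) - h (s n + u n)| ≤ C * |a (s n + u n)|)
    fun y hy => hsu.eventually (hlim y hy))).exists
  set V := {y | y ∈ Set.Icc (0 : ℝ) 2 ∧ |h (s N + y) - h (s N)| ≤ C * |a (s N)|}
  set W := {y | y ∈ Set.Icc (0 : ℝ) 2 ∧ |h (s N + u N + y) - h (s N + u N)| ≤ C * |a (s N + u N)|}
    with hWdef
  have hWm : MeasurableSet W := measurableSet_Icc.inter (measurableSet_le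
    (f := fun y => |h (s N + u N + y) - h (s N + u N)|) (by fun_prop) measurable_const)
  have hW' : ENNReal.ofReal (3 / 2) < volume ((fun y => -u N + y) ⁻¹' W) := by
    rwa [measure_preimage_add]
  -- The total measure exceeds 3, so the two sets intersect.
  have hsum : volume (Set.Icc (0 : ℝ) 3) < volume V + volume ((fun y => -u N + y) ⁻¹' W) := by
    refine lt_of_eq_of_lt ?_ (ENNReal.add_lt_add hV hW')
    rw [Real.volume_Icc, ← ENNReal.ofReal_add (by norm_num) (by norm_num)]
    norm_num
  have hV3 : V ⊆ Set.Icc 0 3 := fun y hy => ⟨hy.1.1, hy.1.2.trans (by norm_num)⟩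
  have hW3 : (fun y => -u N + y) ⁻¹' W ⊆ Set.Icc 0 3 := fun y hy =>
    ⟨by linarith [hy.1.1, (hu N).1], by linarith [hy.1.2, (hu N).2]⟩
  obtain ⟨y, hy1, hy2⟩ := nonempty_inter_of_measure_lt_add volume
    (hWm.preimage (measurable_const_add _)) hV3 hW3 hsum
  have h1 : |h (s N + y) - h (s N)| ≤ C * |a (s N)| := hy1.2
  have h2 : |h (s N + u N + (-u N + y)) - h (s N + u N)| ≤ C * |a (s N + u N)| := hy2.2
  rw [show s N + u N + (-u N + y) = s N + y by ring] at h2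
  have h3 := mul_le_mul_of_nonneg_left ((hs' N).2 (u N) (hu N)) hC
  have h4 : |h (s N + u N) - h (s N)| ≤ C * |a (s N)| + C * |a (s N + u N)| := by
    refine (abs_sub_le _ (h (s N + y)) _).trans ?_
    rw [abs_sub_comm (h (s N + u N))]
    linarith
  linarith [hbad N]

end UniformConvergence

/-! ### Potter bounds in additive form. -/

section Potter
variable {h a ψ : ℝ → ℝ} {ρ : ℝ}

/-- Local uniformity of the regular variation of `a`, in additive form, when `a` is the auxiliary
function of a measurable function `h`. -/
lemma eventually_log_abs_increment (hh : Measurable h) (ha0 : ∀ᶠ x in atTop, a x ≠ 0)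
    (hψ : ψ 1 ≠ 0)
    (hlim : ∀ u, Tendsto (fun x => (h (x + u) - h x) / a x) atTop (𝓝 (ψ u)))
    (hreg : ∀ u, Tendsto (fun x => a (x + u) / a x) atTop (𝓝 (Real.exp (ρ * u))))
    {ε : ℝ} (hε : 0 < ε) :
    ∀ᶠ x in atTop, ∀ u ∈ Set.Icc (0 : ℝ) 1,
      |Real.log |a (x + u)| - Real.log |a x| - ρ * u| ≤ ε := by
  -- The function `a` is not assumed measurable. The increment `b` of `h` is, and `b / a` tends to
  -- `ψ 1 ≠ 0`, so regular variation is studied on `b`.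
  set b : ℝ → ℝ := fun x => h (x + 1) - h x with hb
  set g : ℝ → ℝ := fun x => Real.log |b x| - ρ * x with hg
  have hgm : Measurable g := by fun_prop
  have hshift : ∀ u : ℝ, Tendsto (fun x : ℝ => x + u) atTop atTop := fun u =>
    tendsto_atTop_add_const_right _ u tendsto_id
  have hb0 : ∀ᶠ x in atTop, b x ≠ 0 := by
    filter_upwards [(hlim 1).eventually_ne hψ] with x hx h0
    rw [show h (x + 1) - h x = 0 from h0, zero_div] at hx
    exact hx rfl
  have hlog : Tendsto (fun x => Real.log |b x| - Real.log |a x|) atTop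
      (𝓝 (Real.log |ψ 1|)) := by
    refine ((hlim 1).abs.log (abs_ne_zero.2 hψ)).congr' ?_
    filter_upwards [ha0, hb0] with x h1 h2
    rw [abs_div, Real.log_div (abs_ne_zero.2 h2) (abs_ne_zero.2 h1)]
  have hloga : ∀ u, Tendsto (fun x => Real.log |a (x + u)| - Real.log |a x|) atTop
      (𝓝 (ρ * u)) := by
    intro u
    have h1 := (hreg u).abs.log (abs_ne_zero.2 (Real.exp_pos _).ne')
    rw [abs_of_pos (Real.exp_pos _), Real.log_exp] at h1
    refine h1.congr' ?_
    filter_upwards [ha0, (hshift u).eventually ha0] with x h1 h2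
    rw [abs_div, Real.log_div (abs_ne_zero.2 h2) (abs_ne_zero.2 h1)]
  have hg0 : ∀ u, Tendsto (fun x => g (x + u) - g x) atTop (𝓝 0) := by
    intro u
    have h1 := ((hlog.comp (hshift u)).add (hloga u)).sub hlog
    have h2 := h1.sub_const (ρ * u)
    rw [add_sub_cancel_left, sub_self] at h2
    refine h2.congr fun x => ?_
    simp only [hg, Function.comp_apply]
    ring
  -- This contributes at most $(\varepsilon/4)(1+1)=\varepsilon/2$; replacing `a` by `b` at the two
  -- end points costs $\varepsilon/4$ each.
  have hu := eventually_forall_increment_le (a := fun _ => 1) hgm (C := ε / 4) (C' := 1)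
    (by positivity) (fun y _ => by
      filter_upwards [(hg0 y).abs.eventually (gt_mem_nhds (by rw [abs_zero]; positivity :
        |(0 : ℝ)| < ε / 4))] with x hx
      simpa using hx.le) (by simp)
  have hclose : ∀ᶠ x in atTop, |Real.log |b x| - Real.log |a x| - Real.log (|ψ 1|)| ≤ ε / 4 := by
    have := (hlog.sub_const (Real.log |ψ 1|)).abs
    rw [sub_self, abs_zero] at this
    exact (this.eventually (gt_mem_nhds (by positivity : 0 < ε / 4))).mono fun x hx => hx.le
  obtain ⟨x₀, hx₀⟩ := eventually_atTop.1 hclose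
  filter_upwards [hu, eventually_ge_atTop x₀] with x h1 h2 u hu
  have e1 := abs_le.1 (h1 u hu)
  have e2 := abs_le.1 (hx₀ x h2)
  have e3 := abs_le.1 (hx₀ (x + u) (by linarith [hu.1]))
  simp only [hg, abs_one] at e1
  rw [abs_le]
  constructor <;> linarith [e1.1, e1.2, e2.1, e2.2, e3.1, e3.2]

/-- Potter type bound for the increments of `h`. -/
lemma potter (hh : Measurable h) (ha0 : ∀ᶠ x in atTop, a x ≠ 0) (hψ : ψ 1 ≠ 0)
    (hψb : ∃ B, ∀ u ∈ Set.Icc (0 : ℝ) 2, |ψ u| ≤ B) (hρ : ρ ≤ 0)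
    (hlim : ∀ u, Tendsto (fun x => (h (x + u) - h x) / a x) atTop (𝓝 (ψ u)))
    (hreg : ∀ u, Tendsto (fun x => a (x + u) / a x) atTop (𝓝 (Real.exp (ρ * u))))
    {δ : ℝ} (hδ : 0 < δ) :
    ∃ D, 0 ≤ D ∧ ∀ᶠ x in atTop, ∀ v, 0 ≤ v →
      |h (x + v) - h x| ≤ D * Real.exp (δ * v) * |a x| := by
  obtain ⟨B, hB⟩ := hψb
  have hB0 : 0 ≤ B := (abs_nonneg _).trans (hB 0 ⟨le_rfl, by norm_num⟩)
  have hgrow : ∀ ε, 0 < ε → ∀ᶠ x in atTop, ∀ u ∈ Set.Icc (0 : ℝ) 1,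
      |a (x + u)| ≤ Real.exp ε * |a x| := by
    intro ε hε
    obtain ⟨x₀, hx₀⟩ := eventually_atTop.1 ha0
    filter_upwards [eventually_log_abs_increment hh ha0 hψ hlim hreg hε,
      eventually_ge_atTop x₀] with x h1 h2 u hu
    have p1 : 0 < |a x| := abs_pos.2 (hx₀ x h2)
    have p2 : 0 < |a (x + u)| := abs_pos.2 (hx₀ (x + u) (by linarith [hu.1]))
    rw [← Real.log_le_log_iff p2 (by positivity), Real.log_mul (Real.exp_pos _).ne' p1.ne',
      Real.log_exp]
    have h3 := (abs_le.1 (h1 u hu)).2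
    nlinarith [mul_nonneg (neg_nonneg.2 hρ) hu.1]
  have hloc := eventually_forall_increment_le hh (a := a) (C := B + 1) (by positivity)
    (fun y hy => by
      filter_upwards [((hlim y).abs.eventually (gt_mem_nhds
        (lt_of_le_of_lt (hB y hy) (lt_add_one B)))), ha0] with x h1 h2
      rw [abs_div, div_lt_iff₀ (abs_pos.2 h2)] at h1
      exact h1.le) (hgrow 1 one_pos)
  set C := (B + 1) * (1 + Real.exp 1) with hC
  have hC0 : 0 ≤ C := by positivity
  -- Over a unit step `a` grows at most by $e^{\delta'}$, while the bound to be proved gains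
  -- $e^{2\delta'}$. The surplus absorbs the new increment.
  set δ' := δ / 2 with hδ'
  have hδ'0 : 0 < δ' := by positivity
  have hexp : 0 < Real.exp δ' - 1 := by linarith [Real.add_one_lt_exp hδ'0.ne']
  -- Large enough for a single step, and such that $D(e^{\delta'}-1)\ge C$, which closes the
  -- induction over unit steps.
  set D := C + C / (Real.exp δ' - 1) with hD
  have hD0 : 0 ≤ D := by positivity
  have hD1 : C ≤ D * (Real.exp δ' - 1) := by
    rw [hD, add_mul, div_mul_cancel₀ _ hexp.ne']
    nlinarith
  refine ⟨D, hD0, ?_⟩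
  obtain ⟨x₀, hx₀⟩ := eventually_atTop.1 (hloc.and (hgrow δ' hδ'0))
  have key : ∀ (m : ℕ) (x : ℝ), x₀ ≤ x → ∀ u ∈ Set.Icc (0 : ℝ) 1,
      |h (x + m + u) - h x| ≤ D * Real.exp (δ * m) * |a x| := by
    intro m
    induction m with
    | zero =>
      intro x hx u hu
      have h1 := (hx₀ x hx).1 u hu
      have h2 : C * |a x| ≤ D * |a x| := by
        refine mul_le_mul_of_nonneg_right ?_ (abs_nonneg _)
        rw [hD]
        linarith [div_nonneg hC0 hexp.le]
      simpa using h1.trans h2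
    | succ m ih =>
      intro x hx u hu
      have h1 := ih (x + 1) (by linarith) u hu
      have h2 := (hx₀ x hx).1 1 ⟨zero_le_one, le_rfl⟩
      have h3 := (hx₀ x hx).2 1 ⟨zero_le_one, le_rfl⟩
      have h4 : |h (x + (m + 1 : ℕ) + u) - h x| ≤ D * Real.exp (δ * m) * |a (x + 1)|
          + C * |a x| := by
        refine (abs_sub_le _ (h (x + 1)) _).trans (add_le_add ?_ h2)
        rw [show x + (m + 1 : ℕ) + u = x + 1 + m + u by push_cast; ring]
        exact h1
      refine h4.trans ?_
      have h5 : D * Real.exp (δ * m) * |a (x + 1)|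
          ≤ D * Real.exp (δ * m) * (Real.exp δ' * |a x|) :=
        mul_le_mul_of_nonneg_left h3 (by positivity)
      have h6 : Real.exp (δ * (m + 1 : ℕ)) = Real.exp (δ * m) * Real.exp δ' * Real.exp δ' := by
        rw [← Real.exp_add, ← Real.exp_add]
        congr 1
        push_cast
        rw [hδ']
        ring
      have h7 : C ≤ D * Real.exp (δ * m) * Real.exp δ' * (Real.exp δ' - 1) := by
        have e1 : 1 ≤ Real.exp (δ * m) * Real.exp δ' := by
          rw [← Real.exp_add]
          exact Real.one_le_exp (by positivity)
        calc C ≤ D * (Real.exp δ' - 1) := hD1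
          _ = D * (Real.exp δ' - 1) * 1 := (mul_one _).symm
          _ ≤ D * (Real.exp δ' - 1) * (Real.exp (δ * m) * Real.exp δ') :=
            mul_le_mul_of_nonneg_left e1 (by positivity)
          _ = _ := by ring
      rw [h6]
      nlinarith [mul_le_mul_of_nonneg_right h7 (abs_nonneg (a x))]
  filter_upwards [eventually_ge_atTop x₀] with x hx v hv
  have h1 := key ⌊v⌋₊ x hx (v - ⌊v⌋₊)
    ⟨by linarith [Nat.floor_le hv], by linarith [Nat.lt_floor_add_one v]⟩
  rw [show x + ⌊v⌋₊ + (v - ⌊v⌋₊) = x + v by ring] at h1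
  refine h1.trans (mul_le_mul_of_nonneg_right (mul_le_mul_of_nonneg_left ?_ hD0) (abs_nonneg _))
  exact Real.exp_le_exp.2 (mul_le_mul_of_nonneg_left (Nat.floor_le hv) hδ.le)

end Potter

/-! ### Logarithmic form of the second order condition. -/

section SecondOrder
variable {U A : ℝ → ℝ} {γ ρ : ℝ}

/-- The slowly varying part of `U`, on the logarithmic scale. -/
noncomputable def logDefect (U : ℝ → ℝ) (γ t : ℝ) : ℝ := Real.log (U t) - γ * Real.log t

lemma measurable_logDefect (hU : Measurable U) (γ : ℝ) : Measurable (logDefect U γ) := by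
  unfold logDefect
  fun_prop

lemma SecondOrder.eventually_ne_zero (hA : SecondOrder U A γ ρ) : ∀ᶠ t in atTop, A t ≠ 0 :=
  hA.sign.elim (fun h => h.mono fun _ h => h.ne') fun h => h.mono fun _ h => h.ne

lemma SecondOrder.tendsto_ratio (hA : SecondOrder U A γ ρ) {x : ℝ} (hx : 0 < x) :
    Tendsto (fun t => U (t * x) / U t) atTop (𝓝 (x ^ γ)) := by
  have h := ((hA.limit x hx).mul hA.tendsto_zero).add_const (x ^ γ)
  rw [mul_zero, zero_add] at h
  refine h.congr' ?_
  filter_upwards [hA.eventually_ne_zero] with t ht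
  rw [div_mul_cancel₀ _ ht]
  ring

/-- The ratio $U(2t)/U(t)$ tends to $2^\gamma>1$. For $U(t)<0$ a ratio above 1 would contradict
monotonicity, and for $U(t)=0$ the ratio is 0 by convention. -/
lemma SecondOrder.eventually_pos (hA : SecondOrder U A γ ρ) (hγ : 0 < γ)
    (hU : MonotoneOn U (Set.Ioi 1)) : ∀ᶠ t in atTop, 0 < U t := by
  have h1 := hA.tendsto_ratio (x := 2) two_pos
  have h2 : (1 : ℝ) < 2 ^ γ := Real.one_lt_rpow (by norm_num) hγ
  have h3 : ∀ᶠ t in atTop, 0 < U (t * 2) := by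
    filter_upwards [h1.eventually (lt_mem_nhds h2), eventually_gt_atTop 1] with t ht h1t
    have hm : U t ≤ U (t * 2) := hU h1t (show (1 : ℝ) < t * 2 by linarith) (by linarith)
    rcases lt_trichotomy (U t) 0 with h | h | h
    · rw [lt_div_iff_of_neg h] at ht
      linarith
    · rw [h, div_zero] at ht
      linarith
    · exact h.trans_le hm
  have h4 : Tendsto (fun t : ℝ => t / 2) atTop atTop := tendsto_id.atTop_div_const two_pos
  filter_upwards [h4.eventually h3] with t ht
  rwa [div_mul_cancel₀ _ two_ne_zero] at ht

lemma tendsto_log_one_add_mul_div {ι : Type*} {l : Filter ι} {a c : ι → ℝ} {c₀ : ℝ}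
    (ha : Tendsto a l (𝓝 0)) (ha0 : ∀ᶠ i in l, a i ≠ 0) (hc : Tendsto c l (𝓝 c₀)) :
    Tendsto (fun i => Real.log (1 + a i * c i) / a i) l (𝓝 c₀) := by
  have hd : HasDerivAt (fun x : ℝ => Real.log (1 + x)) 1 0 := by
    have h := (HasDerivAt.const_add (1 : ℝ) (hasDerivAt_id (0 : ℝ))).log (by simp)
    simpa using h
  have hw : Tendsto (fun i => a i * c i) l (𝓝 0) := by
    have := ha.mul hc
    rwa [zero_mul] at this
  -- The difference quotient of $\log(1+x)$, completed by its derivative at 0, is continuous there;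
  -- this covers the indices where $c_i=0$.
  have hds := hd.continuousAt_div
  have hcont := (hds.tendsto.comp hw).mul hc
  simp only [Function.update_self, one_mul] at hcont
  refine hcont.congr' ?_
  filter_upwards [ha0] with i hi
  simp only [Function.comp_apply, Function.update_apply]
  split_ifs with h
  · have : c i = 0 := (mul_eq_zero.1 h).resolve_left hi
    simp [this]
  · have hci : c i ≠ 0 := fun h0 => h (by rw [h0, mul_zero])
    simp
    field_simp

lemma SecondOrder.tendsto_logDefect (hA : SecondOrder U A γ ρ) (hγ : 0 < γ)
    (hU : MonotoneOn U (Set.Ioi 1)) {x : ℝ} (hx : 0 < x) :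
    Tendsto (fun t => (logDefect U γ (t * x) - logDefect U γ t) / A t) atTop
      (𝓝 (boxCox ρ x)) := by
  have hxg : 0 < x ^ γ := by positivity
  have h1 := (hA.limit x hx).div_const (x ^ γ)
  rw [mul_div_cancel_left₀ _ hxg.ne'] at h1
  refine (tendsto_log_one_add_mul_div hA.tendsto_zero hA.eventually_ne_zero h1).congr' ?_
  have hpos := hA.eventually_pos hγ hU
  have hpos' : ∀ᶠ t in atTop, 0 < U (t * x) :=
    (tendsto_id.atTop_mul_const hx).eventually hpos
  filter_upwards [hpos, hpos', hA.eventually_ne_zero, eventually_gt_atTop 0] with t p1 p2 p3 p4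
  congr 1
  have e : 1 + A t * ((U (t * x) / U t - x ^ γ) / A t / x ^ γ) = U (t * x) / U t / x ^ γ := by
    field_simp
    ring
  rw [e, Real.log_div (by positivity) hxg.ne', Real.log_div p2.ne' p1.ne', Real.log_rpow hx]
  unfold logDefect
  rw [Real.log_mul p4.ne' hx.ne']
  ring

lemma boxCox_one_lt_pos (ρ : ℝ) {x : ℝ} (hx : 1 < x) : 0 < boxCox ρ x := by
  have h1 : boxCox ρ 1 = 0 := by simp [boxCox]
  rw [← h1]
  exact boxCox_strictMonoOn ρ (Set.mem_Ioi.2 one_pos) (Set.mem_Ioi.2 (one_pos.trans hx)) hx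

lemma boxCox_nonneg (ρ : ℝ) {x : ℝ} (hx : 1 ≤ x) : 0 ≤ boxCox ρ x := by
  rcases hx.eq_or_lt with rfl | h
  · simp [boxCox]
  · exact (boxCox_one_lt_pos ρ h).le

lemma boxCox_le_log {ρ : ℝ} (hρ : ρ ≤ 0) {x : ℝ} (hx : 0 < x) : boxCox ρ x ≤ Real.log x := by
  unfold boxCox
  split_ifs with h
  · exact le_rfl
  · have hneg : ρ < 0 := lt_of_le_of_ne hρ h
    rw [div_le_iff_of_neg hneg, Real.rpow_def_of_pos hx]
    linarith [Real.add_one_le_exp (Real.log x * ρ)]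

/-- The additive form of the second order condition. -/
lemma SecondOrder.additive (hA : SecondOrder U A γ ρ) (hγ : 0 < γ)
    (hU : MonotoneOn U (Set.Ioi 1)) :
    (∀ᶠ x in atTop, A (Real.exp x) ≠ 0) ∧
    (∀ u, Tendsto (fun x => (logDefect U γ (Real.exp (x + u)) - logDefect U γ (Real.exp x))
      / A (Real.exp x)) atTop (𝓝 (boxCox ρ (Real.exp u)))) ∧
    (∀ u, Tendsto (fun x => A (Real.exp (x + u)) / A (Real.exp x)) atTop
      (𝓝 (Real.exp (ρ * u)))) := by
  refine ⟨Real.tendsto_exp_atTop.eventually hA.eventually_ne_zero, fun u => ?_, fun u => ?_⟩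
  · refine ((hA.tendsto_logDefect hγ hU (Real.exp_pos u)).comp Real.tendsto_exp_atTop).congr
      fun x => ?_
    rw [Function.comp_apply, Real.exp_add]
  · have h := (hA.regVar _ (Real.exp_pos u)).comp Real.tendsto_exp_atTop
    rw [← Real.exp_mul, mul_comm u] at h
    refine h.congr fun x => ?_
    rw [Function.comp_apply, Real.exp_add]

/-- The additive bound at $x=\log t$, $v=\log z$. The exponent $\delta$ is arbitrary, so $z^\delta$
can be made $p$-integrable against $dz/z^2$. -/
lemma SecondOrder.potter (hA : SecondOrder U A γ ρ) (hγ : 0 < γ) (hρ : ρ ≤ 0)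
    (hU : MonotoneOn U (Set.Ioi 1)) (hUm : Measurable U) {δ : ℝ} (hδ : 0 < δ) :
    ∃ D, 0 ≤ D ∧ ∀ᶠ t in atTop, ∀ z, 1 ≤ z →
      |logDefect U γ (t * z) - logDefect U γ t| ≤ D * z ^ δ * |A t| := by
  obtain ⟨h1, h2, h3⟩ := hA.additive hγ hU
  have hm : Measurable fun x => logDefect U γ (Real.exp x) :=
    (measurable_logDefect hUm γ).comp Real.measurable_exp
  obtain ⟨D, hD, hev⟩ := HillBias.potter (ψ := fun u => boxCox ρ (Real.exp u)) hm h1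
    (boxCox_one_lt_pos ρ (Real.one_lt_exp_iff.2 one_pos)).ne'
    ⟨2, fun u hu => by
      rw [abs_of_nonneg (boxCox_nonneg ρ (Real.one_le_exp hu.1))]
      refine (boxCox_le_log hρ (Real.exp_pos _)).trans ?_
      rw [Real.log_exp]
      exact hu.2⟩ hρ h2 h3 hδ
  refine ⟨D, hD, ?_⟩
  filter_upwards [Real.tendsto_log_atTop.eventually hev, eventually_gt_atTop 0] with t ht ht0 z hz
  have hz0 : 0 < z := by linarith
  have h := ht (Real.log z) (Real.log_nonneg hz)
  rwa [← Real.log_mul ht0.ne' hz0.ne', Real.exp_log ht0, Real.exp_log (mul_pos ht0 hz0),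
    mul_comm δ, ← Real.rpow_def_of_pos hz0] at h

/-- `A` varies slowly on small multiplicative neighbourhoods. -/
lemma SecondOrder.abs_sub_le (hA : SecondOrder U A γ ρ) (hγ : 0 < γ)
    (hU : MonotoneOn U (Set.Ioi 1)) (hUm : Measurable U) {ε : ℝ} (hε : 0 < ε) :
    ∃ η, 0 < η ∧ ∀ᶠ s in atTop, ∀ t, 0 < t → |Real.log (t / s)| ≤ η →
      |A t - A s| ≤ ε * |A s| := by
  obtain ⟨h1, h2, h3⟩ := hA.additive hγ hU
  have hm : Measurable fun x => logDefect U γ (Real.exp x) :=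
    (measurable_logDefect hUm γ).comp Real.measurable_exp
  have hψ := (boxCox_one_lt_pos ρ (Real.one_lt_exp_iff.2 one_pos)).ne'
  have hl : 0 < Real.log (1 + ε) := Real.log_pos (by linarith)
  set κ := Real.log (1 + ε) with hκ
  obtain ⟨x₀, hx₀⟩ := eventually_atTop.1 (eventually_log_abs_increment
    (ψ := fun u => boxCox ρ (Real.exp u)) hm h1 hψ h2 h3 (half_pos hl))
  obtain ⟨s₀, hs₀⟩ : ∃ s₀, (∀ t, s₀ ≤ t → 0 < A t) ∨ ∀ t, s₀ ≤ t → A t < 0 := by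
    rcases hA.sign with h | h
    · obtain ⟨s, hs⟩ := eventually_atTop.1 h
      exact ⟨s, Or.inl hs⟩
    · obtain ⟨s, hs⟩ := eventually_atTop.1 h
      exact ⟨s, Or.inr hs⟩
  -- The bound 1 keeps increments of $\log t$ in the range of the uniform estimate; the other makes
  -- $|\rho|\eta\le\kappa/2$. With the error $\kappa/2$ of that estimate, $\log|A|$ moves by at most
  -- $\kappa=\log(1+\varepsilon)$.
  set η := min 1 (κ / (2 * (|ρ| + 1))) with hη
  have hη0 : 0 < η := by positivity
  have hηρ : |ρ| * η ≤ κ / 2 := by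
    have e1 : η ≤ κ / (2 * (|ρ| + 1)) := min_le_right _ _
    rw [le_div_iff₀ (by positivity)] at e1
    nlinarith [abs_nonneg ρ]
  refine ⟨η, hη0, ?_⟩
  -- Since $\eta\le1$, the point $t$ may be smaller than $s$ by a factor $e$; the margins keep it
  -- beyond $e^{x_0}$ and $s_0$.
  filter_upwards [eventually_ge_atTop (Real.exp (x₀ + 1)), eventually_ge_atTop (s₀ * Real.exp 1),
    eventually_ge_atTop s₀] with s hs hs' hs'' t ht htη
  have hs0 : 0 < s := (Real.exp_pos _).trans_le hs
  have hxs : x₀ + 1 ≤ Real.log s := (Real.le_log_iff_exp_le hs0).2 hs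
  rw [Real.log_div ht.ne' hs0.ne'] at htη
  have htη' := abs_le.1 htη
  have hη1 : η ≤ 1 := min_le_left _ _
  have hst : s₀ ≤ t := by
    rcases le_or_gt s₀ 0 with h | h
    · exact h.trans ht.le
    · have hsp : 0 < s₀ * Real.exp 1 := by positivity
      have e1 := Real.log_le_log hsp hs'
      rw [Real.log_mul h.ne' (Real.exp_pos _).ne', Real.log_exp] at e1
      exact (Real.log_le_log_iff h ht).1 (by linarith)
  have key : ∀ x y, x₀ ≤ x → x ≤ y → y - x ≤ η →
      |Real.log |A (Real.exp y)| - Real.log (|A (Real.exp x)|)| ≤ κ := by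
    intro x y hx hxy hyx
    have e1 := hx₀ x hx (y - x) ⟨by linarith, by linarith⟩
    rw [show x + (y - x) = y by ring] at e1
    have e2 : |ρ * (y - x)| ≤ κ / 2 := by
      rw [abs_mul, abs_of_nonneg (sub_nonneg.2 hxy)]
      exact (mul_le_mul_of_nonneg_left hyx (abs_nonneg _)).trans hηρ
    have e3 := abs_le.1 e1
    have e4 := abs_le.1 e2
    rw [abs_le]
    constructor <;> linarith [e3.1, e3.2, e4.1, e4.2]
  have hlog : |Real.log |A t| - Real.log (|A s|)| ≤ κ := by
    rcases le_total (Real.log s) (Real.log t) with h | h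
    · have := key _ _ (by linarith) h (by linarith [htη'.2])
      rwa [Real.exp_log hs0, Real.exp_log ht] at this
    · have := key (Real.log t) (Real.log s) (by linarith [htη'.1]) h (by linarith [htη'.1])
      rwa [Real.exp_log hs0, Real.exp_log ht, abs_sub_comm] at this
  have hAt : A t ≠ 0 := hs₀.elim (fun h => (h t hst).ne') fun h => (h t hst).ne
  have hAs : A s ≠ 0 := hs₀.elim (fun h => (h s hs'').ne') fun h => (h s hs'').ne
  -- Because `A` has a constant sign near infinity, control of its modulus suffices.
  have habs : |A t - A s| = |(|A t| - |A s|)| := by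
    rcases hs₀ with h | h
    · rw [abs_of_pos (h t hst), abs_of_pos (h s hs'')]
    · rw [abs_of_neg (h t hst), abs_of_neg (h s hs''), ← abs_neg]
      congr 1
      ring
  have pt := abs_pos.2 hAt
  have ps := abs_pos.2 hAs
  have hlog' := abs_le.1 hlog
  have u1 : |A t| ≤ (1 + ε) * |A s| := by
    rw [← Real.log_le_log_iff pt (by positivity), Real.log_mul (by positivity) ps.ne']
    linarith [hlog'.2]
  have u2 : |A s| ≤ (1 + ε) * |A t| := by
    rw [← Real.log_le_log_iff ps (by positivity), Real.log_mul (by positivity) pt.ne']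
    linarith [hlog'.1]
  rw [habs, abs_le]
  constructor
  · rcases le_total (|A s|) (|A t|) with h | h
    · nlinarith
    · nlinarith
  · linarith

end SecondOrder

/-! ### Integrability and the logarithmic singularity. -/

section Lp

lemma eLpNorm_ofReal {α : Type*} [MeasurableSpace α] {μ : Measure α} {p : ℝ} (hp : 0 < p)
    (f : α → ℝ) :
    eLpNorm f (ENNReal.ofReal p) μ = (∫⁻ z, ENNReal.ofReal (|f z| ^ p) ∂μ) ^ (1 / p) := by
  rw [eLpNorm_eq_lintegral_rpow_enorm_toReal (by simpa using hp) ENNReal.ofReal_ne_top,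
    ENNReal.toReal_ofReal hp.le]
  congr 1
  refine lintegral_congr fun z => ?_
  rw [← ENNReal.ofReal_rpow_of_nonneg (abs_nonneg _) hp.le, ← Real.norm_eq_abs, ofReal_norm]

lemma memLp_ofReal_of_lintegral {α : Type*} [MeasurableSpace α] {μ : Measure α} {p : ℝ}
    (hp : 0 < p) {f : α → ℝ} (hf : AEStronglyMeasurable f μ)
    (h : ∫⁻ z, ENNReal.ofReal (|f z| ^ p) ∂μ ≠ ∞) : MemLp f (ENNReal.ofReal p) μ := by
  refine ⟨hf, ?_⟩
  rw [eLpNorm_ofReal hp]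
  exact ENNReal.rpow_lt_top_of_nonneg (by positivity) h

lemma MemLp.lintegral_ofReal_ne_top {α : Type*} [MeasurableSpace α] {μ : Measure α} {p : ℝ}
    (hp : 0 < p) {f : α → ℝ} (h : MemLp f (ENNReal.ofReal p) μ) :
    ∫⁻ z, ENNReal.ofReal (|f z| ^ p) ∂μ ≠ ∞ := by
  intro hn
  have := h.2
  rw [eLpNorm_ofReal hp, hn, ENNReal.top_rpow_of_pos (by positivity)] at this
  exact lt_irrefl _ this

lemma tendsto_eLpNorm_of_dominated {α ι : Type*} [MeasurableSpace α] {μ : Measure α}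
    {l : Filter ι} [l.IsCountablyGenerated] {p : ℝ} (hp : 0 < p) {F : ι → α → ℝ} {G : α → ℝ}
    (hm : ∀ᶠ i in l, Measurable (F i)) (hG : MemLp G (ENNReal.ofReal p) μ)
    (hb : ∀ᶠ i in l, ∀ᵐ z ∂μ, |F i z| ≤ G z)
    (hlim : ∀ᵐ z ∂μ, Tendsto (fun i => F i z) l (𝓝 0)) :
    Tendsto (fun i => eLpNorm (F i) (ENNReal.ofReal p) μ) l (𝓝 0) := by
  simp only [eLpNorm_ofReal hp]
  have h : Tendsto (fun i => ∫⁻ z, ENNReal.ofReal (|F i z| ^ p) ∂μ) l (𝓝 (∫⁻ _, 0 ∂μ)) := by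
    refine tendsto_lintegral_filter_of_dominated_convergence
      (fun z => ENNReal.ofReal (|G z| ^ p)) ?_ ?_ (MemLp.lintegral_ofReal_ne_top hp hG) ?_
    · exact hm.mono fun i hi => by fun_prop
    · filter_upwards [hb] with i hi
      filter_upwards [hi] with z hz
      exact ENNReal.ofReal_le_ofReal (Real.rpow_le_rpow (abs_nonneg _)
        (hz.trans (le_abs_self _)) hp.le)
    · filter_upwards [hlim] with z hz
      have h1 := (hz.abs.rpow_const (p := p) (Or.inr hp.le))
      rw [abs_zero, Real.zero_rpow hp.ne'] at h1
      have := ENNReal.tendsto_ofReal h1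
      rwa [ENNReal.ofReal_zero] at this
  rw [lintegral_zero] at h
  have h2 := h.ennrpow_const (1 / p)
  rwa [ENNReal.zero_rpow_of_pos (by positivity)] at h2

lemma memLp_rpow_unitPareto {p δ : ℝ} (hp : 0 < p) (hδ : δ * p < 1) :
    MemLp (fun z : ℝ => z ^ δ) (ENNReal.ofReal p) (paretoMeasure 1 1) := by
  refine memLp_ofReal_of_lintegral hp (by fun_prop) ?_
  rw [lintegral_unitPareto]
  have h := (integrableOn_Ioi_rpow_of_lt (a := δ * p - 2) (by linarith)
    one_pos).lintegral_lt_top.ne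
  refine (setLIntegral_congr_fun measurableSet_Ioi fun z hz => ?_).trans_ne h
  have hz0 : (0 : ℝ) < z := one_pos.trans hz
  rw [← ENNReal.ofReal_mul (by positivity), abs_of_pos (by positivity), ← Real.rpow_mul hz0.le,
    Real.rpow_sub hz0, Real.rpow_two]
  congr 1
  ring

/-- The logarithm of a unit Pareto variable is standard exponential; the change of variables is
$z=e^{v/a}$. -/
lemma lintegral_comp_log_unitPareto {a : ℝ} (ha : 0 < a) (φ : ℝ → ℝ≥0∞) :
    ∫⁻ z, φ (a * Real.log z) ∂(paretoMeasure 1 1)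
      = ∫⁻ v in Set.Ioi 0, ENNReal.ofReal (Real.exp (-(v / a)) / a) * φ v := by
  have himg : (fun v => Real.exp (v / a)) '' Set.Ioi 0 = Set.Ioi 1 := by
    ext z
    simp only [Set.mem_image, Set.mem_Ioi]
    constructor
    · rintro ⟨v, hv, rfl⟩
      exact Real.one_lt_exp_iff.2 (by positivity)
    · intro hz
      exact ⟨a * Real.log z, mul_pos ha (Real.log_pos hz), by
        rw [mul_div_cancel_left₀ _ ha.ne', Real.exp_log (by linarith)]⟩
  have hd : ∀ v ∈ Set.Ioi (0 : ℝ), HasDerivWithinAt (fun v => Real.exp (v / a))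
      (Real.exp (v / a) * (1 / a)) (Set.Ioi 0) v := fun v _ =>
    ((hasDerivAt_id v).div_const a).exp.hasDerivWithinAt
  have hinj : Set.InjOn (fun v => Real.exp (v / a)) (Set.Ioi 0) := fun x _ y _ h =>
    (div_left_inj' ha.ne').1 (Real.exp_injective h)
  rw [lintegral_unitPareto, ← himg, lintegral_image_eq_lintegral_abs_deriv_mul measurableSet_Ioi
    hd hinj]
  refine setLIntegral_congr_fun measurableSet_Ioi fun v _ => ?_
  rw [← mul_assoc, ← ENNReal.ofReal_mul (by positivity), Real.log_exp, mul_div_cancel₀ v ha.ne',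
    abs_of_pos (by positivity)]
  congr 2
  rw [Real.exp_neg]
  field_simp

lemma add_rpow_le {x y p : ℝ} (hx : 0 ≤ x) (hy : 0 ≤ y) (hp : 1 ≤ p) :
    (x + y) ^ p ≤ 2 ^ (p - 1) * (x ^ p + y ^ p) := by
  lift x to ℝ≥0 using hx
  lift y to ℝ≥0 using hy
  exact_mod_cast NNReal.rpow_add_le_mul_rpow_add_rpow x y hp

lemma abs_log_le {s : ℝ} (hs : 0 < s) {r : ℝ} (hr : 0 < r) : |Real.log r| ≤ r + r ^ (-s) / s := by
  rw [abs_le]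
  have h1 := Real.log_le_sub_one_of_pos hr
  have h2 := Real.log_le_sub_one_of_pos (Real.rpow_pos_of_pos hr (-s))
  rw [Real.log_rpow hr] at h2
  have h3 : 0 < r ^ (-s) / s := by positivity
  constructor
  · have : -Real.log r ≤ r ^ (-s) / s := by
      rw [le_div_iff₀ hs]
      linarith
    linarith
  · linarith

/-- `log |1 - V|` has moments of all orders when `V` is a standard exponential variable. -/
lemma lintegral_abs_log_one_sub_ne_top {p : ℝ} (hp : 1 ≤ p) :
    ∫⁻ v in Set.Ioi 0, ENNReal.ofReal (Real.exp (-v)) *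
      ENNReal.ofReal (|Real.log (|1 - v|)| ^ p) ≠ ∞ := by
  have hp0 : 0 < p := by linarith
  -- With this exponent the $p$-th power of $|1-v|^{-s}$ is $|1-v|^{-1/2}$, integrable at 1.
  set s := 1 / (2 * p) with hs
  have hs0 : 0 < s := by positivity
  have hsp : s * p = 1 / 2 := by rw [hs]; field_simp
  have h1 : IntegrableOn (fun v : ℝ => 2 ^ (p - 1) * (2 + |1 - v| ^ (-(1 / 2) : ℝ) / s ^ p))
      (Set.Ioc 0 2) := by
    have e1 : IntervalIntegrable (fun v : ℝ => (1 - v) ^ (-(1 / 2) : ℝ)) volume 0 1 := by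
      have := (intervalIntegral.intervalIntegrable_rpow' (a := 1) (b := 0) (r := -(1 / 2))
        (by norm_num)).comp_sub_left 1
      simpa using this
    have e2 : IntervalIntegrable (fun v : ℝ => (v - 1) ^ (-(1 / 2) : ℝ)) volume 1 2 := by
      have := (intervalIntegral.intervalIntegrable_rpow' (a := 0) (b := 1) (r := -(1 / 2))
        (by norm_num)).comp_sub_right 1
      norm_num at this ⊢
      exact this
    have e1' : IntervalIntegrable (fun v : ℝ => |1 - v| ^ (-(1 / 2) : ℝ)) volume 0 1 := by
      refine e1.congr fun v hv => ?_
      rw [Set.uIoc_of_le zero_le_one] at hv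
      rw [abs_of_nonneg (by linarith [hv.2])]
    have e2' : IntervalIntegrable (fun v : ℝ => |1 - v| ^ (-(1 / 2) : ℝ)) volume 1 2 := by
      refine e2.congr fun v hv => ?_
      rw [Set.uIoc_of_le one_le_two] at hv
      rw [abs_sub_comm, abs_of_nonneg (by linarith [hv.1])]
    have e3 := (intervalIntegrable_iff_integrableOn_Ioc_of_le zero_le_two).1 (e1'.trans e2')
    exact (((integrable_const _).add (e3.div_const _)).const_mul _)
  have h2 : IntegrableOn (fun v : ℝ => v ^ p * Real.exp (-v)) (Set.Ioi 0) := by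
    have := Real.GammaIntegral_convergent (s := p + 1) (by linarith)
    simpa [mul_comm] using this
  have hsplit : Set.Ioi (0 : ℝ) = Set.Ioc 0 2 ∪ Set.Ioi 2 :=
    (Set.Ioc_union_Ioi_eq_Ioi zero_le_two).symm
  rw [hsplit]
  refine ((lintegral_union_le _ _ _).trans_lt (ENNReal.add_lt_top.2 ⟨?_, ?_⟩)).ne
  · refine lt_of_le_of_lt ?_ h1.lintegral_lt_top
    refine setLIntegral_mono_ae (by fun_prop) ?_
    filter_upwards [(measure_eq_zero_iff_ae_notMem.1 (measure_singleton (μ := volume) (1 : ℝ)))]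
      with v hv1 hv
    rw [← ENNReal.ofReal_mul (Real.exp_pos _).le]
    refine ENNReal.ofReal_le_ofReal ?_
    have hr : 0 < |1 - v| := abs_pos.2 fun h => hv1 (by simp; linarith)
    have hr2 : |1 - v| ≤ 1 := by rw [abs_le]; constructor <;> linarith [hv.1, hv.2]
    have e1 : Real.exp (-v) ≤ 1 := Real.exp_le_one_iff.2 (by linarith [hv.1])
    have e2 : |Real.log (|1 - v|)| ^ p ≤ (1 + |1 - v| ^ (-s) / s) ^ p :=
      Real.rpow_le_rpow (abs_nonneg _) ((abs_log_le hs0 hr).trans (by linarith)) hp0.le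
    have e3 : (1 + |1 - v| ^ (-s) / s) ^ p
        ≤ 2 ^ (p - 1) * (1 ^ p + (|1 - v| ^ (-s) / s) ^ p) :=
      add_rpow_le zero_le_one (by positivity) hp
    have e4 : (|1 - v| ^ (-s) / s) ^ p = |1 - v| ^ (-(1 / 2) : ℝ) / s ^ p := by
      rw [Real.div_rpow (by positivity) hs0.le, ← Real.rpow_mul hr.le, neg_mul, hsp]
    rw [e4, Real.one_rpow] at e3
    calc _ ≤ 1 * |Real.log (|1 - v|)| ^ p := mul_le_mul_of_nonneg_right e1 (by positivity)
      _ ≤ 2 ^ (p - 1) * (1 + |1 - v| ^ (-(1 / 2) : ℝ) / s ^ p) := by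
          rw [one_mul]; exact e2.trans e3
      _ ≤ _ := by
          refine mul_le_mul_of_nonneg_left ?_ (by positivity)
          linarith
  · refine lt_of_le_of_lt ?_ (h2.mono_set (Set.Ioi_subset_Ioi zero_le_two)).lintegral_lt_top
    refine setLIntegral_mono (by fun_prop) fun v hv => ?_
    have hv : 2 < v := hv
    rw [← ENNReal.ofReal_mul (Real.exp_pos _).le, mul_comm]
    refine ENNReal.ofReal_le_ofReal (mul_le_mul_of_nonneg_right ?_ (Real.exp_pos _).le)
    rw [abs_sub_comm, abs_of_pos (a := v - 1) (by linarith), abs_of_nonneg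
      (Real.log_nonneg (by linarith))]
    exact Real.rpow_le_rpow (Real.log_nonneg (by linarith))
      ((Real.log_le_sub_one_of_pos (by linarith)).trans (by linarith)) hp0.le

/-- The part of the integral near and beyond the logarithmic singularity is negligible. -/
lemma tendsto_eLpNorm_singular {p : ℝ} (hp : 1 ≤ p) :
    Tendsto (fun a : ℝ => eLpNorm ({z : ℝ | 1 / 2 < a * Real.log z}.indicator
      fun z => Real.log (|1 - a * Real.log z|) / a) (ENNReal.ofReal p) (paretoMeasure 1 1))
      (𝓝[>] 0) (𝓝 0) := by
  have hp0 : 0 < p := by linarith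
  set K := ∫⁻ v in Set.Ioi 0, ENNReal.ofReal (Real.exp (-v)) *
      ENNReal.ofReal (|Real.log (|1 - v|)| ^ p) with hK
  have hKt : K ≠ ∞ := lintegral_abs_log_one_sub_ne_top hp
  -- For $v>1/2$ and $a<1/2$, half of $v/a$ is at least $1/(4a)$ and the other half at least $v$.
  -- The power $a^{-(p+1)}$ collects $a^{-p}$ from the integrand and $a^{-1}$ from the exponential
  -- density; the exponential factor beats it.
  have hlim : Tendsto (fun a : ℝ => (ENNReal.ofReal (a⁻¹ ^ (p + 1) * Real.exp (-(1 / 4) * a⁻¹)) * K)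
      ^ (1 / p)) (𝓝[>] 0) (𝓝 0) := by
    have h1 := (tendsto_rpow_mul_exp_neg_mul_atTop_nhds_zero (p + 1) (1 / 4) (by norm_num)).comp
      tendsto_inv_nhdsGT_zero
    have h2 := (ENNReal.Tendsto.mul_const (ENNReal.tendsto_ofReal h1) (Or.inr hKt)).ennrpow_const
      (1 / p)
    rw [ENNReal.ofReal_zero, zero_mul, ENNReal.zero_rpow_of_pos (by positivity)] at h2
    exact h2
  refine tendsto_of_tendsto_of_tendsto_of_le_of_le' tendsto_const_nhds hlim
    (Eventually.of_forall fun _ => bot_le) ?_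
  filter_upwards [Ioo_mem_nhdsGT (show (0 : ℝ) < 1 / 2 by norm_num)] with a ha
  have ha0 : 0 < a := ha.1
  rw [eLpNorm_ofReal hp0]
  refine ENNReal.rpow_le_rpow ?_ (by positivity)
  have e1 : ∀ z : ℝ, ENNReal.ofReal (|{z : ℝ | 1 / 2 < a * Real.log z}.indicator
      (fun z => Real.log (|1 - a * Real.log z|) / a) z| ^ p)
      = (fun v => ENNReal.ofReal (|(Set.Ioi (1 / 2)).indicator
        (fun v => Real.log (|1 - v|) / a) v| ^ p)) (a * Real.log z) := fun z => rfl
  rw [lintegral_congr e1, lintegral_comp_log_unitPareto ha0 (fun v => ENNReal.ofReal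
    (|(Set.Ioi (1 / 2)).indicator (fun v => Real.log (|1 - v|) / a) v| ^ p)), hK,
    ← lintegral_const_mul' _ _ ENNReal.ofReal_ne_top]
  refine setLIntegral_mono (by fun_prop) fun v hv => ?_
  by_cases hv2 : 1 / 2 < v
  · rw [Set.indicator_of_mem (show v ∈ Set.Ioi (1 / 2) from hv2),
      ← ENNReal.ofReal_mul (by positivity), ← ENNReal.ofReal_mul (by positivity),
      ← ENNReal.ofReal_mul (by positivity)]
    refine ENNReal.ofReal_le_ofReal ?_
    rw [abs_div, abs_of_pos ha0, Real.div_rpow (abs_nonneg _) ha0.le]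
    have h1 : Real.exp (-(v / a)) ≤ Real.exp (-(1 / 4) * a⁻¹) * Real.exp (-v) := by
      rw [← Real.exp_add, Real.exp_le_exp, neg_mul, ← neg_add, neg_le_neg_iff, ← div_eq_mul_inv]
      rw [show v / a = v / (2 * a) + v / (2 * a) by field_simp; ring]
      refine add_le_add ?_ ?_
      · rw [div_le_div_iff₀ ha0 (by positivity)]
        nlinarith
      · rw [le_div_iff₀ (by positivity)]
        nlinarith [ha.2]
    have h2 : a⁻¹ ^ (p + 1) = 1 / a * (1 / a ^ p) := by
      rw [Real.rpow_add (by positivity), Real.rpow_one, Real.inv_rpow ha0.le]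
      ring
    rw [h2]
    calc _ = Real.exp (-(v / a)) * (1 / a * (1 / a ^ p) * |Real.log (|1 - v|)| ^ p) := by ring
      _ ≤ Real.exp (-(1 / 4) * a⁻¹) * Real.exp (-v)
          * (1 / a * (1 / a ^ p) * |Real.log (|1 - v|)| ^ p) :=
        mul_le_mul_of_nonneg_right h1 (by positivity)
      _ = _ := by ring
  · rw [Set.indicator_of_notMem (show v ∉ Set.Ioi (1 / 2) from hv2)]
    simp [Real.zero_rpow hp0.ne']

end Lp

/-! ### Both logarithmic expansions in $L^p$, and the negligible bound. -/

section Convergence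
variable {U A : ℝ → ℝ} {γ ρ p : ℝ}

/-- The dominating functions used below: the $p$-th power of $z^{1/(2p)}$ is $z^{1/2}$, integrable
against $dz/z^2$. -/
lemma memLp_const_mul_rpow (hp : 1 ≤ p) (c : ℝ) :
    MemLp (fun z : ℝ => c * z ^ (1 / (2 * p))) (ENNReal.ofReal p) (paretoMeasure 1 1) :=
  (memLp_rpow_unitPareto (by linarith) (by
    have : p ≠ 0 := by linarith
    field_simp
    norm_num)).const_mul c

lemma boxCox_le_mul_rpow (hρ : ρ ≤ 0) (hp : 1 ≤ p) {z : ℝ} (hz : 1 ≤ z) :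
    |boxCox ρ z| ≤ 2 * p * z ^ (1 / (2 * p)) := by
  have hp0 : 0 < p := by linarith
  rw [abs_of_nonneg (boxCox_nonneg ρ hz)]
  refine (boxCox_le_log hρ (by linarith)).trans ?_
  have := Real.log_le_rpow_div (by linarith : 0 ≤ z) (show 0 < 1 / (2 * p) by positivity)
  rw [div_div_eq_mul_div, div_one, mul_comm] at this
  exact this

lemma ae_one_le_unitPareto : ∀ᵐ z ∂(paretoMeasure 1 1), 1 ≤ z :=
  (ae_one_lt_paretoMeasure one_pos).mono fun _ h => h.le

lemma memLp_boxCox (hρ : ρ ≤ 0) (hp : 1 ≤ p) :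
    MemLp (boxCox ρ) (ENNReal.ofReal p) (paretoMeasure 1 1) := by
  refine (memLp_const_mul_rpow hp (2 * p)).mono' (measurable_boxCox ρ).aestronglyMeasurable ?_
  filter_upwards [ae_one_le_unitPareto] with z hz using boxCox_le_mul_rpow hρ hp hz

lemma SecondOrder.tendsto_eLpNorm_logDefect (hA : SecondOrder U A γ ρ) (hγ : 0 < γ) (hρ : ρ ≤ 0)
    (hU : MonotoneOn U (Set.Ioi 1)) (hUm : Measurable U) (hp : 1 ≤ p) :
    Tendsto (fun t => eLpNorm (fun z => (logDefect U γ (t * z) - logDefect U γ t) / A t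
      - boxCox ρ z) (ENNReal.ofReal p) (paretoMeasure 1 1)) atTop (𝓝 0) := by
  have hm := measurable_logDefect hUm γ
  have hb := measurable_boxCox ρ
  obtain ⟨D, hD, hev⟩ := hA.potter hγ hρ hU hUm (δ := 1 / (2 * p)) (by positivity)
  refine tendsto_eLpNorm_of_dominated (by linarith) (Eventually.of_forall fun t => by fun_prop)
    (memLp_const_mul_rpow hp (D + 2 * p)) ?_ ?_
  · filter_upwards [hev, hA.eventually_ne_zero] with t ht ht0
    filter_upwards [ae_one_le_unitPareto] with z hz
    refine (abs_sub _ _).trans ?_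
    rw [add_mul]
    refine add_le_add ?_ (boxCox_le_mul_rpow hρ hp hz)
    rw [abs_div, div_le_iff₀ (abs_pos.2 ht0)]
    exact ht z hz
  · filter_upwards [ae_one_le_unitPareto] with z hz
    have := (hA.tendsto_logDefect hγ hU (show 0 < z by linarith)).sub_const (boxCox ρ z)
    rwa [sub_self] at this

lemma abs_log_one_add_le {w : ℝ} (hw : -(1 / 2) ≤ w) : |Real.log (|1 + w|)| ≤ 2 * |w| := by
  have h1 : 0 < 1 + w := by linarith
  rw [abs_of_pos h1, abs_le]
  have hu := Real.log_le_sub_one_of_pos h1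
  have hl := Real.one_sub_inv_le_log_of_pos h1
  constructor
  · refine le_trans ?_ hl
    rw [show 1 - (1 + w)⁻¹ = w / (1 + w) by field_simp; ring, le_div_iff₀ h1]
    rcases le_total 0 w with h | h
    · rw [abs_of_nonneg h]; nlinarith
    · rw [abs_of_nonpos h]; nlinarith
  · linarith [le_abs_self w, abs_nonneg w]

lemma tendsto_log_abs_one_add_mul_div {a : ℝ → ℝ} (ha : Tendsto a atTop (𝓝 0))
    (ha0 : ∀ᶠ t in atTop, a t ≠ 0) (c : ℝ) :
    Tendsto (fun t => Real.log (|1 + a t * c|) / a t - c) atTop (𝓝 0) := by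
  have h := (tendsto_log_one_add_mul_div ha ha0 (tendsto_const_nhds (x := c))).sub_const c
  rw [sub_self] at h
  simpa only [Real.log_abs] using h

/-- Where $1+w\ge1/2$ one has $|\log(1+w)|\le2|w|$, so the function is dominated by $3|h|$ with
$h(z)=(z^\rho-1)/\rho$. The set may depend on `t`, which permits cutting off a moving singularity.
-/
lemma SecondOrder.tendsto_eLpNorm_correction_of_regular (hA : SecondOrder U A γ ρ) (hρ : ρ ≤ 0)
    (hp : 1 ≤ p) {S : ℝ → Set ℝ} (hSm : ∀ t, MeasurableSet (S t))
    (hS : ∀ᶠ t in atTop, ∀ z ∈ S t, 1 < z → -(1 / 2) ≤ A t * boxCox ρ z) :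
    Tendsto (fun t => eLpNorm ((S t).indicator fun z =>
      Real.log (|1 + A t * boxCox ρ z|) / A t - boxCox ρ z) (ENNReal.ofReal p)
      (paretoMeasure 1 1)) atTop (𝓝 0) := by
  have hb := measurable_boxCox ρ
  refine tendsto_eLpNorm_of_dominated (by linarith) (Eventually.of_forall fun t => ?_)
    (memLp_const_mul_rpow hp (3 * (2 * p))) ?_ ?_
  · exact Measurable.indicator (by fun_prop) (hSm t)
  · filter_upwards [hS, hA.eventually_ne_zero] with t ht ht0
    filter_upwards [ae_one_lt_paretoMeasure one_pos] with z hz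
    have hbz := boxCox_le_mul_rpow hρ hp hz.le
    by_cases hzS : z ∈ S t
    · rw [Set.indicator_of_mem hzS]
      refine (abs_sub _ _).trans ?_
      have h1 : |Real.log (|1 + A t * boxCox ρ z|) / A t| ≤ 2 * |boxCox ρ z| := by
        rw [abs_div, div_le_iff₀ (abs_pos.2 ht0)]
        refine (abs_log_one_add_le (ht z hzS hz)).trans (le_of_eq ?_)
        rw [abs_mul]
        ring
      linarith
    · rw [Set.indicator_of_notMem hzS, abs_zero]
      exact mul_nonneg (by linarith) (Real.rpow_nonneg (by linarith) _)
  · filter_upwards with z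
    have h := (tendsto_log_abs_one_add_mul_div hA.tendsto_zero hA.eventually_ne_zero
      (boxCox ρ z)).norm
    rw [norm_zero] at h
    exact squeeze_zero_norm (fun t => norm_indicator_le_norm_self _ _) h

/-- If $A>0$ the product $A(t)h(z)$ is positive, with $h(z)=(z^\rho-1)/\rho$; if $\rho<0$ then
$h\le1/|\rho|$ and the product is uniformly small. In the remaining case, $\rho=0$ and $A<0$, the
region $|A(t)|\log z>1/2$ is cut off: there the logarithm is handled by `tendsto_eLpNorm_singular`,
and $\log z$ by dominated convergence. -/
lemma SecondOrder.tendsto_eLpNorm_correction (hA : SecondOrder U A γ ρ) (hρ : ρ ≤ 0)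
    (hp : 1 ≤ p) :
    Tendsto (fun t => eLpNorm (fun z => Real.log (|1 + A t * boxCox ρ z|) / A t - boxCox ρ z)
      (ENNReal.ofReal p) (paretoMeasure 1 1)) atTop (𝓝 0) := by
  have hreg : (∀ᶠ t in atTop, ∀ z : ℝ, 1 < z → -(1 / 2) ≤ A t * boxCox ρ z) →
      Tendsto (fun t => eLpNorm (fun z => Real.log (|1 + A t * boxCox ρ z|) / A t - boxCox ρ z)
        (ENNReal.ofReal p) (paretoMeasure 1 1)) atTop (𝓝 0) := fun h => by
    simpa using hA.tendsto_eLpNorm_correction_of_regular hρ hp (S := fun _ => Set.univ)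
      (fun _ => MeasurableSet.univ) (h.mono fun t ht z _ => ht z)
  rcases hA.sign with hpos | hneg
  · refine hreg ?_
    filter_upwards [hpos] with t ht z hz
    linarith [mul_pos ht (boxCox_one_lt_pos ρ hz)]
  rcases hρ.lt_or_eq with hρ' | rfl
  · refine hreg ?_
    have h1 := hA.tendsto_zero.abs
    rw [abs_zero] at h1
    filter_upwards [h1.eventually (gt_mem_nhds (show 0 < -ρ / 2 by linarith))] with t ht z hz
    have hb : boxCox ρ z ≤ 1 / (-ρ) := by
      rw [boxCox, if_neg hρ'.ne, ← neg_div_neg_eq]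
      exact div_le_div_of_nonneg_right (by linarith [Real.rpow_pos_of_pos (one_pos.trans hz) ρ])
        (by linarith)
    have hb0 := boxCox_nonneg ρ hz.le
    have h2 : |A t * boxCox ρ z| ≤ 1 / 2 := by
      rw [abs_mul, abs_of_nonneg hb0]
      calc |A t| * boxCox ρ z ≤ (-ρ / 2) * (1 / (-ρ)) :=
            mul_le_mul ht.le hb hb0 (by linarith)
        _ = 1 / 2 := by
            have : ρ ≠ 0 := hρ'.ne
            field_simp
    exact (abs_le.1 h2).1
  · have hlogm := Real.measurable_log
    have hbox : ∀ z, boxCox 0 z = Real.log z := fun z => by simp [boxCox]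
    set S : ℝ → Set ℝ := fun t => {z | 1 / 2 < -A t * Real.log z} with hS
    have hSm : ∀ t, MeasurableSet (S t) := fun t =>
      measurableSet_lt measurable_const (by fun_prop)
    have h1 := hA.tendsto_eLpNorm_correction_of_regular le_rfl hp (S := fun t => (S t)ᶜ)
      (fun t => (hSm t).compl) (Eventually.of_forall fun t z hz _ => by
        rw [hbox]
        have : ¬ 1 / 2 < -A t * Real.log z := hz
        linarith [not_lt.1 this])
    have hA0 : Tendsto (fun t => -A t) atTop (𝓝[>] 0) := by
      refine tendsto_nhdsWithin_iff.2 ⟨?_, hneg.mono fun t ht => neg_pos.2 ht⟩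
      simpa using hA.tendsto_zero.neg
    have h2 := (tendsto_eLpNorm_singular hp).comp hA0
    have h3 : Tendsto (fun t => eLpNorm ((S t).indicator (boxCox 0)) (ENNReal.ofReal p)
        (paretoMeasure 1 1)) atTop (𝓝 0) := by
      refine tendsto_eLpNorm_of_dominated (by linarith) (Eventually.of_forall fun t =>
        (measurable_boxCox 0).indicator (hSm t)) (memLp_const_mul_rpow hp (2 * p))
        (Eventually.of_forall fun t => ?_) ?_
      · filter_upwards [ae_one_le_unitPareto] with z hz
        exact (norm_indicator_le_norm_self (boxCox 0) z).trans (boxCox_le_mul_rpow le_rfl hp hz)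
      · filter_upwards with z
        have h : Tendsto (fun t => -A t * Real.log z) atTop (𝓝 0) := by
          simpa using hA.tendsto_zero.neg.mul_const (Real.log z)
        refine tendsto_const_nhds.congr' ?_
        filter_upwards [h.eventually (gt_mem_nhds (show (0 : ℝ) < 1 / 2 by norm_num))] with t ht
        rw [Set.indicator_of_notMem]
        exact ht.not_gt
    have h4 := (h1.add h2).add h3
    rw [add_zero, add_zero] at h4
    refine tendsto_of_tendsto_of_tendsto_of_le_of_le tendsto_const_nhds h4
      (fun _ => bot_le) fun t => ?_
    have hb := measurable_boxCox 0
    have hp1 : 1 ≤ ENNReal.ofReal p := by simpa using ENNReal.ofReal_le_ofReal hp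
    set f1 := (S t)ᶜ.indicator fun z => Real.log (|1 + A t * boxCox 0 z|) / A t - boxCox 0 z
    set f2 := (S t).indicator fun z => Real.log (|1 - -A t * Real.log z|) / -A t
    set f3 := (S t).indicator (boxCox 0)
    have m1 : Measurable f1 := Measurable.indicator (by fun_prop) (hSm t).compl
    have m2 : Measurable f2 := Measurable.indicator (by fun_prop) (hSm t)
    have m3 : Measurable f3 := hb.indicator (hSm t)
    -- On the cut-off region `f1` vanishes; `f2` enters with a minus sign because it is divided by
    -- $-A(t)$.
    have e : (fun z => Real.log (|1 + A t * boxCox 0 z|) / A t - boxCox 0 z)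
        = f1 - f2 - f3 := by
      funext z
      simp only [Pi.sub_apply, f1, f2, f3, Set.indicator_apply, Set.mem_compl_iff, hbox]
      by_cases hz : z ∈ S t
      · simp only [hz, not_true_eq_false, if_true, if_false]
        rw [neg_mul, sub_neg_eq_add, div_neg]
        ring
      · simp [hz]
    rw [e]
    exact (eLpNorm_sub_le (m1.sub m2).aestronglyMeasurable m3.aestronglyMeasurable hp1).trans
      (add_le_add_left (eLpNorm_sub_le m1.aestronglyMeasurable m2.aestronglyMeasurable hp1) _)

/-- The bound on the Wasserstein distance is negligible with respect to `A`. -/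
lemma SecondOrder.bound_le (hA : SecondOrder U A γ ρ) (hγ : 0 < γ) (hρ : ρ ≤ 0)
    (hU : MonotoneOn U (Set.Ioi 1)) (hUm : Measurable U) (hp : 1 ≤ p) {ε : ℝ} (hε : 0 < ε) :
    ∀ᶠ t in atTop, bound U A γ ρ p t ≤ ENNReal.ofReal (ε * |A t|) := by
  have hp1 : 1 ≤ ENNReal.ofReal p := by simpa using ENNReal.ofReal_le_ofReal hp
  have h := (hA.tendsto_eLpNorm_logDefect hγ hρ hU hUm hp).add
    (hA.tendsto_eLpNorm_correction hρ hp)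
  rw [add_zero] at h
  obtain ⟨t₀, ht₀⟩ := eventually_atTop.1 (hA.eventually_pos hγ hU)
  filter_upwards [h.eventually (gt_mem_nhds (ENNReal.ofReal_pos.2 hε)), hA.eventually_ne_zero,
    eventually_ge_atTop t₀, eventually_gt_atTop 0] with t ht hAt htt ht0
  have hm := measurable_logDefect hUm γ
  have hb := measurable_boxCox ρ
  rw [bound_eq, ← eLpNorm_ofReal (by linarith)]
  set f1 := fun z => (logDefect U γ (t * z) - logDefect U γ t) / A t - boxCox ρ z
  set f2 := fun z => Real.log (|1 + A t * boxCox ρ z|) / A t - boxCox ρ z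
  have m1 : Measurable f1 := by fun_prop
  have m2 : Measurable f2 := by fun_prop
  have e : (fun z => Real.log (U (z * t) / (z ^ γ * U t)) - Real.log (|1 + A t * boxCox ρ z|))
      =ᵐ[paretoMeasure 1 1] A t • (f1 - f2) := by
    filter_upwards [ae_one_le_unitPareto] with z hz
    have hz0 : 0 < z := by linarith
    have p1 : 0 < U t := ht₀ t htt
    have p2 : 0 < U (t * z) := ht₀ _ (htt.trans (by nlinarith))
    simp only [Pi.smul_apply, Pi.sub_apply, f1, f2, smul_eq_mul, logDefect]
    rw [mul_comm z t, Real.log_div p2.ne' (by positivity), Real.log_mul (by positivity) p1.ne',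
      Real.log_rpow hz0, Real.log_mul ht0.ne' hz0.ne']
    field_simp
    ring
  rw [eLpNorm_congr_ae e, eLpNorm_const_smul, mul_comm ε, ENNReal.ofReal_mul (abs_nonneg _),
    ← Real.norm_eq_abs, ofReal_norm]
  exact mul_le_mul_right ((eLpNorm_sub_le m1.aestronglyMeasurable m2.aestronglyMeasurable
    hp1).trans ht.le) _

end Convergence

/-! ### Sums of exponential variables. -/

section Erlang

/-- The density of a sum of `k + 1` independent standard exponential variables. -/
noncomputable def erlangPDF (k : ℕ) (v : ℝ) : ℝ≥0∞ :=
  (Set.Ioi (0 : ℝ)).indicator (fun v => ENNReal.ofReal (v ^ k * Real.exp (-v) / k.factorial)) v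

lemma measurable_erlangPDF (k : ℕ) : Measurable (erlangPDF k) :=
  Measurable.indicator (by fun_prop) measurableSet_Ioi

lemma lintegral_erlangPDF_convolution (k : ℕ) (w : ℝ) :
    ∫⁻ v, erlangPDF 0 (w - v) * erlangPDF k v = erlangPDF (k + 1) w := by
  have h1 : ∀ v, erlangPDF 0 (w - v) * erlangPDF k v = (Set.Ioo 0 w).indicator
      (fun v => ENNReal.ofReal (v ^ k * (Real.exp (-w) / k.factorial))) v := by
    intro v
    simp only [erlangPDF, Set.indicator, Set.mem_Ioi, Set.mem_Ioo, sub_pos]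
    by_cases hv : 0 < v <;> by_cases hw : v < w <;> simp only [hv, hw, and_self, and_true,
      and_false, if_true, if_false, mul_zero, zero_mul]
    rw [← ENNReal.ofReal_mul (by positivity)]
    congr 1
    have : Real.exp (-w) = Real.exp (-(w - v)) * Real.exp (-v) := by
      rw [← Real.exp_add]; congr 1; ring
    rw [this, pow_zero, Nat.factorial_zero, Nat.cast_one]
    ring
  simp only [h1]
  rw [lintegral_indicator measurableSet_Ioo]
  rcases le_or_gt w 0 with hw | hw
  · simp [erlangPDF, hw]
  rw [← ofReal_integral_eq_lintegral_ofReal, ← integral_Ioc_eq_integral_Ioo,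
    ← intervalIntegral.integral_of_le hw.le, intervalIntegral.integral_mul_const, integral_pow,
    erlangPDF, Set.indicator_of_mem (Set.mem_Ioi.2 hw)]
  · congr 1
    rw [Nat.factorial_succ]
    push_cast
    have : (k.factorial : ℝ) ≠ 0 := by positivity
    field_simp
    simp
  · refine IntegrableOn.mono_set ?_ Set.Ioo_subset_Icc_self
    exact Continuous.integrableOn_Icc (by fun_prop)
  · filter_upwards [ae_restrict_mem measurableSet_Ioo] with v hv
    have := hv.1
    simp only [Pi.zero_apply]
    positivity

/-- Induction on the number of summands: splitting off one coordinate convolves the density with the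
exponential one. Note the shift, `erlangPDF k` belonging to $k+1$ summands. -/
lemma lintegral_sum_log (k : ℕ) {φ : ℝ → ℝ≥0∞} (hφ : Measurable φ) :
    ∫⁻ y, φ (∑ i, Real.log (y i)) ∂(Measure.pi fun _ : Fin (k + 1) => paretoMeasure 1 1)
      = ∫⁻ v, erlangPDF k v * φ v := by
  have h0 : ∀ ψ : ℝ → ℝ≥0∞, ∫⁻ z, ψ (Real.log z) ∂(paretoMeasure 1 1)
      = ∫⁻ v, erlangPDF 0 v * ψ v := by
    intro ψ
    have := lintegral_comp_log_unitPareto one_pos ψ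
    simp only [one_mul, div_one] at this
    rw [this, ← lintegral_indicator measurableSet_Ioi]
    refine lintegral_congr fun v => ?_
    by_cases hv : v ∈ Set.Ioi (0 : ℝ) <;> simp [erlangPDF, hv]
  induction k generalizing φ with
  | zero =>
    have h := (measurePreserving_eval (fun _ : Fin 1 => paretoMeasure 1 1) 0).lintegral_comp
      (f := fun z => φ (Real.log z)) (by fun_prop)
    rw [← h0, ← h]
    refine lintegral_congr fun y => ?_
    exact congrArg φ (Fin.sum_univ_one fun i : Fin 1 => Real.log (y i))
  | succ k ih =>
    have hmp := measurePreserving_piFinSuccAbove (fun _ : Fin (k + 2) => paretoMeasure 1 1) 0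
    have hg : Measurable fun q : ℝ × (Fin (k + 1) → ℝ) =>
        φ (Real.log q.1 + ∑ i, Real.log (q.2 i)) := by fun_prop
    have h := hmp.lintegral_comp hg
    have he : ∫⁻ y, φ (∑ i, Real.log (y i))
        ∂(Measure.pi fun _ : Fin (k + 2) => paretoMeasure 1 1)
        = ∫⁻ z, ∫⁻ y, φ (Real.log z + ∑ i, Real.log (y i))
          ∂(Measure.pi fun _ : Fin (k + 1) => paretoMeasure 1 1) ∂(paretoMeasure 1 1) := by
      rw [← lintegral_prod _ hg.aemeasurable, ← h]
      refine lintegral_congr fun y => ?_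
      rw [Fin.sum_univ_succ]
      rfl
    rw [he]
    have hm := measurable_erlangPDF k
    have hm0 := measurable_erlangPDF 0
    have h2 : ∀ z : ℝ, ∫⁻ y, φ (Real.log z + ∑ i, Real.log (y i))
          ∂(Measure.pi fun _ : Fin (k + 1) => paretoMeasure 1 1)
        = ∫⁻ v, erlangPDF k v * φ (Real.log z + v) := fun z =>
      ih (φ := fun v => φ (Real.log z + v)) (by fun_prop)
    simp only [h2]
    rw [h0 fun u => ∫⁻ v, erlangPDF k v * φ (u + v)]
    calc ∫⁻ u, erlangPDF 0 u * ∫⁻ v, erlangPDF k v * φ (u + v)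
        = ∫⁻ u, ∫⁻ v, erlangPDF 0 u * (erlangPDF k v * φ (u + v)) :=
          lintegral_congr fun u => (lintegral_const_mul _ (by fun_prop)).symm
      _ = ∫⁻ v, ∫⁻ u, erlangPDF 0 u * (erlangPDF k v * φ (u + v)) :=
          lintegral_lintegral_swap (by fun_prop)
      _ = ∫⁻ v, ∫⁻ w, erlangPDF 0 (w - v) * (erlangPDF k v * φ w) := by
          refine lintegral_congr fun v => ?_
          rw [← lintegral_sub_right_eq_self _ v]
          simp
      _ = ∫⁻ w, ∫⁻ v, erlangPDF 0 (w - v) * (erlangPDF k v * φ w) :=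
          lintegral_lintegral_swap (by fun_prop)
      _ = ∫⁻ w, erlangPDF (k + 1) w * φ w := by
          refine lintegral_congr fun w => ?_
          rw [← lintegral_erlangPDF_convolution, ← lintegral_mul_const _ (by fun_prop)]
          simp only [mul_assoc]

/-- The law of a sum of `k + 1` independent standard exponential variables. -/
noncomputable def erlang (k : ℕ) : Measure ℝ := volume.withDensity (erlangPDF k)

lemma map_sum_log (k : ℕ) :
    (Measure.pi fun _ : Fin (k + 1) => paretoMeasure 1 1).map (fun y => ∑ i, Real.log (y i))
      = erlang k := by
  ext s hs
  rw [Measure.map_apply (by fun_prop) hs, erlang, withDensity_apply _ hs,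
    ← lintegral_indicator_one (by
      exact (show Measurable fun y : Fin (k + 1) → ℝ => ∑ i, Real.log (y i) by fun_prop) hs),
    ← lintegral_indicator hs]
  have := lintegral_sum_log k (φ := s.indicator 1) (measurable_one.indicator hs)
  refine Eq.trans ?_ (this.trans ?_)
  · rfl
  · refine lintegral_congr fun v => ?_
    by_cases hv : v ∈ s <;> simp [hv]

instance isProbabilityMeasure_erlang (k : ℕ) : IsProbabilityMeasure (erlang k) := by
  rw [← map_sum_log]
  exact Measure.isProbabilityMeasure_map
    (show Measurable fun y : Fin (k + 1) → ℝ => ∑ i, Real.log (y i) by fun_prop).aemeasurable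

instance nullSingletonClass_erlang (k : ℕ) : NullSingletonClass (erlang k) := by
  unfold erlang
  infer_instance

lemma ae_pos_erlang (k : ℕ) : ∀ᵐ v ∂(erlang k), 0 < v := by
  rw [ae_iff, erlang, withDensity_apply _ (by measurability)]
  refine (setLIntegral_congr_fun (g := fun _ => 0) (by measurability) fun v hv => ?_).trans
    lintegral_zero
  exact Set.indicator_of_notMem (by simpa using hv) _

lemma erlang_Iic (k : ℕ) (v : ℝ) :
    erlang k (Set.Iic v)
      = ∫⁻ x in Set.Ioc 0 v, ENNReal.ofReal (x ^ k * Real.exp (-x) / k.factorial) := by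
  have h : ∀ x, erlangPDF k x = (Set.Ioi (0 : ℝ)).indicator
      (fun v => ENNReal.ofReal (v ^ k * Real.exp (-v) / k.factorial)) x := fun _ => rfl
  rw [erlang, withDensity_apply _ measurableSet_Iic]
  simp only [h]
  rw [setLIntegral_indicator measurableSet_Ioi]
  rfl

lemma erlang_univ (k : ℕ) :
    ∫⁻ x in Set.Ioi 0, ENNReal.ofReal (x ^ k * Real.exp (-x) / k.factorial) = 1 := by
  rw [← measure_univ (μ := erlang k), erlang, withDensity_apply _ .univ, setLIntegral_univ,
    ← lintegral_indicator measurableSet_Ioi]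
  rfl

lemma strictMonoOn_cdf_erlang (k : ℕ) : StrictMonoOn (cdf (erlang k)) (Set.Ici 0) := by
  intro a ha b hb hab
  have ha' : (0 : ℝ) ≤ a := ha
  have h1 : erlang k (Set.Ioc a b) ≠ 0 := by
    rw [erlang, withDensity_apply _ measurableSet_Ioc]
    intro h
    rw [setLIntegral_eq_zero_iff measurableSet_Ioc (measurable_erlangPDF k)] at h
    have h2 : volume (Set.Ioc a b) = 0 := by
      refine measure_mono_null (fun v hv => ?_) (ae_iff.1 h)
      have hv0 : 0 < v := ha'.trans_lt hv.1
      simp only [Set.mem_ofPred_eq, Classical.not_imp]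
      refine ⟨hv, ?_⟩
      rw [erlangPDF, Set.indicator_of_mem (Set.mem_Ioi.2 hv0), ENNReal.ofReal_eq_zero, not_le]
      positivity
    simp [hab.not_ge] at h2
  have h3 : cdf (erlang k) b - cdf (erlang k) a ≠ 0 →
      cdf (erlang k) a < cdf (erlang k) b := fun h =>
    lt_of_le_of_ne (monotone_cdf _ hab.le) fun he => h (by rw [he, sub_self])
  refine h3 fun h => h1 ?_
  rw [← measure_cdf (erlang k), StieltjesFunction.measure_Ioc, h, ENNReal.ofReal_zero]

end Erlang

/-! ### Monotone likelihood ratio implies stochastic order. -/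

section MonotoneLikelihoodRatio

/-- Integrating the cross inequality over $x\le z<y$ gives $a'b\le ab'$ for the masses on both sides
of $z$. Adding $ab$ and using total mass 1 yields $b\le a$. -/
lemma setLIntegral_Iic_le_of_monotone_likelihood_ratio {f g : ℝ → ℝ≥0∞} (hf : Measurable f)
    (hg : Measurable g) (hf1 : ∫⁻ x, f x = 1) (hg1 : ∫⁻ x, g x = 1)
    (h : ∀ x y, x ≤ y → f y * g x ≤ f x * g y) (z : ℝ) :
    ∫⁻ x in Set.Iic z, g x ≤ ∫⁻ x in Set.Iic z, f x := by
  set a := ∫⁻ x in Set.Iic z, f x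
  set a' := ∫⁻ x in Set.Ioi z, f x
  set b := ∫⁻ x in Set.Iic z, g x
  set b' := ∫⁻ x in Set.Ioi z, g x
  have ha : a + a' = 1 := by
    rw [← hf1, ← lintegral_add_compl f (measurableSet_Iic (a := z)), Set.compl_Iic]
  have hb : b + b' = 1 := by
    rw [← hg1, ← lintegral_add_compl g (measurableSet_Iic (a := z)), Set.compl_Iic]
  have hab : a' * b ≤ a * b' := by
    calc a' * b = ∫⁻ y in Set.Ioi z, ∫⁻ x in Set.Iic z, f y * g x := by
          rw [← lintegral_mul_const _ hf]
          exact lintegral_congr fun y => (lintegral_const_mul _ hg).symm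
      _ ≤ ∫⁻ y in Set.Ioi z, ∫⁻ x in Set.Iic z, f x * g y :=
          setLIntegral_mono_ae' measurableSet_Ioi (.of_forall fun y hy =>
            setLIntegral_mono_ae' measurableSet_Iic (.of_forall fun x hx =>
              h x y (le_trans hx (le_of_lt hy))))
      _ = a * b' := by
          rw [← lintegral_const_mul _ hg]
          exact lintegral_congr fun y => lintegral_mul_const _ hf
  calc b = a * b + a' * b := by rw [← add_mul, ha, one_mul]
    _ ≤ a * b + a * b' := by gcongr
    _ = a := by rw [← mul_add, hb, mul_one]

end MonotoneLikelihoodRatio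

/-! ### Stochastic comparison of Gamma and normal variables. -/

section GaussianComparison

lemma gaussianPDF_zero_one (x : ℝ) :
    gaussianPDF 0 1 x = ENNReal.ofReal ((Real.sqrt (2 * Real.pi))⁻¹ * Real.exp (-(x ^ 2 / 2))) := by
  rw [gaussianPDF, gaussianPDFReal]
  simp [neg_div]

lemma gaussianReal_Iic_le {f : ℝ → ℝ≥0∞} (hf : Measurable f) (hf1 : ∫⁻ x, f x = 1)
    (h : ∀ x y, x ≤ y → f y * gaussianPDF 0 1 x ≤ f x * gaussianPDF 0 1 y) (z : ℝ) :
    gaussianReal 0 1 (Set.Iic z) ≤ ∫⁻ x in Set.Iic z, f x := by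
  rw [gaussianReal_apply 0 one_ne_zero]
  exact setLIntegral_Iic_le_of_monotone_likelihood_ratio hf (measurable_gaussianPDF 0 1) hf1
    (lintegral_gaussianPDF_eq_one 0 one_ne_zero) h z

lemma le_gaussianReal_Iic {f : ℝ → ℝ≥0∞} (hf : Measurable f) (hf1 : ∫⁻ x, f x = 1)
    (h : ∀ x y, x ≤ y → gaussianPDF 0 1 y * f x ≤ gaussianPDF 0 1 x * f y) (z : ℝ) :
    ∫⁻ x in Set.Iic z, f x ≤ gaussianReal 0 1 (Set.Iic z) := by
  rw [gaussianReal_apply 0 one_ne_zero]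
  exact setLIntegral_Iic_le_of_monotone_likelihood_ratio (measurable_gaussianPDF 0 1) hf
    (lintegral_gaussianPDF_eq_one 0 one_ne_zero) hf1 h z

lemma ofReal_mul_exp_mul_le {C C' a b a' b' : ℝ} (hC : 0 ≤ C) (hC' : 0 ≤ C')
    (h : a + b ≤ a' + b') :
    ENNReal.ofReal (C * Real.exp a) * ENNReal.ofReal (C' * Real.exp b)
      ≤ ENNReal.ofReal (C * Real.exp a') * ENNReal.ofReal (C' * Real.exp b') := by
  rw [← ENNReal.ofReal_mul (by positivity), ← ENNReal.ofReal_mul (by positivity)]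
  refine ENNReal.ofReal_le_ofReal ?_
  have : ∀ a b : ℝ, C * Real.exp a * (C' * Real.exp b) = C * C' * Real.exp (a + b) := fun a b => by
    rw [Real.exp_add]; ring
  rw [this, this]
  gcongr

/-- Up to a constant, the logarithm of the density of $r\log(V/r^2)$ over the normal density, for
$V$ Gamma of shape $r^2$. Its derivative $r(1+w/r-e^{w/r})$ is nonpositive by convexity of the
exponential. -/
lemma antitone_log_ratio_exp {r : ℝ} (hr : 0 < r) :
    Antitone fun w : ℝ => r * w - r ^ 2 * Real.exp (w / r) + w ^ 2 / 2 := by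
  have hd : ∀ w : ℝ, HasDerivAt (fun w : ℝ => r * w - r ^ 2 * Real.exp (w / r) + w ^ 2 / 2)
      (r * (1 + w / r - Real.exp (w / r))) w := fun w => by
    have h1 := ((hasDerivAt_id w).const_mul r).sub
      (((hasDerivAt_id w).div_const r).exp.const_mul (r ^ 2))
    have h2 := ((hasDerivAt_id w).pow 2).div_const 2
    refine (h1.add h2).congr_deriv ?_
    simp only [id]
    field_simp
    ring
  refine antitone_of_deriv_nonpos (fun w => (hd w).differentiableAt) fun w => ?_
  rw [(hd w).deriv]
  have := Real.add_one_le_exp (w / r)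
  nlinarith

/-- The analogous log ratio for $(V-s^2)/s$, with $V$ Gamma of shape $s^2+1$. Centring at the mode
$s^2$ cancels the low order terms, and the derivative is $w^2/(s+w)$. -/
lemma monotoneOn_log_ratio_affine (s : ℝ) :
    MonotoneOn (fun w : ℝ => s ^ 2 * Real.log (s + w) - s * w + w ^ 2 / 2) (Set.Ioi (-s)) := by
  have hd : ∀ w ∈ Set.Ioi (-s), HasDerivAt
      (fun w : ℝ => s ^ 2 * Real.log (s + w) - s * w + w ^ 2 / 2) (w ^ 2 / (s + w)) w := by
    intro w hw
    have hw' : 0 < s + w := by linarith [Set.mem_Ioi.1 hw]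
    have h1 := ((((hasDerivAt_id w).const_add s).log hw'.ne').const_mul (s ^ 2)).sub
      ((hasDerivAt_id w).const_mul s)
    have h2 := ((hasDerivAt_id w).pow 2).div_const 2
    refine (h1.add h2).congr_deriv ?_
    simp only [id]
    field_simp
    ring
  refine monotoneOn_of_deriv_nonneg (convex_Ioi _)
    (fun w hw => (hd w hw).continuousAt.continuousWithinAt)
    (fun w hw => (hd w (interior_subset hw)).differentiableAt.differentiableWithinAt) fun w hw => ?_
  rw [(hd w (interior_subset hw)).deriv]
  have hw' : 0 < s + w := by linarith [Set.mem_Ioi.1 (interior_subset hw)]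
  positivity

/-- With $V$ of law `erlang m`, the variable $\sqrt{m+1}\,\log(V/(m+1))$ has a decreasing likelihood
ratio to the normal law, hence is stochastically smaller. -/
lemma gaussianReal_Iic_le_erlang (m : ℕ) (z : ℝ) :
    gaussianReal 0 1 (Set.Iic z)
      ≤ erlang m (Set.Iic ((m + 1) * Real.exp (z / Real.sqrt (m + 1)))) := by
  obtain ⟨r, hr⟩ : ∃ r, r = Real.sqrt ((m : ℝ) + 1) := ⟨_, rfl⟩
  have hr0 : 0 < r := by rw [hr]; positivity
  have hrm : (m : ℝ) + 1 = r ^ 2 := by rw [hr, Real.sq_sqrt (by positivity)]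
  rw [← hr, hrm]
  set h : ℝ → ℝ := fun w => r ^ 2 * Real.exp (w / r) with hh
  have hpos : ∀ w, 0 < h w := fun w => by simp only [hh]; positivity
  have himg : ∀ S : Set ℝ, h '' S = {x | 0 < x ∧ r * Real.log (x / r ^ 2) ∈ S} := by
    intro S
    ext x
    constructor
    · rintro ⟨w, hw, rfl⟩
      refine ⟨hpos w, ?_⟩
      simp only [hh]
      rwa [mul_div_cancel_left₀ _ (by positivity), Real.log_exp, mul_div_cancel₀ _ hr0.ne']
    · rintro ⟨hx, hxS⟩
      refine ⟨_, hxS, ?_⟩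
      simp only [hh]
      rw [mul_div_cancel_left₀ _ hr0.ne', Real.exp_log (by positivity)]
      field_simp
  have hIic : h '' Set.Iic z = Set.Ioc 0 (h z) := by
    rw [himg]
    ext x
    simp only [Set.mem_Iic, Set.mem_ofPred_eq, Set.mem_Ioc]
    refine and_congr_right fun hx => ?_
    rw [← le_div_iff₀' hr0, Real.log_le_iff_le_exp (by positivity), div_le_iff₀' (by positivity)]
  have huniv : h '' Set.univ = Set.Ioi 0 := by
    rw [himg]; ext x; simp
  have hd : ∀ S, ∀ w ∈ S, HasDerivWithinAt h (r * Real.exp (w / r)) S w := by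
    intro S w _
    refine HasDerivAt.hasDerivWithinAt ?_
    refine (((hasDerivAt_id w).div_const r).exp.const_mul (r ^ 2)).congr_deriv ?_
    simp only [id]
    field_simp
  have hinj : ∀ S, Set.InjOn h S := fun S x _ y _ hxy => by
    have h1 := mul_left_cancel₀ (by positivity) hxy
    exact (div_left_inj' hr0.ne').1 (Real.exp_injective h1)
  set d : ℝ → ℝ≥0∞ := fun x => ENNReal.ofReal (x ^ m * Real.exp (-x) / m.factorial) with hdd
  have hf : ∀ w, ENNReal.ofReal |r * Real.exp (w / r)| * d (h w)
      = ENNReal.ofReal (r ^ (2 * m + 1) / m.factorial *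
        Real.exp (r * w - r ^ 2 * Real.exp (w / r))) := by
    intro w
    rw [hdd, abs_of_pos (by positivity), ← ENNReal.ofReal_mul (by positivity)]
    congr 1
    have h1 : Real.exp (r * w) = Real.exp (w / r) ^ (m + 1) := by
      rw [← Real.exp_nat_mul]
      congr 1
      push_cast
      rw [hrm]
      field_simp
    simp only [hh]
    rw [sub_eq_add_neg, Real.exp_add, h1]
    ring
  rw [erlang_Iic, ← hIic,
    lintegral_image_eq_lintegral_abs_deriv_mul measurableSet_Iic (hd _) (hinj _)]
  refine gaussianReal_Iic_le (f := fun w => ENNReal.ofReal |r * Real.exp (w / r)| * d (h w))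
    (by fun_prop) ?_ ?_ z
  · have := erlang_univ m
    rw [← huniv, lintegral_image_eq_lintegral_abs_deriv_mul .univ (hd _) (hinj _),
      setLIntegral_univ] at this
    exact this
  · intro x y hxy
    simp only [hf, gaussianPDF_zero_one]
    refine ofReal_mul_exp_mul_le (by positivity) (by positivity) ?_
    have := antitone_log_ratio_exp hr0 hxy
    simp only at this
    linarith

/-- The affine transform $(V-m)/\sqrt m$ has an increasing likelihood ratio to the normal law and is
stochastically larger. Its density vanishes below $-\sqrt m$, which respects the monotonicity. -/
lemma erlang_le_gaussianReal_Iic {m : ℕ} (hm : 0 < m) (z : ℝ) :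
    erlang m (Set.Iic (m + Real.sqrt m * z)) ≤ gaussianReal 0 1 (Set.Iic z) := by
  obtain ⟨s, hs⟩ : ∃ s, s = Real.sqrt (m : ℝ) := ⟨_, rfl⟩
  have hm' : (0 : ℝ) < m := by exact_mod_cast hm
  have hs0 : 0 < s := by rw [hs]; positivity
  have hsm : (m : ℝ) = s ^ 2 := by rw [hs, Real.sq_sqrt hm'.le]
  rw [← hs]
  set h : ℝ → ℝ := fun w => m + s * w with hh
  have hIic : h '' Set.Ioc (-s) z = Set.Ioc 0 (h z) := by
    ext x
    simp only [Set.mem_image, Set.mem_Ioc, hh]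
    constructor
    · rintro ⟨w, ⟨h1, h2⟩, rfl⟩
      exact ⟨by nlinarith, by gcongr⟩
    · rintro ⟨h1, h2⟩
      refine ⟨(x - m) / s, ⟨?_, ?_⟩, ?_⟩
      · rw [lt_div_iff₀ hs0]; nlinarith
      · rw [div_le_iff₀ hs0]; linarith
      · field_simp; ring
  have huniv : h '' Set.Ioi (-s) = Set.Ioi 0 := by
    ext x
    simp only [Set.mem_image, Set.mem_Ioi, hh]
    constructor
    · rintro ⟨w, h1, rfl⟩
      nlinarith
    · intro h1
      refine ⟨(x - m) / s, ?_, ?_⟩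
      · rw [lt_div_iff₀ hs0]; nlinarith
      · field_simp; ring
  have hd : ∀ S, ∀ w ∈ S, HasDerivWithinAt h s S w := by
    intro S w _
    refine HasDerivAt.hasDerivWithinAt ?_
    refine (((hasDerivAt_id w).const_mul s).const_add (m : ℝ)).congr_deriv ?_
    simp
  have hinj : ∀ S, Set.InjOn h S := fun S x _ y _ hxy =>
    mul_left_cancel₀ hs0.ne' (add_left_cancel hxy)
  set d : ℝ → ℝ≥0∞ := fun x => ENNReal.ofReal (x ^ m * Real.exp (-x) / m.factorial) with hdd
  have hf : ∀ w ∈ Set.Ioi (-s), ENNReal.ofReal |s| * d (h w)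
      = ENNReal.ofReal (s ^ (m + 1) * Real.exp (-m) / m.factorial *
        Real.exp (s ^ 2 * Real.log (s + w) - s * w)) := by
    intro w hw
    have hw' : 0 < s + w := by linarith [Set.mem_Ioi.1 hw]
    rw [hdd, abs_of_pos (by positivity), ← ENNReal.ofReal_mul (by positivity)]
    congr 1
    have h1 : Real.exp (s ^ 2 * Real.log (s + w)) = (s + w) ^ m := by
      rw [← hsm, Real.exp_nat_mul, Real.exp_log hw']
    have h2 : h w = s * (s + w) := by simp only [hh]; rw [hsm]; ring
    have h3 : Real.exp (-(h w)) = Real.exp (-m) * Real.exp (-(s * w)) := by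
      rw [← Real.exp_add]; congr 1; simp only [hh]; ring
    rw [h3, h2, sub_eq_add_neg, Real.exp_add, h1, mul_pow]
    ring
  set f : ℝ → ℝ≥0∞ := (Set.Ioi (-s)).indicator fun w => ENNReal.ofReal |s| * d (h w) with hff
  have hfm : Measurable f := Measurable.indicator (by fun_prop) measurableSet_Ioi
  have key : ∫⁻ x in Set.Iic z, f x = erlang m (Set.Iic (h z)) := by
    rw [erlang_Iic, ← hIic,
      lintegral_image_eq_lintegral_abs_deriv_mul measurableSet_Ioc (hd _) (hinj _), hff,
      setLIntegral_indicator measurableSet_Ioi]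
    rfl
  rw [← key]
  refine le_gaussianReal_Iic hfm ?_ ?_ z
  · have := erlang_univ m
    rw [← huniv, lintegral_image_eq_lintegral_abs_deriv_mul measurableSet_Ioi (hd _) (hinj _),
      ← lintegral_indicator measurableSet_Ioi] at this
    exact this
  · intro x y hxy
    by_cases hx : x ∈ Set.Ioi (-s)
    · have hy : y ∈ Set.Ioi (-s) := lt_of_lt_of_le hx hxy
      rw [hff, Set.indicator_of_mem hx, Set.indicator_of_mem hy, hf x hx, hf y hy,
        gaussianPDF_zero_one, gaussianPDF_zero_one]
      refine ofReal_mul_exp_mul_le (by positivity) (by positivity) ?_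
      have := monotoneOn_log_ratio_affine s hx hy hxy
      simp only at this
      linarith
    · rw [hff, Set.indicator_of_notMem hx, mul_zero]
      exact bot_le

end GaussianComparison

/-! ### Quantile coupling of Gamma and normal variables. -/

section QuantileTransform

lemma continuous_cdf (ν : Measure ℝ) [IsProbabilityMeasure ν] [NullSingletonClass ν] :
    Continuous (cdf ν) := by
  refine continuous_iff_continuousAt.2 fun x => ?_
  have h := (cdf ν).measure_singleton x
  rw [measure_cdf, measure_singleton, eq_comm, ENNReal.ofReal_eq_zero] at h
  have h1 := (monotone_cdf ν).leftLim_le (le_refl x)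
  have h2 : Function.leftLim (cdf ν) x = cdf ν x := le_antisymm h1 (by linarith)
  refine continuousAt_iff_continuous_left'_right'.2
    ⟨((monotone_cdf ν).continuousWithinAt_Iio_iff_leftLim_eq).2 h2,
      ((cdf ν).right_continuous x).mono Set.Ioi_subset_Ici_self⟩

/-- The probability integral transform: without atoms the distribution function is continuous, so it
equals $u$ at the right end of the sublevel set. -/
lemma measure_cdf_le (ν : Measure ℝ) [IsProbabilityMeasure ν] [NullSingletonClass ν] {u : ℝ}
    (hu : u ∈ Set.Ioo (0 : ℝ) 1) : ν {v | cdf ν v ≤ u} = ENNReal.ofReal u := by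
  set S := {v | cdf ν v ≤ u} with hS
  have hne : S.Nonempty :=
    ((tendsto_cdf_atBot ν).eventually (gt_mem_nhds hu.1)).exists.imp fun _ h => h.le
  have hb : BddAbove S := by
    obtain ⟨b, hb⟩ := ((tendsto_cdf_atTop ν).eventually (lt_mem_nhds hu.2)).exists
    exact ⟨b, fun v hv => le_of_not_gt fun h =>
      (lt_irrefl u) (hb.trans_le ((monotone_cdf ν h.le).trans hv))⟩
  have hc : IsClosed S := isClosed_le (continuous_cdf ν) continuous_const
  have hmem : sSup S ∈ S := hc.csSup_mem hne hb
  have hSeq : S = Set.Iic (sSup S) := by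
    ext v
    exact ⟨fun hv => le_csSup hb hv, fun hv => (monotone_cdf ν hv).trans hmem⟩
  have hval : cdf ν (sSup S) = u := by
    refine le_antisymm hmem ?_
    refine ge_of_tendsto (((continuous_cdf ν).tendsto (sSup S)).mono_left nhdsWithin_le_nhds)
      (f := cdf ν) (x := 𝓝[>] (sSup S)) ?_
    filter_upwards [self_mem_nhdsWithin] with v hv
    by_contra h
    exact (not_le.2 (Set.mem_Ioi.1 hv)) (le_csSup hb (le_of_lt (not_le.1 h)))
  rw [hSeq, ← ofReal_cdf, hval]

lemma ae_cdf_mem_Ioo (ν : Measure ℝ) [IsProbabilityMeasure ν] [NullSingletonClass ν] :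
    ∀ᵐ v ∂ν, cdf ν v ∈ Set.Ioo (0 : ℝ) 1 := by
  have h0 : ∀ᵐ v ∂ν, cdf ν v ≠ 0 := by
    rw [ae_iff]
    refine le_antisymm (ENNReal.le_of_forall_pos_le_add fun ε hε _ => ?_) bot_le
    obtain ⟨δ, h1, h2⟩ : ∃ δ : ℝ, δ ∈ Set.Ioo (0 : ℝ) 1 ∧ δ ≤ ε :=
      ⟨min ε (1 / 2), ⟨lt_min (by exact_mod_cast hε) (by norm_num),
        lt_of_le_of_lt (min_le_right _ _) (by norm_num)⟩, min_le_left _ _⟩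
    calc ν {v | ¬ cdf ν v ≠ 0} ≤ ν {v | cdf ν v ≤ δ} := measure_mono fun v hv => by
          simp only [ne_eq, not_not, Set.mem_ofPred_eq] at hv ⊢
          rw [hv]; exact h1.1.le
      _ = ENNReal.ofReal δ := measure_cdf_le ν h1
      _ ≤ 0 + ε := by
          rw [zero_add, ENNReal.ofReal_le_iff_le_toReal (by simp)]
          simpa using h2
  have h1 : ∀ᵐ v ∂ν, cdf ν v ≠ 1 := by
    rw [ae_iff]
    refine le_antisymm (ENNReal.le_of_forall_pos_le_add fun ε hε _ => ?_) bot_le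
    obtain ⟨δ, h1, h2⟩ : ∃ δ : ℝ, δ ∈ Set.Ioo (0 : ℝ) 1 ∧ δ ≤ ε :=
      ⟨min ε (1 / 2), ⟨lt_min (by exact_mod_cast hε) (by norm_num),
        lt_of_le_of_lt (min_le_right _ _) (by norm_num)⟩, min_le_left _ _⟩
    have hm : MeasurableSet {v | cdf ν v ≤ 1 - δ} :=
      measurableSet_le (continuous_cdf ν).measurable measurable_const
    calc ν {v | ¬ cdf ν v ≠ 1} ≤ ν {v | cdf ν v ≤ 1 - δ}ᶜ := measure_mono fun v hv => by
          simp only [ne_eq, not_not, Set.mem_ofPred_eq, Set.mem_compl_iff, not_le] at hv ⊢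
          rw [hv]; linarith [h1.1]
      _ = 1 - ENNReal.ofReal (1 - δ) := by
          rw [prob_compl_eq_one_sub hm, measure_cdf_le ν ⟨by linarith [h1.2], by linarith [h1.1]⟩]
      _ = ENNReal.ofReal δ := by
          rw [← ENNReal.ofReal_one, ← ENNReal.ofReal_sub _ (by linarith [h1.2])]
          congr 1; ring
      _ ≤ 0 + ε := by
          rw [zero_add, ENNReal.ofReal_le_iff_le_toReal (by simp)]
          simpa using h2
  filter_upwards [h0, h1] with v h0 h1
  exact ⟨lt_of_le_of_ne (cdf_nonneg _ _) h0.symm, lt_of_le_of_ne (cdf_le_one _ _) h1⟩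

/-- The increasing transport of `ν` to `η`. -/
noncomputable def quantileTransform (ν η : Measure ℝ) (v : ℝ) : ℝ := quantile η (cdf ν v)

lemma measurable_quantileTransform (ν η : Measure ℝ) : Measurable (quantileTransform ν η) :=
  (measurable_quantile η).comp (monotone_cdf ν).measurable

lemma map_quantileTransform (ν η : Measure ℝ) [IsProbabilityMeasure ν] [NullSingletonClass ν]
    [IsProbabilityMeasure η] (hη : ∀ x, cdf η x ∈ Set.Ioo (0 : ℝ) 1) :
    ν.map (quantileTransform ν η) = η := by
  have := Measure.isProbabilityMeasure_map (μ := ν)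
    (measurable_quantileTransform ν η).aemeasurable
  refine Measure.ext_of_Iic _ _ fun x => ?_
  rw [Measure.map_apply (measurable_quantileTransform ν η) measurableSet_Iic, ← ofReal_cdf η x,
    ← measure_cdf_le ν (hη x)]
  refine measure_congr ?_
  filter_upwards [ae_cdf_mem_Ioo ν] with v hv
  exact propext (quantile_le_iff η hv x)

lemma cdf_gaussianReal_mem_Ioo (x : ℝ) : cdf (gaussianReal 0 1) x ∈ Set.Ioo (0 : ℝ) 1 := by
  have h := gaussianReal_absolutelyContinuous' 0 (v := 1) one_ne_zero
  have h1 : gaussianReal 0 1 (Set.Iic x) ≠ 0 := fun hn => by simpa using h hn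
  have h2 : gaussianReal 0 1 (Set.Iic x)ᶜ ≠ 0 := fun hn => by
    have := h hn
    rw [Set.compl_Iic] at this
    simp at this
  rw [← ofReal_cdf] at h1
  rw [prob_compl_eq_one_sub measurableSet_Iic, ← ofReal_cdf] at h2
  refine ⟨by simpa using h1, lt_of_not_ge fun hn => h2 ?_⟩
  rw [tsub_eq_zero_iff_le, ← ENNReal.ofReal_one]
  exact ENNReal.ofReal_le_ofReal hn

/-- The normal variable coupled with a sum of `k` standard exponential variables. -/
noncomputable def coupledNormal (k : ℕ) (y : Fin k → ℝ) : ℝ :=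
  quantileTransform (erlang (k - 1)) (gaussianReal 0 1) (∑ i, Real.log (y i))

lemma measurable_coupledNormal (k : ℕ) : Measurable (coupledNormal k) :=
  (measurable_quantileTransform _ _).comp (by fun_prop)

lemma map_sum_log' {k : ℕ} (hk : 0 < k) :
    (Measure.pi fun _ : Fin k => paretoMeasure 1 1).map (fun y => ∑ i, Real.log (y i))
      = erlang (k - 1) := by
  obtain ⟨m, rfl⟩ := Nat.exists_eq_succ_of_ne_zero hk.ne'
  exact map_sum_log m

lemma map_coupledNormal {k : ℕ} (hk : 0 < k) :
    (Measure.pi fun _ : Fin k => paretoMeasure 1 1).map (coupledNormal k)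
      = gaussianReal 0 1 := by
  rw [← map_quantileTransform (erlang (k - 1)) (gaussianReal 0 1) cdf_gaussianReal_mem_Ioo,
    ← map_sum_log' hk, Measure.map_map (measurable_quantileTransform _ _) (by fun_prop),
    map_sum_log' hk]
  rfl

/-- The increasing coupling turns both stochastic orders into pointwise inequalities. The lower one
is obtained for $z<N$ and passes to the limit; the upper one is inverted by strict monotonicity of
the Gamma distribution function. -/
lemma quantileTransform_erlang_sandwich {m : ℕ} (hm : 0 < m) {v : ℝ} (hv : 0 < v)
    (hv' : cdf (erlang m) v ∈ Set.Ioo (0 : ℝ) 1) {N : ℝ}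
    (hN : N = quantileTransform (erlang m) (gaussianReal 0 1) v) :
    m + Real.sqrt m * N ≤ v ∧ v ≤ (m + 1) * Real.exp (N / Real.sqrt (m + 1)) := by
  have hiff := fun x => quantile_le_iff (gaussianReal 0 1) hv' x
  rw [quantileTransform] at hN
  rw [← hN] at hiff
  constructor
  · have h1 : ∀ z < N, m + Real.sqrt m * z ≤ v := by
      intro z hz
      have h2 : cdf (gaussianReal 0 1) z < cdf (erlang m) v :=
        lt_of_not_ge fun h => hz.not_ge ((hiff z).2 h)
      have h3 : cdf (erlang m) (m + Real.sqrt m * z) ≤ cdf (gaussianReal 0 1) z := by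
        have := erlang_le_gaussianReal_Iic hm z
        rwa [← ofReal_cdf, ← ofReal_cdf, ENNReal.ofReal_le_ofReal_iff (cdf_nonneg _ _)] at this
      exact le_of_not_gt fun h => (h3.trans_lt h2).not_ge (monotone_cdf _ h.le)
    have hc : Tendsto (fun z : ℝ => m + Real.sqrt m * z) (𝓝[<] N) (𝓝 (m + Real.sqrt m * N)) :=
      ((by fun_prop : Continuous fun z : ℝ => m + Real.sqrt m * z).tendsto N).mono_left
        nhdsWithin_le_nhds
    refine le_of_tendsto hc ?_
    filter_upwards [self_mem_nhdsWithin] with z hz using h1 z hz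
  · have h2 : cdf (erlang m) v ≤ cdf (gaussianReal 0 1) N := (hiff N).1 le_rfl
    have h3 : cdf (gaussianReal 0 1) N
        ≤ cdf (erlang m) ((m + 1) * Real.exp (N / Real.sqrt (m + 1))) := by
      have := gaussianReal_Iic_le_erlang m N
      rwa [← ofReal_cdf, ← ofReal_cdf, ENNReal.ofReal_le_ofReal_iff (cdf_nonneg _ _)] at this
    refine ((strictMonoOn_cdf_erlang m).le_iff_le (Set.mem_Ici.2 hv.le) (Set.mem_Ici.2 ?_)).1
      (h2.trans h3)
    positivity

lemma exp_sub_one_sub_id_le (x : ℝ) : Real.exp x - 1 - x ≤ x ^ 2 * Real.exp |x| := by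
  have h1 : Real.exp x - 1 ≤ x * Real.exp x := by
    have := Real.add_one_le_exp (-x)
    have h2 := mul_le_mul_of_nonneg_right this (Real.exp_pos x).le
    rw [← Real.exp_add, neg_add_cancel, Real.exp_zero] at h2
    linarith
  rcases le_total 0 x with hx | hx
  · rw [abs_of_nonneg hx]; nlinarith
  · have h3 := Real.add_one_le_exp x
    have h4 : 1 ≤ Real.exp |x| := Real.one_le_exp (abs_nonneg _)
    nlinarith [sq_nonneg x]

/-- With $r=\sqrt{m+1}$ and $s=\sqrt m$, expanding $r^2e^{N/r}$ to second order gives $v-r^2-rN\le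
N^2e^{|N|}$, and the lower bound loses at most $1+(r-s)|N|$. Both errors are bounded in $m$; the
division by $r$ produces the rate. The exponential majorant has Gaussian moments of all orders. -/
lemma abs_sub_coupled_le {m : ℕ} {v N : ℝ} (h1 : m + Real.sqrt m * N ≤ v)
    (h2 : v ≤ (m + 1) * Real.exp (N / Real.sqrt (m + 1))) :
    |(v - (m + 1)) / Real.sqrt (m + 1) - N|
      ≤ 1 / Real.sqrt (m + 1) * (4 * Real.exp (2 * N) + 4 * Real.exp (-2 * N)) := by
  obtain ⟨r, hr⟩ : ∃ r, r = Real.sqrt ((m : ℝ) + 1) := ⟨_, rfl⟩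
  obtain ⟨s, hs⟩ : ∃ s, s = Real.sqrt (m : ℝ) := ⟨_, rfl⟩
  have hr1 : 1 ≤ r := by
    rw [hr]
    exact Real.one_le_sqrt.2 (by linarith [Nat.cast_nonneg (α := ℝ) m])
  have hs0 : 0 ≤ s := by rw [hs]; positivity
  have hrm : (m : ℝ) + 1 = r ^ 2 := by rw [hr, Real.sq_sqrt (by positivity)]
  have hsm : (m : ℝ) = s ^ 2 := by rw [hs, Real.sq_sqrt (by positivity)]
  rw [← hr] at h2 ⊢
  rw [← hs] at h1
  rw [hrm] at h2 ⊢
  have hr0 : 0 < r := by linarith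
  have hsr : s ≤ r := by nlinarith
  have hrs : r - s ≤ 1 := by nlinarith
  have hE : 1 + |N| + N ^ 2 * Real.exp |N| ≤ 4 * Real.exp (2 * |N|) := by
    have e1 : 1 + |N| ≤ Real.exp |N| := by linarith [Real.add_one_le_exp |N|]
    have e2 := Real.quadratic_le_exp_of_nonneg (abs_nonneg N)
    have e3 : Real.exp (2 * |N|) = Real.exp |N| * Real.exp |N| := by rw [← Real.exp_add]; ring_nf
    have e4 : 1 ≤ Real.exp |N| := Real.one_le_exp (abs_nonneg _)
    rw [sq_abs] at e2
    have e5 : N ^ 2 ≤ 2 * Real.exp |N| := by linarith [abs_nonneg N]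
    rw [e3]
    nlinarith [mul_le_mul_of_nonneg_right e5 (Real.exp_pos |N|).le]
  have hE2 : Real.exp (2 * |N|) ≤ Real.exp (2 * N) + Real.exp (-2 * N) := by
    rcases abs_cases N with ⟨h, _⟩ | ⟨h, _⟩ <;> rw [h]
    · linarith [Real.exp_pos (-2 * N)]
    · rw [mul_neg, ← neg_mul]; linarith [Real.exp_pos (2 * N)]
  have hup : v - r ^ 2 - r * N ≤ N ^ 2 * Real.exp |N| := by
    have e1 := exp_sub_one_sub_id_le (N / r)
    have e2 : Real.exp |N / r| ≤ Real.exp |N| := by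
      rw [Real.exp_le_exp, abs_div, abs_of_pos hr0]
      exact div_le_self (abs_nonneg _) hr1
    have e3 : (N / r) ^ 2 * Real.exp |N / r| ≤ (N / r) ^ 2 * Real.exp |N| := by gcongr
    have e4 := mul_le_mul_of_nonneg_left (e1.trans e3) (sq_nonneg r)
    have e5 : r ^ 2 * ((N / r) ^ 2 * Real.exp |N|) = N ^ 2 * Real.exp |N| := by field_simp
    have e6 : r ^ 2 * (Real.exp (N / r) - 1 - N / r)
        = r ^ 2 * Real.exp (N / r) - r ^ 2 - r * N := by
      field_simp
    linarith
  have hlo : -(1 + |N|) ≤ v - r ^ 2 - r * N := by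
    have e1 : (r - s) * N ≤ 1 * |N| :=
      (mul_le_mul_of_nonneg_left (le_abs_self N) (by linarith)).trans (by gcongr)
    nlinarith
  have hfin : |v - r ^ 2 - r * N| ≤ 4 * Real.exp (2 * N) + 4 * Real.exp (-2 * N) := by
    have e3 : 0 ≤ N ^ 2 * Real.exp |N| := by positivity
    rw [abs_le]
    constructor <;> linarith [abs_nonneg N]
  have : (v - r ^ 2) / r - N = 1 / r * (v - r ^ 2 - r * N) := by field_simp
  rw [this, abs_mul, abs_of_pos (by positivity)]
  gcongr

lemma memLp_exp_mul_gaussianReal (c : ℝ) {p : ℝ} (hp : 0 < p) :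
    MemLp (fun x => Real.exp (c * x)) (ENNReal.ofReal p) (gaussianReal 0 1) := by
  refine memLp_ofReal_of_lintegral hp (by fun_prop) ?_
  have h := (integrable_exp_mul_gaussianReal (μ := 0) (v := 1) (p * c)).lintegral_lt_top.ne
  refine (lintegral_congr fun x => ?_).trans_ne h
  rw [Real.abs_exp, ← Real.exp_mul]
  congr 2
  ring

/-- The Gaussian approximation of the normalized mean of `k` exponential variables, with rate
`1 / √k`. -/
lemma exists_eLpNorm_sub_coupledNormal_le {p : ℝ} (hp : 1 ≤ p) :
    ∃ C : ℝ, 0 ≤ C ∧ ∀ k : ℕ, 2 ≤ k →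
      eLpNorm (fun y => Real.sqrt k * ((1 / (k : ℝ)) * ∑ i, Real.log (y i) - 1) - coupledNormal k y)
        (ENNReal.ofReal p) (Measure.pi fun _ : Fin k => paretoMeasure 1 1)
        ≤ ENNReal.ofReal (C / Real.sqrt k) := by
  have hp0 : 0 < p := by linarith
  set Ψ : ℝ → ℝ := fun x => 4 * Real.exp (2 * x) + 4 * Real.exp (-2 * x) with hΨ
  have hmem : MemLp Ψ (ENNReal.ofReal p) (gaussianReal 0 1) :=
    ((memLp_exp_mul_gaussianReal 2 hp0).const_mul 4).add
      ((memLp_exp_mul_gaussianReal (-2) hp0).const_mul 4)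
  refine ⟨(eLpNorm Ψ (ENNReal.ofReal p) (gaussianReal 0 1)).toReal, ENNReal.toReal_nonneg, ?_⟩
  intro k hk
  obtain ⟨m, rfl⟩ : ∃ m, k = m + 1 := ⟨k - 1, by omega⟩
  have hm : 0 < m := by omega
  set μ := Measure.pi fun _ : Fin (m + 1) => paretoMeasure 1 1 with hμ
  have hae : ∀ᵐ y ∂μ, 0 < ∑ i, Real.log (y i) ∧
      cdf (erlang m) (∑ i, Real.log (y i)) ∈ Set.Ioo (0 : ℝ) 1 := by
    have h := (ae_pos_erlang m).and (ae_cdf_mem_Ioo (erlang m))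
    rw [← map_sum_log m] at h
    have := ae_of_ae_map (show Measurable fun y : Fin (m + 1) → ℝ =>
      ∑ i, Real.log (y i) by fun_prop).aemeasurable h
    rwa [map_sum_log m] at this
  have hle : ∀ᵐ y ∂μ, ‖Real.sqrt (m + 1 : ℕ) * ((1 / ((m + 1 : ℕ) : ℝ)) *
      ∑ i, Real.log (y i) - 1) - coupledNormal (m + 1) y‖
      ≤ ‖(1 / Real.sqrt (m + 1)) * Ψ (coupledNormal (m + 1) y)‖ := by
    filter_upwards [hae] with y ⟨hy1, hy2⟩
    obtain ⟨h1, h2⟩ := quantileTransform_erlang_sandwich hm hy1 hy2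
      (N := coupledNormal (m + 1) y) rfl
    have h := abs_sub_coupled_le h1 h2
    rw [Real.norm_eq_abs]
    refine (le_of_eq ?_).trans (h.trans (le_abs_self _))
    congr 2
    push_cast
    have h3 : Real.sqrt ((m : ℝ) + 1) ^ 2 = m + 1 := Real.sq_sqrt (by positivity)
    have h4 : 0 < Real.sqrt ((m : ℝ) + 1) := by positivity
    rw [eq_div_iff h4.ne']
    rw [mul_right_comm, ← sq, h3]
    field_simp
  refine (eLpNorm_mono_ae hle).trans ?_
  have h5 : eLpNorm (fun y => Ψ (coupledNormal (m + 1) y)) (ENNReal.ofReal p) μ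
      = eLpNorm Ψ (ENNReal.ofReal p) (gaussianReal 0 1) := by
    rw [← map_coupledNormal (Nat.succ_pos m), eLpNorm_map_measure (by fun_prop)
      (measurable_coupledNormal _).aemeasurable]
    rfl
  rw [show (fun y => 1 / Real.sqrt (m + 1) * Ψ (coupledNormal (m + 1) y))
    = (1 / Real.sqrt (m + 1)) • (fun y => Ψ (coupledNormal (m + 1) y)) from rfl,
    eLpNorm_const_smul, h5, Real.enorm_of_nonneg (by positivity),
    div_eq_mul_one_div (ENNReal.toReal _), mul_comm (ENNReal.toReal _),
    ENNReal.ofReal_mul (by positivity), ENNReal.ofReal_toReal hmem.2.ne, Nat.cast_add_one]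

end QuantileTransform

/-! ### Averages over a Pareto sample in $L^p$. -/

section Averages

/-- Minkowski's inequality. Independence is not exploited, as this serves for a remainder that is
small term by term. -/
lemma eLpNorm_average_le {k : ℕ} (hk : 0 < k) {p : ℝ≥0∞} (hp : 1 ≤ p) (μ : Measure ℝ)
    [IsProbabilityMeasure μ] {f : ℝ → ℝ} (hf : Measurable f) :
    eLpNorm (fun y : Fin k → ℝ => (1 / (k : ℝ)) * ∑ i, f (y i)) p (Measure.pi fun _ => μ)
      ≤ eLpNorm f p μ := by
  have hi : ∀ i : Fin k, eLpNorm (fun y : Fin k → ℝ => f (y i)) p (Measure.pi fun _ => μ)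
      = eLpNorm f p μ := fun i =>
    eLpNorm_comp_measurePreserving hf.aestronglyMeasurable
      (measurePreserving_eval (fun _ : Fin k => μ) i)
  have hs : eLpNorm (∑ i : Fin k, fun y : Fin k → ℝ => f (y i)) p (Measure.pi fun _ => μ)
      ≤ k * eLpNorm f p μ := by
    refine (eLpNorm_sum_le (fun i _ => ?_) hp).trans ?_
    · exact (hf.comp (measurable_pi_apply i)).aestronglyMeasurable
    · simp [hi]
  have he : (fun y : Fin k → ℝ => (1 / (k : ℝ)) * ∑ i, f (y i))
      = (1 / (k : ℝ)) • ∑ i : Fin k, fun y : Fin k → ℝ => f (y i) := by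
    ext y; simp
  rw [he, eLpNorm_const_smul]
  calc _ ≤ ‖(1 / (k : ℝ))‖ₑ * (k * eLpNorm f p μ) := by gcongr
    _ = eLpNorm f p μ := by
      rw [← mul_assoc, Real.enorm_of_nonneg (by positivity), ← ENNReal.ofReal_natCast,
        ← ENNReal.ofReal_mul (by positivity), one_div_mul_cancel (by positivity),
        ENNReal.ofReal_one, one_mul]

lemma integral_boxCox_unitPareto (ρ : ℝ) : ∫ z, boxCox ρ z ∂(paretoMeasure 1 1) = bias ρ := by
  have hb := measurable_boxCox ρ
  rw [bias, integral_eq_lintegral_of_nonneg_ae, integral_eq_lintegral_of_nonneg_ae,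
    lintegral_unitPareto]
  · congr 1
    refine setLIntegral_congr_fun measurableSet_Ioi fun z _ => ?_
    rw [← ENNReal.ofReal_mul (by positivity)]
    congr 1
    ring
  · filter_upwards [ae_restrict_mem measurableSet_Ioi] with z hz
    have := boxCox_nonneg ρ (le_of_lt (Set.mem_Ioi.1 hz))
    simp only [Pi.zero_apply]
    positivity
  · exact Measurable.aestronglyMeasurable (by fun_prop)
  · filter_upwards [ae_one_le_unitPareto] with z hz using boxCox_nonneg ρ hz
  · exact hb.aestronglyMeasurable

/-- The $L^p$ law of large numbers for the given sequence `Z`, transported to the product measures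
through the law of its first `k` terms. -/
lemma tendsto_eLpNorm_average_boxCox {Ω : Type*} [MeasurableSpace Ω] {P : Measure Ω}
    [IsProbabilityMeasure P] {Z : ℕ → Ω → ℝ} (hZ : ∀ i, HasLaw (Z i) (paretoMeasure 1 1) P)
    (hind : iIndepFun Z P) {ρ p : ℝ} (hρ : ρ ≤ 0) (hp : 1 ≤ p) :
    Tendsto (fun k : ℕ => eLpNorm (fun y : Fin k → ℝ => (1 / (k : ℝ)) * ∑ i, boxCox ρ (y i)
      - bias ρ) (ENNReal.ofReal p) (Measure.pi fun _ => paretoMeasure 1 1)) atTop (𝓝 0) := by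
  have hb := measurable_boxCox ρ
  have hid : ∀ i, IdentDistrib (Z i) (Z 0) P P := fun i =>
    ⟨(hZ i).aemeasurable, (hZ 0).aemeasurable, by rw [(hZ i).map_eq, (hZ 0).map_eq]⟩
  have h0 : MemLp (fun ω => boxCox ρ (Z 0 ω)) (ENNReal.ofReal p) P := by
    have := memLp_boxCox hρ hp
    rw [← (hZ 0).map_eq] at this
    exact this.comp_of_map (hZ 0).aemeasurable
  have h1 := strong_law_Lp (μ := P) (p := ENNReal.ofReal p) (by simpa using hp)
    ENNReal.ofReal_ne_top (fun i ω => boxCox ρ (Z i ω)) h0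
    (fun i j hij => (hind.indepFun hij).comp hb hb) (fun i => (hid i).comp hb)
  have h2 : ∫ ω, boxCox ρ (Z 0 ω) ∂P = bias ρ := by
    rw [← integral_boxCox_unitPareto, ← (hZ 0).map_eq,
      integral_map (hZ 0).aemeasurable hb.aestronglyMeasurable]
  rw [h2] at h1
  refine h1.congr fun k => ?_
  have hpi : AEMeasurable (fun ω (i : Fin k) => Z i ω) P :=
    aemeasurable_pi_lambda _ fun i => (hZ i).aemeasurable
  rw [← map_sample_eq_pi hZ hind k, eLpNorm_map_measure (Measurable.aestronglyMeasurable
    (by fun_prop)) hpi]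
  congr 1
  funext ω
  simp [Finset.sum_range]

end Averages

/-! ### Gaussian approximation of the Hill estimator at a given threshold. -/

section ConditionalHill

lemma IsIntermediate.tendsto_div_atTop {k : ℕ → ℕ} (hk : IsIntermediate k) :
    Tendsto (fun n : ℕ => (n : ℝ) / k n) atTop atTop := by
  have h1 : Tendsto (fun n : ℕ => (k n : ℝ) / n) atTop (𝓝[>] 0) := by
    refine tendsto_nhdsWithin_iff.2 ⟨hk.2, ?_⟩
    filter_upwards [hk.1.eventually_gt_atTop 0, eventually_gt_atTop 0] with n h1 h2
    have : (0 : ℝ) < k n := by exact_mod_cast h1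
    have : (0 : ℝ) < n := by exact_mod_cast h2
    exact Set.mem_Ioi.2 (by positivity)
  refine h1.inv_tendsto_nhdsGT_zero.congr fun n => ?_
  simp

/-- The normalized Hill estimator of the points `U (u_i)` above the threshold `U x`. -/
noncomputable def hillStat (U : ℝ → ℝ) (γ : ℝ) (k : ℕ) (q : ℝ × (Fin k → ℝ)) : ℝ :=
  Real.sqrt k * ((1 / (k : ℝ)) * ∑ i, Real.log (U (q.2 i) / U q.1) - γ)

lemma measurable_hillStat {U : ℝ → ℝ} (hU : Measurable U) (γ : ℝ) (k : ℕ) :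
    Measurable (hillStat U γ k) := by
  unfold hillStat
  fun_prop

variable {U A : ℝ → ℝ} {γ ρ p : ℝ}

/-- The four terms are the normal approximation error, the second order remainder, the fluctuation
of the bias around its mean, and the replacement of $A(t)$ by a deterministic value. -/
lemma hillStat_eq {k : ℕ} (hk : 0 < k) {t a b N : ℝ} (ht : 0 < t)
    (hUt : ∀ z, 1 ≤ z → 0 < U (t * z)) {y : Fin k → ℝ} (hy : ∀ i, 1 ≤ y i) :
    hillStat U γ k (t, fun i => t * y i) - (Real.sqrt k * a * b + γ * N)
      = γ * (Real.sqrt k * ((1 / (k : ℝ)) * ∑ i, Real.log (y i) - 1) - N)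
        + Real.sqrt k * ((1 / (k : ℝ)) *
          ∑ i, (logDefect U γ (t * y i) - logDefect U γ t - A t * boxCox ρ (y i)))
        + Real.sqrt k * A t * ((1 / (k : ℝ)) * ∑ i, boxCox ρ (y i) - b)
        + Real.sqrt k * (A t - a) * b := by
  have hk' : (0 : ℝ) < k := by exact_mod_cast hk
  have hU1 : 0 < U t := by simpa using hUt 1 le_rfl
  have h : ∀ i, Real.log (U (t * y i) / U t) = γ * Real.log (y i)
      + (logDefect U γ (t * y i) - logDefect U γ t - A t * boxCox ρ (y i))
      + A t * boxCox ρ (y i) := fun i => by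
    have hy0 : 0 < y i := by linarith [hy i]
    rw [Real.log_div (hUt _ (hy i)).ne' hU1.ne', logDefect, logDefect,
      Real.log_mul ht.ne' hy0.ne']
    ring
  simp only [hillStat, h]
  rw [Finset.sum_add_distrib, Finset.sum_add_distrib, ← Finset.mul_sum, ← Finset.mul_sum]
  ring

lemma eLpNorm_const_mul' {α : Type*} [MeasurableSpace α] {μ : Measure α} {q : ℝ≥0∞} (c : ℝ)
    (f : α → ℝ) : eLpNorm (fun y => c * f y) q μ = ENNReal.ofReal |c| * eLpNorm f q μ := by
  rw [show (fun y => c * f y) = c • f from rfl, eLpNorm_const_smul, Real.enorm_eq_ofReal_abs]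

/-- The conditional Hill estimator is `L^p`-close to a normal variable, uniformly over thresholds
of the order of `n / k`. -/
lemma SecondOrder.eLpNorm_hillStat_sub_le (hA : SecondOrder U A γ ρ) (hγ : 0 < γ) (hρ : ρ ≤ 0)
    (hU : MonotoneOn U (Set.Ioi 1)) (hUm : Measurable U) (hp : 1 ≤ p)
    {Ω : Type*} [MeasurableSpace Ω] {P : Measure Ω} [IsProbabilityMeasure P] {Z : ℕ → Ω → ℝ}
    (hZ : ∀ i, HasLaw (Z i) (paretoMeasure 1 1) P) (hind : iIndepFun Z P) :
    ∃ C : ℝ, 0 ≤ C ∧ ∀ k : ℕ → ℕ, IsIntermediate k → ∀ ε : ℝ, 0 < ε → ∃ η, 0 < η ∧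
      ∀ᶠ n : ℕ in atTop, ∀ t, 0 < t → |Real.log (t / (n / k n))| ≤ η →
        eLpNorm (fun y => hillStat U γ (k n) (t, fun i => t * y i)
            - (Real.sqrt (k n) * A (n / k n) * bias ρ + γ * coupledNormal (k n) y))
          (ENNReal.ofReal p) (Measure.pi fun _ : Fin (k n) => paretoMeasure 1 1)
          ≤ ENNReal.ofReal (C / Real.sqrt (k n))
            + ENNReal.ofReal (ε * |Real.sqrt (k n) * A (n / k n)|) := by
  obtain ⟨C, hC, hCk⟩ := exists_eLpNorm_sub_coupledNormal_le hp
  have hp1 : 1 ≤ ENNReal.ofReal p := by simpa using hp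
  refine ⟨γ * C, by positivity, fun k hk ε hε => ?_⟩
  -- The last three terms contribute $2\varepsilon'$, $2\varepsilon'$ and $\varepsilon'|b(\rho)|$
  -- times $\sqrt k\,|A(n/k)|$. The cap at 1 ensures $|A(t)|\le2|A(n/k)|$.
  set ε' := min (ε / (4 + |bias ρ|)) 1 with hε'
  have hε0 : 0 < ε' := lt_min (by positivity) one_pos
  have hε1 : ε' ≤ 1 := min_le_right _ _
  have hεε : ε' * (4 + |bias ρ|) ≤ ε := by
    rw [← le_div_iff₀ (by positivity)]
    exact min_le_left _ _
  obtain ⟨η, hη, hAη⟩ := hA.abs_sub_le hγ hU hUm hε0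
  refine ⟨η, hη, ?_⟩
  have hε'' : (0 : ℝ≥0∞) < ENNReal.ofReal ε' := by simpa using hε0
  have hev : ∀ᶠ t in atTop, A t ≠ 0 ∧ 1 < t ∧ (∀ z, 1 ≤ z → 0 < U (t * z)) ∧
      eLpNorm (fun z => (logDefect U γ (t * z) - logDefect U γ t) / A t - boxCox ρ z)
        (ENNReal.ofReal p) (paretoMeasure 1 1) ≤ ENNReal.ofReal ε' := by
    filter_upwards [hA.eventually_ne_zero, eventually_gt_atTop 1,
      (hA.tendsto_eLpNorm_logDefect hγ hρ hU hUm hp).eventually (ge_mem_nhds hε''),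
      hA.eventually_pos hγ hU] with t h1 h2 h3 h4
    refine ⟨h1, h2, fun z hz => h4.trans_le (hU h2 ?_ ?_), h3⟩
    · exact Set.mem_Ioi.2 (by nlinarith)
    · nlinarith
  obtain ⟨M, hM⟩ := eventually_atTop.1 hev
  have hnk := hk.tendsto_div_atTop
  have hbox := ((tendsto_eLpNorm_average_boxCox hZ hind hρ hp).comp hk.1).eventually
    (ge_mem_nhds hε'')
  filter_upwards [hk.1.eventually_ge_atTop 2, hbox, hnk.eventually hAη,
    hnk.eventually_ge_atTop (|M| * Real.exp η), hnk.eventually_gt_atTop 0]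
    with n hk2 hbox hAn hnM hn0 t ht hlog
  have hAt := hAn t ht hlog
  simp only [Function.comp_apply] at hbox
  -- Closeness to $n/k$ on the logarithmic scale gives $t\ge e^{-\eta}n/k\ge|M|$.
  have htM : M ≤ t := by
    have h1 : -η ≤ Real.log (t / (n / k n)) := (abs_le.1 hlog).1
    rw [Real.le_log_iff_exp_le (by positivity), le_div_iff₀ hn0] at h1
    have h2 := mul_le_mul_of_nonneg_left hnM (Real.exp_pos (-η)).le
    have h3 : Real.exp (-η) * (|M| * Real.exp η) = |M| := by
      rw [Real.exp_neg]; field_simp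
    linarith [le_abs_self M]
  obtain ⟨hAt0, ht1, hUt, hdef⟩ := hM t htM
  generalize ha : A (n / k n) = a at *
  generalize hkk : k n = K at *
  have hK : 0 < K := by omega
  have hbm := measurable_boxCox ρ
  have hlm := measurable_logDefect hUm γ
  have hcm := measurable_coupledNormal K
  set π := Measure.pi fun _ : Fin K => paretoMeasure 1 1 with hπ
  have hae : ∀ᵐ y ∂π, ∀ i, 1 ≤ y i := ae_all_iff.2 fun i =>
    (Measure.quasiMeasurePreserving_eval (μ := fun _ : Fin K => paretoMeasure 1 1) i).ae
      ae_one_le_unitPareto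
  have heq : (fun y => hillStat U γ K (t, fun i => t * y i)
      - (Real.sqrt K * a * bias ρ + γ * coupledNormal K y)) =ᵐ[π] fun y =>
        γ * (Real.sqrt K * ((1 / (K : ℝ)) * ∑ i, Real.log (y i) - 1) - coupledNormal K y)
        + Real.sqrt K * ((1 / (K : ℝ)) *
          ∑ i, (logDefect U γ (t * y i) - logDefect U γ t - A t * boxCox ρ (y i)))
        + Real.sqrt K * A t * ((1 / (K : ℝ)) * ∑ i, boxCox ρ (y i) - bias ρ)
        + Real.sqrt K * (A t - a) * bias ρ := by
    filter_upwards [hae] with y hy using hillStat_eq hK ht hUt hy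
  rw [eLpNorm_congr_ae heq]
  have hA2 : |A t| ≤ 2 * |a| := by
    have := abs_sub_abs_le_abs_sub (A t) a
    nlinarith [abs_nonneg a]
  have n1 : eLpNorm (fun y : Fin K → ℝ => γ * (Real.sqrt K *
      ((1 / (K : ℝ)) * ∑ i, Real.log (y i) - 1) - coupledNormal K y)) (ENNReal.ofReal p) π
      ≤ ENNReal.ofReal (γ * C / Real.sqrt K) := by
    rw [eLpNorm_const_mul', abs_of_pos hγ, mul_div_assoc, ENNReal.ofReal_mul hγ.le]
    gcongr
    exact hCk K hk2
  have n2 : eLpNorm (fun y : Fin K → ℝ => Real.sqrt K * ((1 / (K : ℝ)) *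
      ∑ i, (logDefect U γ (t * y i) - logDefect U γ t - A t * boxCox ρ (y i))))
      (ENNReal.ofReal p) π ≤ ENNReal.ofReal (Real.sqrt K * (2 * |a| * ε')) := by
    rw [eLpNorm_const_mul', abs_of_nonneg (Real.sqrt_nonneg _),
      ENNReal.ofReal_mul (Real.sqrt_nonneg _)]
    gcongr
    refine (eLpNorm_average_le hK hp1 (paretoMeasure 1 1) (f := fun z =>
      logDefect U γ (t * z) - logDefect U γ t - A t * boxCox ρ z) (by fun_prop)).trans ?_
    have : (fun z => logDefect U γ (t * z) - logDefect U γ t - A t * boxCox ρ z)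
        = fun z => A t * ((logDefect U γ (t * z) - logDefect U γ t) / A t - boxCox ρ z) := by
      funext z
      field_simp
    rw [this, eLpNorm_const_mul', ENNReal.ofReal_mul (by positivity)]
    gcongr
  have n3 : eLpNorm (fun y : Fin K → ℝ => Real.sqrt K * A t * ((1 / (K : ℝ)) *
      ∑ i, boxCox ρ (y i) - bias ρ)) (ENNReal.ofReal p) π
      ≤ ENNReal.ofReal (Real.sqrt K * (2 * |a|) * ε') := by
    rw [eLpNorm_const_mul', abs_mul, abs_of_nonneg (Real.sqrt_nonneg _),
      ENNReal.ofReal_mul (p := Real.sqrt K * (2 * |a|)) (by positivity)]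
    gcongr
  have n4 : eLpNorm (fun _ : Fin K → ℝ => Real.sqrt K * (A t - a) * bias ρ)
      (ENNReal.ofReal p) π ≤ ENNReal.ofReal (Real.sqrt K * (ε' * |a|) * |bias ρ|) := by
    rw [eLpNorm_const _ (by positivity) (IsProbabilityMeasure.ne_zero π), measure_univ,
      ENNReal.one_rpow, mul_one, Real.enorm_eq_ofReal_abs, abs_mul, abs_mul,
      abs_of_nonneg (Real.sqrt_nonneg _)]
    gcongr
  have m1 : Measurable fun y : Fin K → ℝ => γ * (Real.sqrt K *
      ((1 / (K : ℝ)) * ∑ i, Real.log (y i) - 1) - coupledNormal K y) := by fun_prop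
  have m2 : Measurable fun y : Fin K → ℝ => Real.sqrt K * ((1 / (K : ℝ)) *
      ∑ i, (logDefect U γ (t * y i) - logDefect U γ t - A t * boxCox ρ (y i))) := by fun_prop
  have m3 : Measurable fun y : Fin K → ℝ => Real.sqrt K * A t * ((1 / (K : ℝ)) *
      ∑ i, boxCox ρ (y i) - bias ρ) := by fun_prop
  refine (eLpNorm_add_le ((m1.add m2).add m3).aestronglyMeasurable
    aestronglyMeasurable_const hp1).trans ?_
  refine (add_le_add ((eLpNorm_add_le (m1.add m2).aestronglyMeasurable m3.aestronglyMeasurable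
    hp1).trans (add_le_add (eLpNorm_add_le m1.aestronglyMeasurable m2.aestronglyMeasurable
    hp1) le_rfl)) le_rfl).trans ?_
  refine (add_le_add (add_le_add (add_le_add n1 n2) n3) n4).trans ?_
  rw [add_assoc, add_assoc, ← ENNReal.ofReal_add (by positivity) (by positivity),
    ← ENNReal.ofReal_add (by positivity) (by positivity)]
  gcongr
  rw [abs_mul, abs_of_nonneg (Real.sqrt_nonneg _)]
  have h5 : 0 ≤ Real.sqrt K * |a| := by positivity
  nlinarith [mul_le_mul_of_nonneg_right hεε h5]

end ConditionalHill

/-! ### Concentration of the threshold around $n/k$. -/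

section Threshold

variable {Ω : Type*} [MeasurableSpace Ω] {P : Measure Ω} [IsProbabilityMeasure P] {Z : ℕ → Ω → ℝ}

/-- The number of exceedances of the level `x` among the first `n` variables. -/
noncomputable def exceedances {Ω : Type*} (Z : ℕ → Ω → ℝ) (n : ℕ) (x : ℝ) (ω : Ω) : ℝ :=
  ∑ i ∈ Finset.range n, (Set.Ioi x).indicator 1 (Z i ω)

lemma exceedances_eq {Ω : Type*} (Z : ℕ → Ω → ℝ) (n : ℕ) (x : ℝ) (ω : Ω) : exceedances Z n x ω
    = n - ((Finset.univ.filter fun i : Fin n => Z i ω ≤ x).card : ℝ) := by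
  have h : ∀ i : ℕ, (Set.Ioi x).indicator (1 : ℝ → ℝ) (Z i ω)
      = 1 - if Z i ω ≤ x then 1 else 0 := fun i => by
    by_cases hi : Z i ω ≤ x
    · simp [hi]
    · simp [hi, not_le.1 hi]
  rw [exceedances, Finset.sum_range fun i => (Set.Ioi x).indicator (1 : ℝ → ℝ) (Z i ω)]
  simp only [h]
  rw [Finset.sum_sub_distrib]
  simp

/-- Chebyshev's inequality for a sum of independent indicators, whose variance is at most its mean
$n/x$. -/
lemma measure_exceedances_deviation_le (hZ : ∀ i, HasLaw (Z i) (paretoMeasure 1 1) P)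
    (hind : iIndepFun Z P) {x c : ℝ} (hx : 1 ≤ x) (hc : 0 < c) (n : ℕ) :
    P {ω | c ≤ |exceedances Z n x ω - n / x|} ≤ ENNReal.ofReal (n / x / c ^ 2) := by
  set g : ℝ → ℝ := (Set.Ioi x).indicator 1 with hg
  have hgm : Measurable g := measurable_one.indicator measurableSet_Ioi
  have hmem : ∀ i, MemLp (fun ω => g (Z i ω)) 2 P := fun i => by
    refine MemLp.of_bound (hgm.comp_aemeasurable (hZ i).aemeasurable).aestronglyMeasurable 1
      (.of_forall fun ω => ?_)
    simp only [hg, Set.indicator]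
    split_ifs <;> simp
  have hE : ∀ i, ∫ ω, g (Z i ω) ∂P = 1 / x := fun i => by
    have h1 : ∫ ω, g (Z i ω) ∂P = ∫ z, g z ∂(paretoMeasure 1 1) := by
      rw [← (hZ i).map_eq, integral_map (hZ i).aemeasurable hgm.aestronglyMeasurable]
    rw [h1, hg, integral_indicator_one measurableSet_Ioi, measureReal_def,
      paretoMeasure_Ioi one_pos hx, ENNReal.toReal_ofReal (by positivity),
      Real.rpow_neg_one, one_div]
  have hsq : ∀ z, g z ^ 2 = g z := fun z => by
    simp only [hg, Set.indicator]
    split_ifs <;> simp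
  have hV : ∀ i, Var[fun ω => g (Z i ω); P] ≤ 1 / x := fun i => by
    refine (variance_le_expectation_sq (hmem i).aestronglyMeasurable).trans (le_of_eq ?_)
    rw [← hE i]
    refine integral_congr_ae (.of_forall fun ω => ?_)
    simp [hsq]
  have hsum : MemLp (exceedances Z n x) 2 P := memLp_finsetSum _ fun i _ => hmem i
  have hEs : ∫ ω, exceedances Z n x ω ∂P = n / x := by
    unfold exceedances
    rw [integral_finsetSum _ fun i _ => (hmem i).integrable (by norm_num)]
    simp only [hE]
    simp [div_eq_mul_inv]
  have hVs : Var[exceedances Z n x; P] ≤ n / x := by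
    have h1 : exceedances Z n x = ∑ i ∈ Finset.range n, fun ω => g (Z i ω) := by
      funext ω
      simp [exceedances, hg]
    rw [h1, IndepFun.variance_sum (fun i _ => hmem i)
      fun i _ j _ hij => (hind.indepFun hij).comp hgm hgm]
    refine (Finset.sum_le_sum fun i _ => hV i).trans (le_of_eq ?_)
    simp [div_eq_mul_inv]
  have h := meas_ge_le_variance_div_sq hsum hc
  rw [hEs] at h
  exact h.trans (ENNReal.ofReal_le_ofReal (by gcongr))

lemma lt_threshold_iff {Ω : Type*} {Z : ℕ → Ω → ℝ} {n k : ℕ} (hkn : k < n) (x : ℝ) (ω : Ω) :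
    x < threshold Z n k ω ↔ (k : ℝ) < exceedances Z n x ω := by
  rw [exceedances_eq, ← not_le, threshold, orderStat_le_iff (by omega) (by omega), not_le,
    lt_sub_comm, ← Nat.cast_sub hkn.le, Nat.cast_lt]

/-- At the levels $(n/k)e^{\pm\eta}$ the expected numbers of exceedances are $ke^{\mp\eta}$, at a
distance of order $k$ from $k$, while the variances are of order $k$. Hence the rate $1/k$. -/
lemma measure_threshold_gt_le (hZ : ∀ i, HasLaw (Z i) (paretoMeasure 1 1) P)
    (hind : iIndepFun Z P) {n k : ℕ} (hk : 0 < k) (hkn : k < n) {η : ℝ} (hη : 0 < η)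
    (hx : 1 ≤ (n / k : ℝ) * Real.exp (-η)) :
    P {ω | ¬ |Real.log (threshold Z n k ω / (n / k))| ≤ η}
      ≤ ENNReal.ofReal ((Real.exp (-η) / (1 - Real.exp (-η)) ^ 2
        + Real.exp η / (Real.exp η - 1) ^ 2) / k) := by
  have hk' : (0 : ℝ) < k := by exact_mod_cast hk
  have hn' : (0 : ℝ) < n := by exact_mod_cast hk.trans hkn
  have he1 : Real.exp (-η) < 1 := Real.exp_lt_one_iff.2 (by linarith)
  have he2 : 1 < Real.exp η := Real.one_lt_exp_iff.2 hη
  set x₁ := (n / k : ℝ) * Real.exp η with hx1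
  set x₂ := (n / k : ℝ) * Real.exp (-η) with hx2
  have hx₁ : 1 ≤ x₁ := hx.trans (by simp only [hx1, hx2]; gcongr; linarith)
  have hnx1 : n / x₁ = k * Real.exp (-η) := by
    rw [hx1, Real.exp_neg]; field_simp
  have hnx2 : n / x₂ = k * Real.exp η := by
    rw [hx2, Real.exp_neg]; field_simp
  have hc1 : 0 < k * (1 - Real.exp (-η)) := mul_pos hk' (by linarith)
  have hc2 : 0 < k * (Real.exp η - 1) := mul_pos hk' (by linarith)
  have b1 := measure_exceedances_deviation_le hZ hind hx₁ hc1 n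
  have b2 := measure_exceedances_deviation_le hZ hind hx hc2 n
  rw [hnx1] at b1
  rw [hnx2] at b2
  have hsub : {ω | ¬ |Real.log (threshold Z n k ω / (n / k))| ≤ η} ≤ᵐ[P]
      ({ω | k * (1 - Real.exp (-η)) ≤ |exceedances Z n x₁ ω - k * Real.exp (-η)|} ∪
      {ω | k * (Real.exp η - 1) ≤ |exceedances Z n x₂ ω - k * Real.exp η|} : Set Ω) := by
    filter_upwards [ae_one_lt hZ] with ω hω hlog
    have hT := threshold_one_lt hkn hω
    by_contra hcon
    change ¬ (k * (1 - Real.exp (-η)) ≤ |exceedances Z n x₁ ω - k * Real.exp (-η)| ∨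
      k * (Real.exp η - 1) ≤ |exceedances Z n x₂ ω - k * Real.exp η|) at hcon
    rw [not_or, not_le, not_le] at hcon
    obtain ⟨h1, h2⟩ := hcon
    refine hlog ?_
    have h3 : threshold Z n k ω ≤ x₁ := by
      rw [← not_lt, lt_threshold_iff hkn]
      have := (abs_lt.1 h1).2
      rw [not_lt]; nlinarith
    have h4 : x₂ < threshold Z n k ω := by
      rw [lt_threshold_iff hkn]
      have := (abs_lt.1 h2).1
      nlinarith
    have hpos : 0 < threshold Z n k ω / (n / k) := by positivity
    rw [abs_le]
    constructor
    · rw [Real.le_log_iff_exp_le hpos, le_div_iff₀ (by positivity), mul_comm]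
      exact h4.le
    · rw [Real.log_le_iff_le_exp hpos, div_le_iff₀ (by positivity), mul_comm]
      exact h3
  refine (measure_mono_ae hsub).trans ((measure_union_le _ _).trans ((add_le_add b1 b2).trans
    (le_of_eq ?_)))
  have hne1 : 1 - Real.exp (-η) ≠ 0 := by linarith
  have hne2 : Real.exp η - 1 ≠ 0 := by linarith
  rw [← ENNReal.ofReal_add (by positivity) (by positivity)]
  congr 1
  field_simp

lemma IsIntermediate.eventually_lt {k : ℕ → ℕ} (hk : IsIntermediate k) :
    ∀ᶠ n in atTop, 0 < k n ∧ k n < n := by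
  filter_upwards [hk.1.eventually_gt_atTop 0, hk.tendsto_div_atTop.eventually_gt_atTop 1]
    with n h1 h2
  have : (0 : ℝ) < k n := by exact_mod_cast h1
  rw [lt_div_iff₀ this, one_mul] at h2
  exact ⟨h1, by exact_mod_cast h2⟩

/-- The threshold `Z_{n-k,n}` is equivalent to `n / k` in probability. -/
lemma IsIntermediate.tendsto_threshold (hZ : ∀ i, HasLaw (Z i) (paretoMeasure 1 1) P)
    (hind : iIndepFun Z P) {k : ℕ → ℕ} (hk : IsIntermediate k) {η : ℝ} (hη : 0 < η) :
    Tendsto (fun n : ℕ => P {ω | ¬ |Real.log (threshold Z n (k n) ω / (n / k n))| ≤ η}) atTop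
      (𝓝 0) := by
  have hkR : Tendsto (fun n => (k n : ℝ)) atTop atTop := tendsto_natCast_atTop_atTop.comp hk.1
  have h := ENNReal.tendsto_ofReal (hkR.const_div_atTop (Real.exp (-η) / (1 - Real.exp (-η)) ^ 2
        + Real.exp η / (Real.exp η - 1) ^ 2))
  rw [ENNReal.ofReal_zero] at h
  refine tendsto_of_tendsto_of_tendsto_of_le_of_le' tendsto_const_nhds h
    (.of_forall fun _ => bot_le) ?_
  filter_upwards [hk.eventually_lt, hk.tendsto_div_atTop.eventually_ge_atTop (Real.exp η)]
    with n h1 h2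
  refine measure_threshold_gt_le hZ hind h1.1 h1.2 hη ?_
  rw [Real.exp_neg, ← div_eq_mul_inv, one_le_div (Real.exp_pos _)]
  exact h2

end Threshold

/-! ### Conditional Wasserstein approximation. -/

section CondDistribHill

lemma aemeasurable_hillError {Ω : Type*} [MeasurableSpace Ω] {P : Measure Ω}
    {Z : ℕ → Ω → ℝ} (hZ : ∀ i, HasLaw (Z i) (paretoMeasure 1 1) P) (F : Measure ℝ)
    (γ : ℝ) (n k : ℕ) : AEMeasurable (hillError (tailQuantile F) Z γ n k) P := by
  have hs : AEMeasurable (sample (tailQuantile F) Z n) P := aemeasurable_pi_lambda _ fun i =>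
    (measurable_tailQuantile F).comp_aemeasurable (hZ i).aemeasurable
  have hg : Measurable fun x : Fin n → ℝ => Real.sqrt k * (hill k x - γ) := by
    have h : ∀ m, Measurable fun x : Fin n → ℝ => orderStat x m := measurable_orderStat
    unfold hill relExceed
    fun_prop
  exact hg.comp_aemeasurable hs

variable {Ω : Type*} [MeasurableSpace Ω] {P : Measure Ω} [IsProbabilityMeasure P] {Z : ℕ → Ω → ℝ}

lemma hasCondDistrib_hillError (hZ : ∀ i, HasLaw (Z i) (paretoMeasure 1 1) P)
    (hind : iIndepFun Z P) (F : Measure ℝ) (γ : ℝ) {n k : ℕ} (hkn : k < n) :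
    HasCondDistrib (hillError (tailQuantile F) Z γ n k) (threshold Z n k)
      (scaledKernel k (hillStat (tailQuantile F) γ k)) P := by
  refine hasCondDistrib_congr_left (hasCondDistrib_scaledKernel hZ hind hkn
    (measurable_hillStat (measurable_tailQuantile F) γ k) fun x u τ => ?_) ?_
  · simp only [hillStat, Function.comp_apply]
    rw [Equiv.sum_comp τ fun i => Real.log (tailQuantile F (u i) / tailQuantile F x)]
  · filter_upwards [ae_one_lt hZ] with ω hω
    rw [hillError, hill, relExceed_sample F hkn hω]
    rfl

/-- The normal limit, as a function of the Pareto variables above the threshold. -/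
lemma map_affine_coupledNormal {k : ℕ} (hk : 0 < k) {γ : ℝ} (c : ℝ) :
    (Measure.pi fun _ : Fin k => paretoMeasure 1 1).map (fun y => c + γ * coupledNormal k y)
      = gaussianReal c (Real.toNNReal (γ ^ 2)) := by
  have hm := measurable_coupledNormal k
  calc (Measure.pi fun _ : Fin k => paretoMeasure 1 1).map (fun y => c + γ * coupledNormal k y)
      = (((Measure.pi fun _ : Fin k => paretoMeasure 1 1).map (coupledNormal k)).map
          fun x => γ * x).map fun x => c + x := by
        rw [Measure.map_map (by fun_prop) hm, Measure.map_map (by fun_prop) (by fun_prop)]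
        rfl
    _ = gaussianReal c (Real.toNNReal (γ ^ 2)) := by
        rw [map_coupledNormal hk, gaussianReal_map_const_mul, gaussianReal_map_const_add, mul_zero,
          zero_add, mul_one, Real.toNNReal_of_nonneg (sq_nonneg γ)]

lemma wasserstein_scaledKernel_hillStat_le {U : ℝ → ℝ} (hU : Measurable U) (γ : ℝ) {p : ℝ}
    (hp : 0 < p) {k : ℕ} (hk : 0 < k) (c t : ℝ) :
    wasserstein edist p (scaledKernel k (hillStat U γ k) t)
        (gaussianReal c (Real.toNNReal (γ ^ 2)))
      ≤ eLpNorm (fun y => hillStat U γ k (t, fun i => t * y i) - (c + γ * coupledNormal k y))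
          (ENNReal.ofReal p) (Measure.pi fun _ : Fin k => paretoMeasure 1 1) := by
  have hm := measurable_coupledNormal k
  have hh := measurable_hillStat hU γ k
  rw [scaledKernel_apply hh, ← map_affine_coupledNormal hk c]
  refine (wasserstein_map_le _ _ hp (hh.comp (by fun_prop)) (by fun_prop)).trans (le_of_eq ?_)
  rw [eLpNorm_eq_lintegral_rpow_enorm_toReal (by simpa using hp) ENNReal.ofReal_ne_top,
    ENNReal.toReal_ofReal hp.le]
  simp only [edist_eq_enorm_sub]
  rfl

/-- Conditionally on the threshold, the Hill estimator is asymptotically normal in Wasserstein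
distance. -/
lemma SecondOrder.exists_wasserstein_decomposition {F : Measure ℝ} {A : ℝ → ℝ} {γ ρ p : ℝ}
    (hA : SecondOrder (tailQuantile F) A γ ρ) (hγ : 0 < γ) (hρ : ρ ≤ 0) (hp : 1 ≤ p)
    (hZ : ∀ i, HasLaw (Z i) (paretoMeasure 1 1) P) (hind : iIndepFun Z P)
    {k : ℕ → ℕ} (hk : IsIntermediate k) {κ : ℕ → Kernel ℝ ℝ} (hκ : ∀ n, IsMarkovKernel (κ n))
    (hcond : ∀ n, HasCondDistrib (hillError (tailQuantile F) Z γ n (k n))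
      (threshold Z n (k n)) (κ n) P) :
    ∃ R S : ℕ → Ω → ℝ≥0∞,
      (∀ n ω, wasserstein edist p (κ n (threshold Z n (k n) ω))
        (gaussianReal (Real.sqrt (k n) * A (n / k n) * bias ρ) (Real.toNNReal (γ ^ 2)))
          = R n ω + S n ω) ∧
      IsBigOP P R (fun n => 1 / Real.sqrt (k n)) ∧
      IsLittleOP P S (fun n => Real.sqrt (k n) * A (n / k n)) := by
  obtain ⟨C, hC, hkey⟩ := hA.eLpNorm_hillStat_sub_le hγ hρ (monotoneOn_tailQuantile F)
    (measurable_tailQuantile F) hp hZ hind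
  set W : ℕ → Ω → ℝ≥0∞ := fun n ω => wasserstein edist p (κ n (threshold Z n (k n) ω))
    (gaussianReal (Real.sqrt (k n) * A (n / k n) * bias ρ) (Real.toNNReal (γ ^ 2))) with hW
  -- Truncating at $C/\sqrt k$ makes the first part deterministically of the right order. The excess
  -- is below $c\sqrt k\,|A(n/k)|$ as soon as the threshold is close to $n/k$.
  refine ⟨fun n ω => min (W n ω) (ENNReal.ofReal (C / Real.sqrt (k n))),
    fun n ω => W n ω - min (W n ω) (ENNReal.ofReal (C / Real.sqrt (k n))),
    fun n ω => (add_tsub_cancel_of_le (min_le_left _ _)).symm,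
    fun ε _ => ⟨C, .of_forall fun n => ?_⟩, fun c hc => ?_⟩
  · refine (le_of_eq ?_).trans bot_le
    refine measure_mono_null (fun ω hω => ?_) measure_empty
    simp only [Set.mem_ofPred_eq, abs_of_nonneg (one_div_nonneg.2 (Real.sqrt_nonneg (k n : ℝ))),
      mul_one_div] at hω
    exact (hω.not_ge (min_le_right _ _)).elim
  · obtain ⟨η, hη, hev⟩ := hkey k hk c hc
    refine tendsto_of_tendsto_of_tendsto_of_le_of_le' tendsto_const_nhds
      (hk.tendsto_threshold hZ hind hη) (.of_forall fun _ => bot_le) ?_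
    filter_upwards [hev, hk.eventually_lt] with n hn hkn
    have hmark := isMarkovKernel_scaledKernel
      (measurable_hillStat (measurable_tailQuantile F) γ (k n))
    have hmn := hκ n
    have hver := ae_of_ae_map (hcond n).aemeasurable_fst (ae_eq_of_hasCondDistrib (hcond n)
      (hasCondDistrib_hillError hZ hind F γ hkn.2))
    refine measure_mono_ae ?_
    filter_upwards [hver, ae_one_lt hZ] with ω h1 h2 h3 h4
    refine (not_lt.2 ?_) h3
    have h5 := (wasserstein_scaledKernel_hillStat_le (measurable_tailQuantile F) γ
      (by linarith) hkn.1 (Real.sqrt (k n) * A (n / k n) * bias ρ) (threshold Z n (k n) ω)).trans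
      (hn _ (by linarith [threshold_one_lt hkn.2 h2]) h4)
    rw [← h1] at h5
    rcases le_total (W n ω) (ENNReal.ofReal (C / Real.sqrt (k n))) with h | h
    · rw [min_eq_left h, tsub_self]
      exact bot_le
    · rw [min_eq_right h]
      exact tsub_le_iff_left.2 h5

end CondDistribHill

/-! ### Weak convergence and integration of conditional probabilities. -/

section WeakConvergence

/-- Bounded half-open intervals form a π-system containing arbitrarily small neighbourhoods of each
point, and their masses are differences of distribution functions. -/
lemma tendsto_of_tendsto_measureReal_Iic {μ : ℕ → ProbabilityMeasure ℝ} {ν : ProbabilityMeasure ℝ}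
    (h : ∀ x, Tendsto (fun n => (μ n : Measure ℝ).real (Set.Iic x)) atTop
      (𝓝 ((ν : Measure ℝ).real (Set.Iic x)))) : Tendsto μ atTop (𝓝 ν) := by
  have hIoc : ∀ (η : ProbabilityMeasure ℝ) {a b : ℝ}, a < b → (η : Measure ℝ).real (Set.Ioc a b)
      = (η : Measure ℝ).real (Set.Iic b) - (η : Measure ℝ).real (Set.Iic a) := by
    intro η a b hab
    have hd : Set.Ioc a b = Set.Iic b \ Set.Iic a := by
      ext z
      simp [and_comm]
    rw [hd, measureReal_sdiff (Set.Iic_subset_Iic.2 hab.le) measurableSet_Iic]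
  refine IsPiSystem.tendsto_probabilityMeasure_of_tendsto_of_mem
    (isPiSystem_Ioc_mem (Set.univ : Set ℝ) Set.univ) ?_ ?_ ?_
  · rintro s ⟨a, _, b, _, hab, rfl⟩
    exact measurableSet_Ioc
  · intro u hu x hx
    obtain ⟨a, b, hxab, hab⟩ := mem_nhds_iff_exists_Ioo_subset.1 (hu.mem_nhds hx)
    obtain ⟨b', hb1, hb2⟩ := exists_between hxab.2
    exact ⟨Set.Ioc a b', ⟨a, trivial, b', trivial, hxab.1.trans hb1, rfl⟩,
      Ioc_mem_nhds hxab.1 hb1, fun z hz => hab ⟨hz.1, hz.2.trans_lt hb2⟩⟩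
  · rintro s ⟨a, _, b, _, hab, rfl⟩
    have h1 := (h b).sub (h a)
    simp only [← hIoc _ hab] at h1
    rw [← NNReal.tendsto_coe]
    exact h1

/-- After disintegration along `X`, the integrand differs from $q$ by at most $\delta$ off `bad`,
and by at most 1 on it. -/
lemma abs_measureReal_sub_le_of_hasCondDistrib {Ω α β : Type*} [MeasurableSpace Ω]
    [MeasurableSpace α] [MeasurableSpace β] {P : Measure Ω} [IsProbabilityMeasure P] {X : Ω → α}
    {Y : Ω → β} {κ : Kernel α β} [IsMarkovKernel κ] (h : HasCondDistrib Y X κ P) {s : Set β}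
    (hs : MeasurableSet s) {q δ : ℝ} (hq0 : 0 ≤ q) (hq1 : q ≤ 1) (hδ : 0 ≤ δ) {bad : Set α}
    (hbad : MeasurableSet bad) (hκ : ∀ t ∉ bad, |(κ t).real s - q| ≤ δ) {B : Set α}
    (hB : MeasurableSet B) :
    |P.real {ω | Y ω ∈ s ∧ X ω ∈ B} - q * P.real {ω | X ω ∈ B}|
      ≤ δ + P.real {ω | X ω ∈ bad} := by
  have hX := h.aemeasurable_fst
  have hprob := Measure.isProbabilityMeasure_map (μ := P) hX
  have hm : Measurable fun t => (κ t).real s := (κ.measurable_coe hs).ennreal_toReal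
  have hb1 : ∀ t, (κ t).real s ≤ 1 := fun t => measureReal_le_one
  have hb0 : ∀ t, 0 ≤ (κ t).real s := fun t => measureReal_nonneg
  have hint : Integrable (fun t => (κ t).real s) (P.map X) :=
    Integrable.of_bound hm.aestronglyMeasurable 1 (.of_forall fun t => by
      rw [Real.norm_eq_abs, abs_of_nonneg (hb0 t)]; exact hb1 t)
  have hset : ∀ {D : Set α}, MeasurableSet D → P.real {ω | X ω ∈ D} = (P.map X).real D :=
    fun hD => by
      rw [measureReal_def, measureReal_def, Measure.map_apply_of_aemeasurable hX hD]
      rfl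
  have h1 : P.real {ω | Y ω ∈ s ∧ X ω ∈ B} = ∫ t in B, (κ t).real s ∂(P.map X) := by
    have h2 : P {ω | Y ω ∈ s ∧ X ω ∈ B} = ∫⁻ t in B, κ t s ∂(P.map X) := by
      rw [← Measure.compProd_apply_prod hB hs, ← h.map_eq,
        Measure.map_apply_of_aemeasurable h.aemeasurable (hB.prod hs)]
      congr 1
      ext ω
      exact and_comm
    rw [measureReal_def, h2]
    exact (integral_toReal (κ.measurable_coe hs).aemeasurable
      (.of_forall fun t => measure_lt_top _ _)).symm
  have h3 : q * P.real {ω | X ω ∈ B} = ∫ _ in B, q ∂(P.map X) := by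
    rw [hset hB, setIntegral_const, smul_eq_mul, mul_comm]
  rw [h1, h3, ← integral_sub hint.integrableOn (integrable_const q).integrableOn, hset hbad]
  have hint2 : Integrable (fun t => |(κ t).real s - q|) (P.map X) :=
    (hint.sub (integrable_const q)).abs
  have hint3 : Integrable (fun t => δ + bad.indicator (1 : α → ℝ) t) (P.map X) :=
    (integrable_const δ).add ((integrable_const 1).indicator hbad)
  calc |∫ t in B, ((κ t).real s - q) ∂(P.map X)|
      ≤ ∫ t in B, |(κ t).real s - q| ∂(P.map X) := abs_integral_le_integral_abs
    _ ≤ ∫ t, |(κ t).real s - q| ∂(P.map X) :=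
        setIntegral_le_integral hint2 (.of_forall fun t => abs_nonneg _)
    _ ≤ ∫ t, (δ + bad.indicator 1 t) ∂(P.map X) := by
        refine integral_mono hint2 hint3 fun t => ?_
        by_cases ht : t ∈ bad
        · simp only [ht, Set.indicator_of_mem, Pi.one_apply]
          rw [abs_le]
          constructor <;> linarith [hb0 t, hb1 t]
        · simpa [ht] using hκ t ht
    _ = δ + (P.map X).real bad := by
        refine (integral_add (integrable_const δ) ((integrable_const 1).indicator hbad)).trans ?_
        rw [integral_const, probReal_univ, one_smul]
        exact congrArg (δ + ·) (integral_indicator_one hbad)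

end WeakConvergence

/-! ### Limit law and asymptotic independence. -/

section AsymptoticIndependence

/-- Markov's inequality at level $\tau$ bounds the exceptional mass by $e/\tau$. Elsewhere the shift
$2\tau$ pays for the approximation error and for the change of centre. -/
lemma measureReal_Iic_sandwich {β : Type*} [MeasurableSpace β] (π : Measure β)
    [IsProbabilityMeasure π] {h g : β → ℝ} (hh : Measurable h) (hg : Measurable g)
    {m c τ e : ℝ} (hτ : 0 < τ) (he : 0 ≤ e) (hmc : |m - c| ≤ τ)
    (hD : eLpNorm (fun y => h y - (m + g y)) 1 π ≤ ENNReal.ofReal e) (x : ℝ) :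
    (π.map fun y => c + g y).real (Set.Iic (x - 2 * τ)) - e / τ ≤ (π.map h).real (Set.Iic x) ∧
      (π.map h).real (Set.Iic x) ≤ (π.map fun y => c + g y).real (Set.Iic (x + 2 * τ)) + e / τ := by
  have hcg : Measurable fun y => c + g y := by fun_prop
  have hDm : Measurable fun y => h y - (m + g y) := by fun_prop
  obtain ⟨hmc1, hmc2⟩ := abs_le.1 hmc
  set S : Set β := {y | τ ≤ |h y - (m + g y)|} with hS
  have hSle : π.real S ≤ e / τ := by
    have h1 := mul_meas_ge_le_pow_eLpNorm' π one_ne_zero ENNReal.one_ne_top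
      hDm.aestronglyMeasurable (ENNReal.ofReal τ)
    rw [ENNReal.toReal_one, ENNReal.rpow_one, ENNReal.rpow_one] at h1
    have h2 : {y | ENNReal.ofReal τ ≤ ‖h y - (m + g y)‖ₑ} = S := by
      ext y
      rw [Set.mem_ofPred_eq, Real.enorm_eq_ofReal_abs, ENNReal.ofReal_le_ofReal_iff (abs_nonneg _)]
      rfl
    rw [h2] at h1
    have h3 := ENNReal.toReal_mono ENNReal.ofReal_ne_top (h1.trans hD)
    rw [ENNReal.toReal_mul, ENNReal.toReal_ofReal hτ.le, ENNReal.toReal_ofReal he] at h3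
    rw [le_div_iff₀' hτ]
    exact h3
  rw [map_measureReal_apply hcg measurableSet_Iic, map_measureReal_apply hh measurableSet_Iic,
    map_measureReal_apply hcg measurableSet_Iic]
  constructor
  · have hsub : (fun y => c + g y) ⁻¹' Set.Iic (x - 2 * τ) ⊆ h ⁻¹' Set.Iic x ∪ S := by
      intro y hy
      by_contra hn
      rw [Set.mem_union, not_or] at hn
      have h1 : x < h y := not_le.1 hn.1
      have h2 : |h y - (m + g y)| < τ := not_le.1 hn.2
      have h3 : c + g y ≤ x - 2 * τ := hy
      linarith [(abs_lt.1 h2).2]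
    linarith [(measureReal_mono hsub (measure_ne_top π _)).trans (measureReal_union_le _ _)]
  · have hsub : h ⁻¹' Set.Iic x ⊆ (fun y => c + g y) ⁻¹' Set.Iic (x + 2 * τ) ∪ S := by
      intro y hy
      by_contra hn
      rw [Set.mem_union, not_or] at hn
      have h1 : x + 2 * τ < c + g y := not_le.1 hn.1
      have h2 : |h y - (m + g y)| < τ := not_le.1 hn.2
      have h3 : h y ≤ x := hy
      linarith [(abs_lt.1 h2).1]
    linarith [(measureReal_mono hsub (measure_ne_top π _)).trans (measureReal_union_le _ _)]

variable {Ω : Type*} [MeasurableSpace Ω] {P : Measure Ω} [IsProbabilityMeasure P] {Z : ℕ → Ω → ℝ}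
  {F : Measure ℝ} {A : ℝ → ℝ} {γ ρ : ℝ} {k : ℕ → ℕ} {lam : ℝ}

/-- The conditional distribution function of the normalized Hill estimator converges, uniformly
over thresholds of the order of `n / k`. -/
lemma SecondOrder.abs_condCdf_sub_le (hA : SecondOrder (tailQuantile F) A γ ρ) (hγ : 0 < γ)
    (hρ : ρ ≤ 0) (hZ : ∀ i, HasLaw (Z i) (paretoMeasure 1 1) P) (hind : iIndepFun Z P)
    (hk : IsIntermediate k)
    (hlam : Tendsto (fun n => Real.sqrt (k n) * A (n / k n)) atTop (𝓝 lam)) (x : ℝ) {δ : ℝ}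
    (hδ : 0 < δ) :
    ∃ η, 0 < η ∧ ∀ᶠ n : ℕ in atTop, ∀ t, 0 < t → |Real.log (t / (n / k n))| ≤ η →
      |(scaledKernel (k n) (hillStat (tailQuantile F) γ (k n)) t).real (Set.Iic x)
        - (gaussianReal (lam * bias ρ) (Real.toNNReal (γ ^ 2))).real (Set.Iic x)| ≤ δ := by
  have hv : Real.toNNReal (γ ^ 2) ≠ 0 := by
    rw [ne_eq, Real.toNNReal_eq_zero, not_le]
    positivity
  set G := gaussianReal (lam * bias ρ) (Real.toNNReal (γ ^ 2)) with hG
  have hna : NullSingletonClass G := nullSingletonClass_gaussianReal hv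
  obtain ⟨r, hr, hcont⟩ := Metric.continuousAt_iff.1 (continuous_cdf G).continuousAt (δ / 2)
    (half_pos hδ)
  -- Then $2\tau<r$, within the range where the Gaussian distribution function moves by less than
  -- $\delta/2$.
  set τ := r / 4 with hτ
  have hτ0 : 0 < τ := by positivity
  have hcdf : ∀ y, |y - x| < r → |G.real (Set.Iic y) - G.real (Set.Iic x)| < δ / 2 := by
    intro y hy
    have := hcont (x := y) hy
    rwa [Real.dist_eq, cdf_eq_real, cdf_eq_real] at this
  obtain ⟨C, hC, hkey⟩ := hA.eLpNorm_hillStat_sub_le hγ hρ (monotoneOn_tailQuantile F)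
    (measurable_tailQuantile F) le_rfl hZ hind
  -- As $\sqrt k\,|A(n/k)|\le|\lambda|+1$ eventually, this part of the $L^1$ error is at most
  -- $\delta\tau/4$. With the $1/\sqrt k$ part it stays below $\delta\tau/2$, so Markov's inequality
  -- loses at most $\delta/2$.
  set ε := δ * τ / (4 * (|lam| + 1)) with hε
  have hε0 : 0 < ε := by positivity
  obtain ⟨η, hη, hev⟩ := hkey k hk ε hε0
  refine ⟨η, hη, ?_⟩
  have hsq : Tendsto (fun n => C / Real.sqrt (k n)) atTop (𝓝 0) :=
    (Real.tendsto_sqrt_atTop.comp (tendsto_natCast_atTop_atTop.comp hk.1)).const_div_atTop C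
  have hb := hlam.mul_const (bias ρ)
  filter_upwards [hev, hk.eventually_lt, hsq.eventually (ge_mem_nhds (show 0 < δ * τ / 4 by
    positivity)), hlam.abs.eventually (ge_mem_nhds (lt_add_one |lam|)),
    hb.eventually (Metric.closedBall_mem_nhds _ hτ0)] with n h1 h2 h3 h4 h5 t ht hlog
  have h6 := h1 t ht hlog
  have hm := measurable_coupledNormal (k n)
  have hh := measurable_hillStat (measurable_tailQuantile F) γ (k n)
  rw [← ENNReal.ofReal_add (by positivity) (by positivity)] at h6
  have h7 : C / Real.sqrt (k n) + ε * |Real.sqrt (k n) * A (n / k n)| ≤ δ * τ / 2 := by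
    have : ε * |Real.sqrt (k n) * A (n / k n)| ≤ ε * (|lam| + 1) := by gcongr
    have h8 : ε * (|lam| + 1) = δ * τ / 4 := by rw [hε]; field_simp
    linarith
  have h9 := h6.trans (ENNReal.ofReal_le_ofReal h7)
  rw [ENNReal.ofReal_one] at h9
  obtain ⟨h10, h11⟩ := measureReal_Iic_sandwich
    (Measure.pi fun _ : Fin (k n) => paretoMeasure 1 1)
    (h := fun y => hillStat (tailQuantile F) γ (k n) (t, fun i => t * y i))
    (g := fun y => γ * coupledNormal (k n) y) (hh.comp (by fun_prop)) (by fun_prop) hτ0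
    (by positivity) h5 h9 x
  rw [map_affine_coupledNormal h2.1] at h10 h11
  rw [scaledKernel_apply hh]
  have h12 : δ * τ / 2 / τ = δ / 2 := by field_simp
  rw [h12] at h10 h11
  have h13 := abs_lt.1 (hcdf (x - 2 * τ) (by
    rw [sub_sub_cancel_left, abs_neg, abs_of_pos (by positivity)]; linarith))
  have h14 := abs_lt.1 (hcdf (x + 2 * τ) (by
    rw [add_sub_cancel_left, abs_of_pos (by positivity)]; linarith))
  rw [abs_le]
  constructor <;> linarith [h13.1, h14.2]

/-- The Gaussian probability is a common value for all thresholds near $n/k$, and the others have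
vanishing probability. The whole line as `B n` gives the limit law; general events give
independence. -/
lemma SecondOrder.tendsto_joint (hA : SecondOrder (tailQuantile F) A γ ρ) (hγ : 0 < γ)
    (hρ : ρ ≤ 0) (hZ : ∀ i, HasLaw (Z i) (paretoMeasure 1 1) P) (hind : iIndepFun Z P)
    (hk : IsIntermediate k)
    (hlam : Tendsto (fun n => Real.sqrt (k n) * A (n / k n)) atTop (𝓝 lam)) (x : ℝ)
    {B : ℕ → Set ℝ} (hB : ∀ n, MeasurableSet (B n)) :
    Tendsto (fun n => P.real {ω | hillError (tailQuantile F) Z γ n (k n) ω ∈ Set.Iic x ∧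
        threshold Z n (k n) ω ∈ B n}
      - (gaussianReal (lam * bias ρ) (Real.toNNReal (γ ^ 2))).real (Set.Iic x)
        * P.real {ω | threshold Z n (k n) ω ∈ B n}) atTop (𝓝 0) := by
  rw [Metric.tendsto_nhds]
  intro δ hδ
  obtain ⟨η, hη, hev⟩ := hA.abs_condCdf_sub_le hγ hρ hZ hind hk hlam x
    (show 0 < δ / 3 by positivity)
  have hbad := (hk.tendsto_threshold hZ hind hη).eventually (ge_mem_nhds
    (show (0 : ℝ≥0∞) < ENNReal.ofReal (δ / 3) by simpa using hδ))
  filter_upwards [hev, hk.eventually_lt, hbad] with n h1 h2 h3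
  have hmark := isMarkovKernel_scaledKernel
    (measurable_hillStat (measurable_tailQuantile F) γ (k n))
  have hcond := hasCondDistrib_hillError hZ hind F γ h2.2
  set bad : Set ℝ := {t | ¬ (0 < t ∧ |Real.log (t / (n / k n))| ≤ η)} with hbaddef
  have hbm : MeasurableSet bad := by
    refine ((measurableSet_lt measurable_const measurable_id).inter
      (measurableSet_le (f := fun t : ℝ => |Real.log (t / (n / k n))|) ?_ measurable_const)).compl
    fun_prop
  have h4 := abs_measureReal_sub_le_of_hasCondDistrib hcond (measurableSet_Iic (a := x))
    (measureReal_nonneg (μ := gaussianReal (lam * bias ρ) (Real.toNNReal (γ ^ 2)))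
      (s := Set.Iic x)) measureReal_le_one (show 0 ≤ δ / 3 by positivity) hbm
    (fun t ht => by
      have ht' := not_not.1 ht
      exact h1 t ht'.1 ht'.2) (hB n)
  have h5 : P.real {ω | threshold Z n (k n) ω ∈ bad} ≤ δ / 3 := by
    have h6 : P {ω | threshold Z n (k n) ω ∈ bad}
        ≤ P {ω | ¬ |Real.log (threshold Z n (k n) ω / (n / k n))| ≤ η} := by
      refine measure_mono_ae ?_
      filter_upwards [ae_one_lt hZ] with ω hω h7 h8
      exact h7 ⟨by linarith [threshold_one_lt h2.2 hω], h8⟩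
    rw [measureReal_def, ← ENNReal.toReal_ofReal (show 0 ≤ δ / 3 by positivity)]
    exact ENNReal.toReal_mono ENNReal.ofReal_ne_top (h6.trans h3)
  rw [Real.dist_eq, sub_zero]
  linarith

lemma SecondOrder.tendsto_measureReal_hillError (hA : SecondOrder (tailQuantile F) A γ ρ)
    (hγ : 0 < γ) (hρ : ρ ≤ 0) (hZ : ∀ i, HasLaw (Z i) (paretoMeasure 1 1) P)
    (hind : iIndepFun Z P) (hk : IsIntermediate k)
    (hlam : Tendsto (fun n => Real.sqrt (k n) * A (n / k n)) atTop (𝓝 lam)) (x : ℝ) :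
    Tendsto (fun n => P.real {ω | hillError (tailQuantile F) Z γ n (k n) ω ≤ x}) atTop
      (𝓝 ((gaussianReal (lam * bias ρ) (Real.toNNReal (γ ^ 2))).real (Set.Iic x))) := by
  have h := hA.tendsto_joint hγ hρ hZ hind hk hlam x (B := fun _ => Set.univ) fun _ => .univ
  simp only [Set.mem_univ, and_true, Set.mem_Iic, Set.ofPred_true, probReal_univ, mul_one] at h
  exact tendsto_sub_nhds_zero_iff.1 h

/-- Asymptotic normality of the Hill estimator. -/
lemma SecondOrder.tendstoInDistribution_hillError (hA : SecondOrder (tailQuantile F) A γ ρ)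
    (hγ : 0 < γ) (hρ : ρ ≤ 0) (hZ : ∀ i, HasLaw (Z i) (paretoMeasure 1 1) P)
    (hind : iIndepFun Z P) (hk : IsIntermediate k)
    (hlam : Tendsto (fun n => Real.sqrt (k n) * A (n / k n)) atTop (𝓝 lam)) :
    TendstoInDistribution (fun n => hillError (tailQuantile F) Z γ n (k n)) atTop
      (id : ℝ → ℝ) (fun _ => P) (gaussianReal (lam * bias ρ) (Real.toNNReal (γ ^ 2))) where
  forall_aemeasurable n := aemeasurable_hillError hZ F γ n (k n)
  aemeasurable_limit := aemeasurable_id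
  tendsto := by
    refine tendsto_of_tendsto_measureReal_Iic fun x => ?_
    have h := hA.tendsto_measureReal_hillError hγ hρ hZ hind hk hlam x
    simp only [ProbabilityMeasure.coe_mk, Measure.map_id]
    refine h.congr fun n => ?_
    rw [measureReal_def, measureReal_def, Measure.map_apply_of_aemeasurable
      (aemeasurable_hillError hZ F γ n (k n)) measurableSet_Iic]
    rfl

/-- Asymptotic independence of the Hill estimator and the threshold. -/
lemma SecondOrder.tendsto_asymptotic_independence (hA : SecondOrder (tailQuantile F) A γ ρ)
    (hγ : 0 < γ) (hρ : ρ ≤ 0) (hZ : ∀ i, HasLaw (Z i) (paretoMeasure 1 1) P)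
    (hind : iIndepFun Z P) (hk : IsIntermediate k)
    (hlam : Tendsto (fun n => Real.sqrt (k n) * A (n / k n)) atTop (𝓝 lam)) (x : ℝ)
    {B : ℕ → Set ℝ} (hB : ∀ n, MeasurableSet (B n)) :
    Tendsto (fun n =>
      P.real {ω | hillError (tailQuantile F) Z γ n (k n) ω ≤ x ∧
          orderStat (sample (tailQuantile F) Z n ω) (n - k n) ∈ B n}
        - P.real {ω | hillError (tailQuantile F) Z γ n (k n) ω ≤ x}
          * P.real {ω | orderStat (sample (tailQuantile F) Z n ω) (n - k n) ∈ B n})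
      atTop (𝓝 0) := by
  set q := (gaussianReal (lam * bias ρ) (Real.toNNReal (γ ^ 2))).real (Set.Iic x) with hq
  -- Almost surely $X_{n-k,n}=U(Z_{n-k,n})$, so events on $X_{n-k,n}$ are pulled back to
  -- $Z_{n-k,n}$.
  set B' : ℕ → Set ℝ := fun n => tailQuantile F ⁻¹' B n with hB'
  have h1 := hA.tendsto_joint hγ hρ hZ hind hk hlam x (B := B')
    fun n => measurable_tailQuantile F (hB n)
  -- Replaces the Gaussian probability by that of the Hill error; the other factor is a probability,
  -- hence bounded.
  have h2 := (tendsto_sub_nhds_zero_iff.2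
    (hA.tendsto_measureReal_hillError hγ hρ hZ hind hk hlam x)).zero_mul_isBoundedUnder_le
    (g := fun n => P.real {ω | threshold Z n (k n) ω ∈ B' n})
    ⟨1, by
      rw [eventually_map]
      exact .of_forall fun n => by
        rw [Function.comp_apply, Real.norm_eq_abs, abs_of_nonneg measureReal_nonneg]
        exact measureReal_le_one⟩
  have h3 := h1.sub h2
  rw [sub_zero] at h3
  refine h3.congr' ?_
  filter_upwards [hk.eventually_lt] with n hn
  have he : ∀ᵐ ω ∂P, (orderStat (sample (tailQuantile F) Z n ω) (n - k n) ∈ B n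
      ↔ threshold Z n (k n) ω ∈ B' n) := by
    filter_upwards [ae_one_lt hZ] with ω hω
    rw [orderStat_sample F (by omega) (by omega) hω]
    rfl
  have e1 : P.real {ω | hillError (tailQuantile F) Z γ n (k n) ω ≤ x ∧
      orderStat (sample (tailQuantile F) Z n ω) (n - k n) ∈ B n}
      = P.real {ω | hillError (tailQuantile F) Z γ n (k n) ω ∈ Set.Iic x ∧
        threshold Z n (k n) ω ∈ B' n} := by
    refine measureReal_congr ?_
    filter_upwards [he] with ω hω
    exact propext (and_congr_right fun _ => hω)
  have e2 : P.real {ω | orderStat (sample (tailQuantile F) Z n ω) (n - k n) ∈ B n}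
      = P.real {ω | threshold Z n (k n) ω ∈ B' n} := by
    refine measureReal_congr ?_
    filter_upwards [he] with ω hω
    exact propext hω
  rw [e1, e2]
  ring

end AsymptoticIndependence

end HillBias

/-! ### Assembly of the three statements. -/

theorem mainTheorem6
    (F : Measure ℝ) [IsProbabilityMeasure F] (A : ℝ → ℝ) (γ ρ : ℝ) (hγ : 0 < γ) (hρ : ρ ≤ 0)
    (hA : SecondOrder (tailQuantile F) A γ ρ)
    {Ω : Type*} [MeasurableSpace Ω] (P : Measure Ω) [IsProbabilityMeasure P]
    (Z : ℕ → Ω → ℝ) (hZ : ∀ i, HasLaw (Z i) (paretoMeasure 1 1) P) (hind : iIndepFun Z P) :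
    (∀ p : ℝ, 1 ≤ p →
      (∀ t₀ : ℝ, 1 ≤ t₀ → 0 < tailQuantile F t₀ → ∀ (n k : ℕ) (hk : 0 < k), k < n →
        (∃ κ : Kernel ℝ (ProbabilityMeasure ℝ), IsMarkovKernel κ ∧
          HasCondDistrib (fun ω => empirical k hk (relExceed k (sample (tailQuantile F) Z n ω)))
            (threshold Z n k) κ P ∧
          ∀ t : ℝ, t₀ ≤ t →
            wasserstein₂ p (κ t) (correctedLaw γ ρ (A t) k hk) ≤
              bound (tailQuantile F) A γ ρ p t) ∧
        (∀ κ : Kernel ℝ (ProbabilityMeasure ℝ), IsMarkovKernel κ →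
          HasCondDistrib (fun ω => empirical k hk (relExceed k (sample (tailQuantile F) Z n ω)))
            (threshold Z n k) κ P →
          ∀ᵐ t ∂(P.map (threshold Z n k)), t₀ ≤ t →
            wasserstein₂ p (κ t) (correctedLaw γ ρ (A t) k hk) ≤
              bound (tailQuantile F) A γ ρ p t)) ∧
      (∀ ε : ℝ, 0 < ε → ∀ᶠ t in atTop,
        bound (tailQuantile F) A γ ρ p t ≤ ENNReal.ofReal (ε * |A t|)) ∧
      (∀ k : ℕ → ℕ, IsIntermediate k →
        ∀ κ : ℕ → Kernel ℝ ℝ, (∀ n, IsMarkovKernel (κ n)) →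
          (∀ n, HasCondDistrib (hillError (tailQuantile F) Z γ n (k n))
            (threshold Z n (k n)) (κ n) P) →
          ∃ R S : ℕ → Ω → ℝ≥0∞,
            (∀ n ω, wasserstein edist p (κ n (threshold Z n (k n) ω))
              (gaussianReal (Real.sqrt (k n) * A (n / k n) * bias ρ) (Real.toNNReal (γ ^ 2)))
                = R n ω + S n ω) ∧
            IsBigOP P R (fun n => 1 / Real.sqrt (k n)) ∧
            IsLittleOP P S (fun n => Real.sqrt (k n) * A (n / k n)))) ∧
    (∀ k : ℕ → ℕ, IsIntermediate k →
      ∀ lam : ℝ, Tendsto (fun n => Real.sqrt (k n) * A (n / k n)) atTop (𝓝 lam) →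
        TendstoInDistribution (fun n => hillError (tailQuantile F) Z γ n (k n)) atTop
          (id : ℝ → ℝ) (fun _ => P)
          (gaussianReal (lam * bias ρ) (Real.toNNReal (γ ^ 2))) ∧
        (∀ (x : ℝ) (B : ℕ → Set ℝ), (∀ n, MeasurableSet (B n)) →
          Tendsto (fun n =>
            P.real {ω | hillError (tailQuantile F) Z γ n (k n) ω ≤ x ∧
                orderStat (sample (tailQuantile F) Z n ω) (n - k n) ∈ B n}
              - P.real {ω | hillError (tailQuantile F) Z γ n (k n) ω ≤ x}
                * P.real {ω | orderStat (sample (tailQuantile F) Z n ω) (n - k n) ∈ B n})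
            atTop (𝓝 0))) := by
  have hU := monotoneOn_tailQuantile F
  have hUm := measurable_tailQuantile F
  refine ⟨fun p hp => ⟨fun t₀ ht₀ hpos n k hk hkn => ?_,
    fun ε hε => hA.bound_le hγ hρ hU hUm hp hε, fun k hk κ hκ hcond =>
      hA.exists_wasserstein_decomposition hγ hρ hp hZ hind hk hκ hcond⟩,
    fun k hk lam hlam => ⟨hA.tendstoInDistribution_hillError hγ hρ hZ hind hk hlam,
      fun x B hB => hA.tendsto_asymptotic_independence hγ hρ hZ hind hk hlam x hB⟩⟩
  have hmark := isMarkovKernel_scaledKernel (measurable_ratioEmpirical hUm hk)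
  have hver := hasCondDistrib_empirical hZ hind F hk hkn
  refine ⟨⟨_, hmark, hver, fun t ht => wasserstein₂_scaledKernel_le F A hγ hp ht₀ hpos hk ht⟩,
    fun κ hκ hcond => ?_⟩
  filter_upwards [ae_eq_of_hasCondDistrib hcond hver] with t ht htt
  rw [ht]
  exact wasserstein₂_scaledKernel_le F A hγ hp ht₀ hpos hk htt
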